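/- Let $k$ be a commutative ring and $(H,\alpha)$ a monoidal Hom-Hopf algebra over $k$, that is, a Hopf algebra in $\widetilde{\mathcal H}(\mathcal M_k)$, the category of pairs $(M,\mu)$ of a $k$-module and an automorphism, with tensor product $(M\otimes N,\mu\otimes\nu)$ over $k$, associativity constraint $(m\otimes n)\otimes p\mapsto\mu(m)\otimes(n\otimes\pi^{-1}(p))$ and unit constraints $x\otimes m\mapsto x\mu(m)$, $m\otimes x\mapsto x\mu(m)$. Write $\Delta(h)=h_1\otimes h_2$, and $S$ for the antipode. *The categories.* Morphisms below are $k$-linear maps that commute with the automorphisms and with all the given actions and coactions. - A right $(H,\alpha)$-Hom-module is $(V,\nu)$ with an action $v\lhd h$ such that $\nu(v\lhd h)=\nu(v)\lhd\alpha(h)$, $\nu(v)\lhd(gh)=(v\lhd g)\lhd\alpha(h)$, $v\lhd1=\nu(v)$. - A right-right Yetter-Drinfel'd Hom-module is moreover a right Hom-comodule, $v\mapsto v_{(0)}\otimes v_{(1)}$, with $v_{(0)}\lhd\alpha^{-1}(h_1)\otimes v_{(1)}\alpha^{-1}(h_2)=(v\lhd h_2)_{(0)}\otimes\alpha^{-1}(h_1(v\lhd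 h_2)_{(1)})$. - A left-covariant Hom-bimodule is an $(H,\alpha)$-Hom-bimodule $(M,\mu)$ with a left Hom-coaction $\rho(m)=m_{(-1)}\otimes m_{(0)}$ such that $\rho((hm)\alpha(g))=\Delta(\alpha(h))(\rho(m)\Delta(g))$. - A bicovariant Hom-bimodule has moreover a right Hom-coaction $\sigma(m)=m_{[0]}\otimes m_{[1]}$ with $\sigma((hm)\alpha(g))=\Delta(\alpha(h))(\sigma(m)\Delta(g))$ and $m_{(-1)}\otimes\sigma(m_{(0)})=\alpha(m_{[0](-1)})\otimes(m_{[0](0)}\otimes\alpha^{-1}(m_{[1]}))$. *The tensor structures.* Right Hom-modules and Yetter-Drinfel'd Hom-modules have the tensor product over $k$ with $(v\otimes w)\lhd h=v\lhd h_1\otimes w\lhd h_2$ and coaction $(v_{(0)}\otimes w_{(0)})\otimes v_{(1)}w_{(1)}$, the unit $(k,\mathrm{id})$ with trivial action and coaction, and the constraints of $\widetilde{\mathcal H}(\mathcal M_k)$. Left-covariant and bicovariant Hom-bimodules have the tensor product $M\otimes_HN$, the quotient of $M\otimes N$ by the relations $mh\otimes n=\mu(m)\otimes h\nu^{-1}(n)$,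 with automorphism $\mu\otimes_H\nu$ and $$h(m\otimes_Hn)=\alpha^{-1}(h)m\otimes_H\nu(n),\qquad (m\otimes_Hn)h=\mu(m)\otimes_Hn\alpha^{-1}(h),$$ $$\rho(m\otimes_Hn)=m_{(-1)}n_{(-1)}\otimes(m_{(0)}\otimes_Hn_{(0)}),\qquad \sigma(m\otimes_Hn)=(m_{[0]}\otimes_Hn_{[0]})\otimes m_{[1]}n_{[1]};$$ the unit is $(H,\alpha)$ with its multiplication as actions and $\Delta$ as coaction(s); the constraints are $(m\otimes_Hn)\otimes_Hp\mapsto\mu(m)\otimes_H(n\otimes_H\pi^{-1}(p))$, $h\otimes_Hm\mapsto hm$, $m\otimes_Hh\mapsto mh$. *The functors.* $F(V)=(H\otimes V,\alpha\otimes\nu)$ with $$h(g\otimes v)=\alpha^{-1}(h)g\otimes\nu(v),\qquad (g\otimes v)h=gh_1\otimes v\lhd h_2,\qquad \rho(g\otimes v)=\alpha(g_1)\otimes(g_2\otimes\nu^{-1}(v)),$$ in the second case also $\sigma(g\otimes v)=(g_1\otimes v_{(0)})\otimes g_2v_{(1)}$, and $F(f)=\mathrm{id}_H\otimes f$. $G(M)={}^{coH}M=\{m\in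 M:\rho(m)=1_H\otimes\mu^{-1}(m)\}$ with the restriction of $\mu$ and with $m\lhd h=P_L(mh)$, where $P_L(m)=S(m_{(-1)})m_{(0)}$, in the second case also with the restriction of $\sigma$ as coaction; on morphisms $G$ is the restriction. **Theorem.** The structures above are well-defined tensor categories, $F$ and $G$ are well-defined functors, and they are mutually inverse tensor equivalences, with counit $H\otimes{}^{coH}M\to M$, $h\otimes m\mapsto hm$, 1. between the category of right $(H,\alpha)$-Hom-modules and the category of left-covariant $(H,\alpha)$-Hom-bimodules; 2. between the category of right-right Yetter-Drinfel'd $(H,\alpha)$-Hom-modules and the category of bicovariant $(H,\alpha)$-Hom-bimodules. In both cases $F$ is a strong tensor functor with the unit isomorphism $\varphi_0:H\to H\otimes k$, $h\mapsto\alpha^{-1}(h)\otimes1$, and the isomorphisms $\varphi_2(V,W):(H\otimes V)\otimes_H(H\otimes W)\to H\otimes(V\otimes W)$, $$\varphi_2(V,W)((g\otimes v)\otimes_H(h\otimes w))=g\alpha(h_1)\otimes(\nu^{-1}(v)\lhd h_2\otimes w)$$ ($\nu$ the automorphism of $V$); $G$ has a strong tensor structure for which the unit and the counit of the equivalence are monoidal.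 -/

import Mathlib

open CategoryTheory
open scoped TensorProduct

universe u

/-! ## Monoidal Hom-Hopf algebras

Throughout, `k` is a commutative ring. Multiplications and actions are bilinear maps `A →ₗ B →ₗ C`,
i.e. linear maps `A ⊗ B → C`. For bilinear `f`, `g`, the map `TensorProduct.map₂ f g` sends
`(a ⊗ b, c ⊗ d)` to `f a c ⊗ g b d`. -/

/-- A monoidal Hom-algebra `(A, α)`: the automorphism `α` (`twist`) is multiplicative and unital,
`α(a)(bc) = (ab)α(c)` and `a1 = 1a = α(a)`. -/
structure MonoidalHomAlgebra (k A : Type u) [CommRing k] [AddCommGroup A] [Module k A] where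
  twist : A ≃ₗ[k] A
  mul : A →ₗ[k] A →ₗ[k] A
  one : A
  twist_mul : ∀ a b, twist (mul a b) = mul (twist a) (twist b)
  twist_one : twist one = one
  hom_assoc : ∀ a b c, mul (twist a) (mul b c) = mul (mul a b) (twist c)
  mul_one : ∀ a, mul a one = twist a
  one_mul : ∀ a, mul one a = twist a

/-- A monoidal Hom-coalgebra `(C, γ)`: `Δ(γ(c)) = γ(c₁) ⊗ γ(c₂)`, `ε(γ(c)) = ε(c)`,
`γ⁻¹(c₁) ⊗ Δ(c₂) = c₁₁ ⊗ (c₁₂ ⊗ γ⁻¹(c₂))` and `c₁ε(c₂) = γ⁻¹(c) = ε(c₁)c₂`. -/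
structure MonoidalHomCoalgebra (k C : Type u) [CommRing k] [AddCommGroup C] [Module k C] where
  twist : C ≃ₗ[k] C
  comul : C →ₗ[k] C ⊗[k] C
  counit : C →ₗ[k] k
  comul_twist : ∀ c, comul (twist c) =
    TensorProduct.map twist.toLinearMap twist.toLinearMap (comul c)
  counit_twist : ∀ c, counit (twist c) = counit c
  hom_coassoc : ∀ c, TensorProduct.map twist.symm.toLinearMap comul (comul c) =
    TensorProduct.assoc k C C C (TensorProduct.map comul twist.symm.toLinearMap (comul c))
  comul_counit : ∀ c, TensorProduct.rid k C (counit.lTensor C (comul c)) = twist.symm c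
  counit_comul : ∀ c, TensorProduct.lid k C (counit.rTensor C (comul c)) = twist.symm c

/-- A monoidal Hom-bialgebra: `Δ` and `ε` are multiplicative and unital. -/
structure MonoidalHomBialgebra (k H : Type u) [CommRing k] [AddCommGroup H] [Module k H] extends
    MonoidalHomAlgebra k H, MonoidalHomCoalgebra k H where
  comul_mul : ∀ g h, comul (mul g h) = TensorProduct.map₂ mul mul (comul g) (comul h)
  comul_one : comul one = one ⊗ₜ[k] one
  counit_mul : ∀ g h, counit (mul g h) = counit g * counit h
  counit_one : counit one = 1

/-- A monoidal Hom-Hopf algebra: the antipode `S` commutes with `α` and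
`S(h₁)h₂ = ε(h)1 = h₁S(h₂)`. -/
structure MonoidalHomHopfAlgebra (k H : Type u) [CommRing k] [AddCommGroup H] [Module k H] extends
    MonoidalHomBialgebra k H where
  antipode : H →ₗ[k] H
  antipode_twist : ∀ h, antipode (twist h) = twist (antipode h)
  antipode_mul : ∀ h, TensorProduct.lift mul (antipode.rTensor H (comul h)) = counit h • one
  mul_antipode : ∀ h, TensorProduct.lift mul (antipode.lTensor H (comul h)) = counit h • one

/-- An object `(M, μ)` of the Hom-category of `k`-modules: a `k`-module with an automorphism. -/
structure HomObject (k : Type u) [CommRing k] where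
  carrier : Type u
  [addCommGroup : AddCommGroup carrier]
  [module : Module k carrier]
  twist : carrier ≃ₗ[k] carrier

attribute [instance] HomObject.addCommGroup HomObject.module

instance (k : Type u) [CommRing k] : CoeSort (HomObject k) (Type u) := ⟨HomObject.carrier⟩

section

variable {k H : Type u} [CommRing k] [AddCommGroup H] [Module k H]

/-! ## Right Hom-modules and Yetter-Drinfel'd Hom-modules -/

/-- A right `(H, α)`-Hom-module `(M, μ)`: `μ(m ◁ a) = μ(m) ◁ α(a)`,
`μ(m) ◁ (ab) = (m ◁ a) ◁ α(b)` and `m ◁ 1 = μ(m)`. -/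
structure RightHomModule (𝓗 : MonoidalHomHopfAlgebra k H) extends HomObject k where
  act : carrier →ₗ[k] H →ₗ[k] carrier
  twist_act : ∀ m a, twist (act m a) = act (twist m) (𝓗.twist a)
  act_mul : ∀ m a b, act (twist m) (𝓗.mul a b) = act (act m a) (𝓗.twist b)
  act_one : ∀ m, act m 𝓗.one = twist m

/-- A right-right Yetter-Drinfel'd `(H, α)`-Hom-module: a right Hom-module `(N, ν)` with a
coaction `n ↦ n₍₀₎ ⊗ n₍₁₎` commuting with the automorphisms such that
`ν⁻¹(n₍₀₎) ⊗ Δ(n₍₁₎) = n₍₀₎₍₀₎ ⊗ (n₍₀₎₍₁₎ ⊗ α⁻¹(n₍₁₎))`, `n₍₀₎ε(n₍₁₎) = ν⁻¹(n)`, and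
`n₍₀₎ ◁ α⁻¹(h₁) ⊗ n₍₁₎α⁻¹(h₂) = (n ◁ h₂)₍₀₎ ⊗ α⁻¹(h₁(n ◁ h₂)₍₁₎)`. -/
structure YetterDrinfeldHomModule (𝓗 : MonoidalHomHopfAlgebra k H) extends
    RightHomModule 𝓗 where
  coact : carrier →ₗ[k] carrier ⊗[k] H
  coact_twist : ∀ n, coact (twist n) =
    TensorProduct.map twist.toLinearMap 𝓗.twist.toLinearMap (coact n)
  coact_coassoc : ∀ n, TensorProduct.map twist.symm.toLinearMap 𝓗.comul (coact n) =
    TensorProduct.assoc k carrier H H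
      (TensorProduct.map coact 𝓗.twist.symm.toLinearMap (coact n))
  coact_counit : ∀ n,
    TensorProduct.rid k carrier (𝓗.counit.lTensor carrier (coact n)) = twist.symm n
  yetter_drinfeld : ∀ n h,
    TensorProduct.map₂ act 𝓗.mul (coact n)
        (TensorProduct.map 𝓗.twist.symm.toLinearMap 𝓗.twist.symm.toLinearMap (𝓗.comul h)) =
      (𝓗.twist.symm.toLinearMap ∘ₗ TensorProduct.lift 𝓗.mul.flip).lTensor carrier
        (TensorProduct.assoc k carrier H H
          ((coact ∘ₗ act n).rTensor H (TensorProduct.comm k H H (𝓗.comul h))))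

/-! ## Left-covariant and bicovariant Hom-bimodules -/

/-- A left-covariant `(H, α)`-Hom-bimodule `(M, μ)`: a Hom-bimodule
(`lact h m = hm`, `ract m h = mh`) with a left Hom-coaction `ρ(m) = m₍₋₁₎ ⊗ m₍₀₎` such that
`ρ((hm)α(g)) = Δ(α(h))(ρ(m)Δ(g))`. -/
structure LeftCovariantHomBimodule (𝓗 : MonoidalHomHopfAlgebra k H) extends HomObject k where
  lact : H →ₗ[k] carrier →ₗ[k] carrier
  ract : carrier →ₗ[k] H →ₗ[k] carrier
  twist_lact : ∀ a m, twist (lact a m) = lact (𝓗.twist a) (twist m)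
  twist_ract : ∀ m a, twist (ract m a) = ract (twist m) (𝓗.twist a)
  mul_lact : ∀ a b m, lact (𝓗.twist a) (lact b m) = lact (𝓗.mul a b) (twist m)
  one_lact : ∀ m, lact 𝓗.one m = twist m
  ract_mul : ∀ m a b, ract (ract m a) (𝓗.twist b) = ract (twist m) (𝓗.mul a b)
  ract_one : ∀ m, ract m 𝓗.one = twist m
  lact_ract : ∀ a m b, ract (lact a m) (𝓗.twist b) = lact (𝓗.twist a) (ract m b)
  lcoact : carrier →ₗ[k] H ⊗[k] carrier
  lcoact_twist : ∀ m, lcoact (twist m) =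
    TensorProduct.map 𝓗.twist.toLinearMap twist.toLinearMap (lcoact m)
  lcoact_coassoc : ∀ m,
    TensorProduct.assoc k H H carrier
        (TensorProduct.map 𝓗.comul twist.symm.toLinearMap (lcoact m)) =
      TensorProduct.map 𝓗.twist.symm.toLinearMap lcoact (lcoact m)
  lcoact_counit : ∀ m,
    TensorProduct.lid k carrier (𝓗.counit.rTensor carrier (lcoact m)) = twist.symm m
  left_covariant : ∀ h m g, lcoact (ract (lact h m) (𝓗.twist g)) =
    TensorProduct.map₂ 𝓗.mul lact (𝓗.comul (𝓗.twist h))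
      (TensorProduct.map₂ 𝓗.mul ract (lcoact m) (𝓗.comul g))

/-- A bicovariant `(H, α)`-Hom-bimodule: a left-covariant one with a right Hom-coaction
`σ(m) = m₍[0]₎ ⊗ m₍[1]₎` such that `σ((hm)α(g)) = Δ(α(h))(σ(m)Δ(g))`, and
`m₍₋₁₎ ⊗ σ(m₍₀₎) = α(m₍[0](-1)₎) ⊗ (m₍[0](0)₎ ⊗ α⁻¹(m₍[1]₎))`. -/
structure BicovariantHomBimodule (𝓗 : MonoidalHomHopfAlgebra k H) extends
    LeftCovariantHomBimodule 𝓗 where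
  rcoact : carrier →ₗ[k] carrier ⊗[k] H
  rcoact_twist : ∀ m, rcoact (twist m) =
    TensorProduct.map twist.toLinearMap 𝓗.twist.toLinearMap (rcoact m)
  rcoact_coassoc : ∀ m, TensorProduct.map twist.symm.toLinearMap 𝓗.comul (rcoact m) =
    TensorProduct.assoc k carrier H H
      (TensorProduct.map rcoact 𝓗.twist.symm.toLinearMap (rcoact m))
  rcoact_counit : ∀ m,
    TensorProduct.rid k carrier (𝓗.counit.lTensor carrier (rcoact m)) = twist.symm m
  right_covariant : ∀ h m g, rcoact (ract (lact h m) (𝓗.twist g)) =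
    TensorProduct.map₂ lact 𝓗.mul (𝓗.comul (𝓗.twist h))
      (TensorProduct.map₂ ract 𝓗.mul (rcoact m) (𝓗.comul g))
  hom_commutative : ∀ m, rcoact.lTensor H (lcoact m) =
    TensorProduct.map 𝓗.twist.toLinearMap (𝓗.twist.symm.toLinearMap.lTensor carrier)
      (TensorProduct.assoc k H carrier H (lcoact.rTensor H (rcoact m)))

variable {𝓗 : MonoidalHomHopfAlgebra k H}

/-! ## The four categories -/

/-- Morphisms of right Hom-modules: `H`-linear maps commuting with the automorphisms. -/
@[ext]
structure RightHomModule.Hom (V W : RightHomModule 𝓗) where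
  lin : V.carrier →ₗ[k] W.carrier
  map_twist : ∀ v, lin (V.twist v) = W.twist (lin v)
  map_act : ∀ v h, lin (V.act v h) = W.act (lin v) h

instance : Category (RightHomModule 𝓗) where
  Hom := RightHomModule.Hom
  id _ := ⟨LinearMap.id, fun _ => rfl, fun _ _ => rfl⟩
  comp f g := ⟨g.lin ∘ₗ f.lin, fun v => by simp [f.map_twist, g.map_twist],
    fun v h => by simp [f.map_act, g.map_act]⟩

/-- Morphisms of Yetter-Drinfel'd Hom-modules: `H`-linear and `H`-colinear maps commuting with
the automorphisms. -/
@[ext]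
structure YetterDrinfeldHomModule.Hom (V W : YetterDrinfeldHomModule 𝓗) extends
    RightHomModule.Hom V.toRightHomModule W.toRightHomModule where
  map_coact : ∀ v, W.coact (lin v) = lin.rTensor H (V.coact v)

instance : Category (YetterDrinfeldHomModule 𝓗) where
  Hom := YetterDrinfeldHomModule.Hom
  id V := ⟨𝟙 V.toRightHomModule, fun v => (LinearMap.rTensor_id_apply H V.carrier (V.coact v)).symm⟩
  comp {U V W} f g := ⟨show U.toRightHomModule ⟶ W.toRightHomModule from
      (show U.toRightHomModule ⟶ V.toRightHomModule from f.toHom) ≫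
      (show V.toRightHomModule ⟶ W.toRightHomModule from g.toHom), fun v => by
    change W.coact (g.lin (f.lin v)) = (g.lin ∘ₗ f.lin).rTensor H (U.coact v)
    rw [g.map_coact, f.map_coact, LinearMap.rTensor_comp_apply]⟩

/-- Morphisms of left-covariant Hom-bimodules: maps commuting with the automorphisms that are
`H`-linear on both sides and left `H`-colinear. -/
@[ext]
structure LeftCovariantHomBimodule.Hom (M N : LeftCovariantHomBimodule 𝓗) where
  lin : M.carrier →ₗ[k] N.carrier
  map_twist : ∀ m, lin (M.twist m) = N.twist (lin m)
  map_lact : ∀ h m, lin (M.lact h m) = N.lact h (lin m)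
  map_ract : ∀ m h, lin (M.ract m h) = N.ract (lin m) h
  map_lcoact : ∀ m, N.lcoact (lin m) = lin.lTensor H (M.lcoact m)

instance : Category (LeftCovariantHomBimodule 𝓗) where
  Hom := LeftCovariantHomBimodule.Hom
  id M := ⟨LinearMap.id, fun _ => rfl, fun _ _ => rfl, fun _ _ => rfl,
    fun m => (LinearMap.lTensor_id_apply H M.carrier (M.lcoact m)).symm⟩
  comp f g := ⟨g.lin ∘ₗ f.lin, fun v => by simp [f.map_twist, g.map_twist],
    fun h m => by simp [f.map_lact, g.map_lact], fun m h => by simp [f.map_ract, g.map_ract],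
    fun m => by
      rw [LinearMap.comp_apply, g.map_lcoact, f.map_lcoact, LinearMap.lTensor_comp_apply]⟩

/-- Morphisms of bicovariant Hom-bimodules: maps commuting with the automorphisms that are
`H`-linear and `H`-colinear on both sides. -/
@[ext]
structure BicovariantHomBimodule.Hom (M N : BicovariantHomBimodule 𝓗) extends
    LeftCovariantHomBimodule.Hom M.toLeftCovariantHomBimodule N.toLeftCovariantHomBimodule where
  map_rcoact : ∀ m, N.rcoact (lin m) = lin.rTensor H (M.rcoact m)

instance : Category (BicovariantHomBimodule 𝓗) where
  Hom := BicovariantHomBimodule.Hom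
  id M := ⟨𝟙 M.toLeftCovariantHomBimodule,
    fun m => (LinearMap.rTensor_id_apply H M.carrier (M.rcoact m)).symm⟩
  comp {L M N} f g := ⟨show L.toLeftCovariantHomBimodule ⟶ N.toLeftCovariantHomBimodule from
      (show L.toLeftCovariantHomBimodule ⟶ M.toLeftCovariantHomBimodule from f.toHom) ≫
      (show M.toLeftCovariantHomBimodule ⟶ N.toLeftCovariantHomBimodule from g.toHom), fun m => by
    change N.rcoact (g.lin (f.lin m)) = (g.lin ∘ₗ f.lin).rTensor H (L.rcoact m)
    rw [g.map_rcoact, f.map_rcoact, LinearMap.rTensor_comp_apply]⟩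

variable (𝓗) in
/-- The functor forgetting the coaction of a Yetter-Drinfel'd Hom-module. -/
def YetterDrinfeldHomModule.forget : YetterDrinfeldHomModule 𝓗 ⥤ RightHomModule 𝓗 where
  obj V := V.toRightHomModule
  map f := f.toHom

variable (𝓗) in
/-- The functor forgetting the right coaction of a bicovariant Hom-bimodule. -/
def BicovariantHomBimodule.forget : BicovariantHomBimodule 𝓗 ⥤ LeftCovariantHomBimodule 𝓗 where
  obj M := M.toLeftCovariantHomBimodule
  map f := f.toHom

/-! ## Tensor products over `H`, projections and coinvariants -/

/-- The relations `mh ⊗ n = μ(m) ⊗ hν⁻¹(n)`: the quotient of `M ⊗ N` by this submodule is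
`M ⊗_H N`. -/
def balancingRelations (M N : LeftCovariantHomBimodule 𝓗) :
    Submodule k (M.carrier ⊗[k] N.carrier) :=
  Submodule.span k {x | ∃ m h n,
    x = M.ract m h ⊗ₜ[k] n - M.twist m ⊗ₜ[k] N.lact h (N.twist.symm n)}

/-- The left Hom-coinvariants `{m | ρ(m) = 1 ⊗ μ⁻¹(m)}`. -/
def leftCoinvariants (M : LeftCovariantHomBimodule 𝓗) : Submodule k M.carrier :=
  LinearMap.eqLocus M.lcoact (TensorProduct.mk k H M.carrier 𝓗.one ∘ₗ M.twist.symm.toLinearMap)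

/-- `P_L(m) = S(m₍₋₁₎)m₍₀₎`. -/
def leftProjection (M : LeftCovariantHomBimodule 𝓗) : M.carrier →ₗ[k] M.carrier :=
  TensorProduct.lift M.lact ∘ₗ 𝓗.antipode.rTensor M.carrier ∘ₗ M.lcoact

/-! ## The tensor categories

The next structures say, for a category `C` with a functor to right Hom-modules (resp. a category
`D` with a functor to left-covariant Hom-bimodules), that a given monoidal category structure is the
one with the tensor product over `k` and the diagonal action (resp. the tensor product over `H`).
They determine the monoidal structure up to a unique isomorphism compatible with the maps `τ`. -/

open MonoidalCategory

/-- The tensor product of `V` and `W` is `V ⊗ W` (`τ v w` stands for `v ⊗ w`) with automorphism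
`ν ⊗ ω` and action `(v ⊗ w) ◁ h = v ◁ h₁ ⊗ w ◁ h₂`; the unit is `k` with the trivial action
(`unit x` stands for `x`); the constraints are `(u ⊗ v) ⊗ w ↦ μ(u) ⊗ (v ⊗ ω⁻¹(w))`,
`x ⊗ v ↦ xν(v)` and `v ⊗ x ↦ xν(v)`. -/
structure DiagonalTensor {C : Type*} [Category* C] (U : C ⥤ RightHomModule 𝓗)
    [MonoidalCategory C] where
  τ : ∀ V W : C, (U.obj V).carrier →ₗ[k] (U.obj W).carrier →ₗ[k] (U.obj (tensorObj V W)).carrier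
  τ_bijective : ∀ V W, Function.Bijective (TensorProduct.lift (τ V W))
  twist_τ : ∀ V W v w, (U.obj (tensorObj V W)).twist (τ V W v w) =
    τ V W ((U.obj V).twist v) ((U.obj W).twist w)
  act_τ : ∀ V W v w h, (U.obj (tensorObj V W)).act (τ V W v w) h =
    TensorProduct.lift (τ V W)
      (TensorProduct.map ((U.obj V).act v) ((U.obj W).act w) (𝓗.comul h))
  unit : k ≃ₗ[k] (U.obj (𝟙_ C)).carrier
  twist_unit : ∀ x, (U.obj (𝟙_ C)).twist (unit x) = unit x
  act_unit : ∀ x h, (U.obj (𝟙_ C)).act (unit x) h = unit (𝓗.counit h * x)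
  map_τ : ∀ {V V' W W' : C} (f : V ⟶ V') (g : W ⟶ W') v w,
    (U.map (tensorHom f g)).lin (τ V W v w) = τ V' W' ((U.map f).lin v) ((U.map g).lin w)
  associator_τ : ∀ V W X v w x,
    (U.map (associator V W X).hom).lin (τ (tensorObj V W) X (τ V W v w) x) =
      τ V (tensorObj W X) ((U.obj V).twist v) (τ W X w ((U.obj X).twist.symm x))
  leftUnitor_τ : ∀ V x v,
    (U.map (leftUnitor V).hom).lin (τ (𝟙_ C) V (unit x) v) = x • (U.obj V).twist v
  rightUnitor_τ : ∀ V v x,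
    (U.map (rightUnitor V).hom).lin (τ V (𝟙_ C) v (unit x)) = x • (U.obj V).twist v

/-- The tensor product of `M` and `N` is `M ⊗_H N`, the quotient of `M ⊗ N` by the balancing
relations (`τ m n` stands for `m ⊗_H n`), with automorphism `μ ⊗_H ν` and
`h(m ⊗_H n) = α⁻¹(h)m ⊗_H ν(n)`, `(m ⊗_H n)h = μ(m) ⊗_H nα⁻¹(h)`,
`ρ(m ⊗_H n) = m₍₋₁₎n₍₋₁₎ ⊗ (m₍₀₎ ⊗_H n₍₀₎)`; the unit is `(H, α)` with the multiplications as
actions and `Δ` as coaction (`unit h` stands for `h`); the constraints are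
`(m ⊗_H n) ⊗_H p ↦ μ(m) ⊗_H (n ⊗_H π⁻¹(p))`, `h ⊗_H m ↦ hm` and `m ⊗_H h ↦ mh`. -/
structure BalancedTensor {D : Type*} [Category* D] (U : D ⥤ LeftCovariantHomBimodule 𝓗)
    [MonoidalCategory D] where
  τ : ∀ M N : D, (U.obj M).carrier →ₗ[k] (U.obj N).carrier →ₗ[k] (U.obj (tensorObj M N)).carrier
  τ_surjective : ∀ M N, Function.Surjective (TensorProduct.lift (τ M N))
  τ_ker : ∀ M N, LinearMap.ker (TensorProduct.lift (τ M N)) =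
    balancingRelations (U.obj M) (U.obj N)
  twist_τ : ∀ M N m n, (U.obj (tensorObj M N)).twist (τ M N m n) =
    τ M N ((U.obj M).twist m) ((U.obj N).twist n)
  lact_τ : ∀ M N h m n, (U.obj (tensorObj M N)).lact h (τ M N m n) =
    τ M N ((U.obj M).lact (𝓗.twist.symm h) m) ((U.obj N).twist n)
  ract_τ : ∀ M N m n h, (U.obj (tensorObj M N)).ract (τ M N m n) h =
    τ M N ((U.obj M).twist m) ((U.obj N).ract n (𝓗.twist.symm h))
  lcoact_τ : ∀ M N m n, (U.obj (tensorObj M N)).lcoact (τ M N m n) =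
    TensorProduct.map₂ 𝓗.mul (τ M N) ((U.obj M).lcoact m) ((U.obj N).lcoact n)
  unit : H ≃ₗ[k] (U.obj (𝟙_ D)).carrier
  twist_unit : ∀ h, (U.obj (𝟙_ D)).twist (unit h) = unit (𝓗.twist h)
  lact_unit : ∀ g h, (U.obj (𝟙_ D)).lact g (unit h) = unit (𝓗.mul g h)
  ract_unit : ∀ h g, (U.obj (𝟙_ D)).ract (unit h) g = unit (𝓗.mul h g)
  lcoact_unit : ∀ h, (U.obj (𝟙_ D)).lcoact (unit h) = unit.toLinearMap.lTensor H (𝓗.comul h)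
  map_τ : ∀ {M M' N N' : D} (f : M ⟶ M') (g : N ⟶ N') m n,
    (U.map (tensorHom f g)).lin (τ M N m n) = τ M' N' ((U.map f).lin m) ((U.map g).lin n)
  associator_τ : ∀ M N P m n p,
    (U.map (associator M N P).hom).lin (τ (tensorObj M N) P (τ M N m n) p) =
      τ M (tensorObj N P) ((U.obj M).twist m) (τ N P n ((U.obj P).twist.symm p))
  leftUnitor_τ : ∀ M h m,
    (U.map (leftUnitor M).hom).lin (τ (𝟙_ D) M (unit h) m) = (U.obj M).lact h m
  rightUnitor_τ : ∀ M m h,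
    (U.map (rightUnitor M).hom).lin (τ M (𝟙_ D) m (unit h)) = (U.obj M).ract m h

/-- The tensor category of Yetter-Drinfel'd Hom-modules: in addition,
`v ⊗ w ↦ (v₍₀₎ ⊗ w₍₀₎) ⊗ v₍₁₎w₍₁₎`, and `x ↦ x ⊗ 1` on the unit. -/
structure YetterDrinfeldTensor (𝓗 : MonoidalHomHopfAlgebra k H)
    [MonoidalCategory (YetterDrinfeldHomModule 𝓗)] extends
    DiagonalTensor (YetterDrinfeldHomModule.forget 𝓗) where
  coact_τ : ∀ (V W : YetterDrinfeldHomModule 𝓗) (v : V.carrier) (w : W.carrier),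
    (tensorObj V W).coact (τ V W v w) =
      TensorProduct.map₂ (τ V W) 𝓗.mul (V.coact v) (W.coact w)
  coact_unit : ∀ x, (𝟙_ (YetterDrinfeldHomModule 𝓗)).coact (unit x) = unit x ⊗ₜ[k] 𝓗.one

/-- The tensor category of bicovariant Hom-bimodules: in addition,
`σ(m ⊗_H n) = (m₍[0]₎ ⊗_H n₍[0]₎) ⊗ m₍[1]₎n₍[1]₎`, and `σ = Δ` on the unit. -/
structure BicovariantTensor (𝓗 : MonoidalHomHopfAlgebra k H)
    [MonoidalCategory (BicovariantHomBimodule 𝓗)] extends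
    BalancedTensor (BicovariantHomBimodule.forget 𝓗) where
  rcoact_τ : ∀ (M N : BicovariantHomBimodule 𝓗) (m : M.carrier) (n : N.carrier),
    (tensorObj M N).rcoact (τ M N m n) =
      TensorProduct.map₂ (τ M N) 𝓗.mul (M.rcoact m) (N.rcoact n)
  rcoact_unit : ∀ h, (𝟙_ (BicovariantHomBimodule 𝓗)).rcoact (unit h) =
    unit.toLinearMap.rTensor H (𝓗.comul h)

/-! ## The functors -/

/-- `F` is `H ⊗ -`: `F V` is `H ⊗ V` (`ι g v` stands for `g ⊗ v`) with automorphism `α ⊗ ν` and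
`h(g ⊗ v) = α⁻¹(h)g ⊗ ν(v)`, `(g ⊗ v)h = gh₁ ⊗ v ◁ h₂`,
`ρ(g ⊗ v) = α(g₁) ⊗ (g₂ ⊗ ν⁻¹(v))`; on morphisms `F f = id ⊗ f`. -/
structure FreeFunctor {C D : Type*} [Category* C] [Category* D] (U : C ⥤ RightHomModule 𝓗)
    (U' : D ⥤ LeftCovariantHomBimodule 𝓗) (F : C ⥤ D) where
  ι : ∀ V : C, H →ₗ[k] (U.obj V).carrier →ₗ[k] (U'.obj (F.obj V)).carrier
  ι_bijective : ∀ V, Function.Bijective (TensorProduct.lift (ι V))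
  twist_ι : ∀ V g v, (U'.obj (F.obj V)).twist (ι V g v) = ι V (𝓗.twist g) ((U.obj V).twist v)
  lact_ι : ∀ V h g v, (U'.obj (F.obj V)).lact h (ι V g v) =
    ι V (𝓗.mul (𝓗.twist.symm h) g) ((U.obj V).twist v)
  ract_ι : ∀ V g v h, (U'.obj (F.obj V)).ract (ι V g v) h =
    TensorProduct.lift (ι V) (TensorProduct.map (𝓗.mul g) ((U.obj V).act v) (𝓗.comul h))
  lcoact_ι : ∀ V g v, (U'.obj (F.obj V)).lcoact (ι V g v) =
    TensorProduct.map 𝓗.twist.toLinearMap ((ι V).flip ((U.obj V).twist.symm v)) (𝓗.comul g)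
  map_ι : ∀ {V W : C} (f : V ⟶ W) g v,
    (U'.map (F.map f)).lin (ι V g v) = ι W g ((U.map f).lin v)

/-- `G` is `^{coH}(-)`: `G M` is the submodule of left Hom-coinvariants of `M` (`κ` is its
inclusion) with the restricted automorphism and the action `m ◁ h = P_L(mh)`; on morphisms `G` is
the restriction. -/
structure CoinvariantsFunctor {C D : Type*} [Category* C] [Category* D]
    (U : C ⥤ RightHomModule 𝓗) (U' : D ⥤ LeftCovariantHomBimodule 𝓗) (G : D ⥤ C) where
  κ : ∀ M : D, (U.obj (G.obj M)).carrier →ₗ[k] (U'.obj M).carrier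
  κ_injective : ∀ M, Function.Injective (κ M)
  κ_range : ∀ M, LinearMap.range (κ M) = leftCoinvariants (U'.obj M)
  κ_twist : ∀ M m, κ M ((U.obj (G.obj M)).twist m) = (U'.obj M).twist (κ M m)
  κ_act : ∀ M m h, κ M ((U.obj (G.obj M)).act m h) =
    leftProjection (U'.obj M) ((U'.obj M).ract (κ M m) h)
  κ_map : ∀ {M N : D} (f : M ⟶ N) m, κ N ((U.map (G.map f)).lin m) = (U'.map f).lin (κ M m)

/-- `F = H ⊗ -` on Yetter-Drinfel'd Hom-modules: in addition,
`σ(g ⊗ v) = (g₁ ⊗ v₍₀₎) ⊗ g₂v₍₁₎`. -/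
structure YetterDrinfeldFreeFunctor
    (F : YetterDrinfeldHomModule 𝓗 ⥤ BicovariantHomBimodule 𝓗) extends
    FreeFunctor (YetterDrinfeldHomModule.forget 𝓗) (BicovariantHomBimodule.forget 𝓗) F where
  rcoact_ι : ∀ (V : YetterDrinfeldHomModule 𝓗) (g : H) (v : V.carrier),
    (F.obj V).rcoact (ι V g v) =
      TensorProduct.map₂ (ι V) 𝓗.mul (𝓗.comul g) (V.coact v)

/-- `G = ^{coH}(-)` on bicovariant Hom-bimodules: in addition, the right coaction of `G M` is the
restriction of that of `M`. -/
structure BicovariantCoinvariantsFunctor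
    (G : BicovariantHomBimodule 𝓗 ⥤ YetterDrinfeldHomModule 𝓗) extends
    CoinvariantsFunctor (YetterDrinfeldHomModule.forget 𝓗) (BicovariantHomBimodule.forget 𝓗)
      G where
  κ_coact : ∀ (M : BicovariantHomBimodule 𝓗) (m : (G.obj M).carrier),
    M.rcoact (κ M m) = (κ M).rTensor H ((G.obj M).coact m)

/-- `F = H ⊗ -` and `G = ^{coH}(-)`, with `θ : H ⊗ ^{coH}M → M`, `h ⊗ m ↦ hm`, as counit, form a
tensor equivalence: `F` is strong monoidal with unit map `H → H ⊗ k`, `h ↦ α⁻¹(h) ⊗ 1`, and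
`φ₂((g ⊗ v) ⊗_H (h ⊗ w)) = gα(h₁) ⊗ (ν⁻¹(v) ◁ h₂ ⊗ w)` (`ν` the automorphism of `V`),
and `G` is strong monoidal in such a way that the unit and the counit of the equivalence are
monoidal. -/
def IsTensorEquivalence {C D : Type*} [Category* C] [Category* D] [MonoidalCategory C]
    [MonoidalCategory D] {U : C ⥤ RightHomModule 𝓗} {U' : D ⥤ LeftCovariantHomBimodule 𝓗}
    (S : DiagonalTensor U) (T : BalancedTensor U') (e : C ≌ D)
    (f : FreeFunctor U U' e.functor) (g : CoinvariantsFunctor U U' e.inverse) : Prop :=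
  (∀ M h m, (U'.map (e.counitIso.hom.app M)).lin (f.ι (e.inverse.obj M) h m) =
    (U'.obj M).lact h (g.κ M m)) ∧
  ∃ (_ : e.functor.Monoidal) (_ : e.inverse.Monoidal), e.IsMonoidal ∧
    (∀ h, (U'.map (Functor.LaxMonoidal.ε e.functor)).lin (T.unit h) =
      f.ι (𝟙_ C) (𝓗.twist.symm h) (S.unit 1)) ∧
    (∀ V W a v h w, (U'.map (Functor.LaxMonoidal.μ e.functor V W)).lin
        (T.τ (e.functor.obj V) (e.functor.obj W) (f.ι V a v) (f.ι W h w)) =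
      TensorProduct.lift (f.ι (tensorObj V W))
        (TensorProduct.map (𝓗.mul a ∘ₗ 𝓗.twist.toLinearMap)
          ((S.τ V W).flip w ∘ₗ (U.obj V).act ((U.obj V).twist.symm v)) (𝓗.comul h)))

end

/-! The core is the structure theorem for Hom-Hopf modules. P_L(m) = S(m₍₋₁₎)m₍₀₎ projects a
left-covariant Hom-bimodule M onto its coinvariants, and m = m₍₋₁₎P_L(m₍₀₎), so M ≅ H ⊗ ^{coH}M
(`lcoact_leftProjection`, `sum_lact_leftProjection`, `counitEquiv`). Applied to vh for coinvariant
v, where ρ(vh) = α(h₁) ⊗ μ⁻¹(v)h₂, the same reconstruction gives vh = α(h₁)(μ⁻¹(v) ◁ h₂): the right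
action on M is determined by ◁ (`ract_eq_sum_of_lcoact`). Conversely P_L(g ⊗ v) = ε(g)1 ⊗ v in H ⊗
V, so the coinvariants of H ⊗ V are a copy of V. This yields the equivalence.

The tensor product over H is not built as a quotient. The tensor structure over k is constructed
directly and carried along the equivalence, so M ⊗ N is F(GM ⊗ GN) and coherence is inherited. What
remains is to recognise this object as M ⊗_H N. The bilinear map φ₂ is balanced and surjective, and
g ⊗ (v ⊗ w) ↦ (α⁻¹(g) ⊗ v) ⊗ (1 ⊗ w) inverts it modulo the balancing relations, so its kernel
consists of exactly these relations (`prod_ract`, `prod_surjective`, `prodSection_prod_sub_mem`).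
Precomposing with the inverse counits gives `transportMk`; actions, coactions and constraints are
read off from φ₂. The strong monoidal structure of F that comes with the transport is then given by
φ₀ and φ₂, and G receives the structure adjoint to it, for which unit and counit are monoidal.

For the second equivalence the forgetful functors are faithful, so only statements about the
additional coactions are new. The Yetter-Drinfel'd condition makes σ on H ⊗ V compatible with the
right action (`freeCoact_ract`); for coinvariants it results from computing σ(vh) in two ways
(`coinvariants_yetter_drinfeld`); and it makes φ₂ right colinear (`value_prod`). The map φ₂ and the
transport are treated over abstract categories with functors `U`, `U'`, so that both equivalences
use the same lemmas.

Calculations use Sweedler notation with chosen decompositions into pure tensors. Each axiom becomes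
an identity between sums of values of an arbitrary multilinear function `T`, and terms are
normalised by pushing automorphisms inwards and bracketing products to the right. -/

open MonoidalCategory

/-! ## Sweedler sums -/

/-- A function that is linear in one variable. -/
structure Lin₁ (k : Type*) {A X : Type*} [CommRing k] [AddCommGroup A] [Module k A]
    [AddCommGroup X] [Module k X] (T : A → X) : Prop where
  add : ∀ a a', T (a + a') = T a + T a' := by
    intros; simp [TensorProduct.add_tmul, TensorProduct.tmul_add, add_smul, mul_add, add_mul,
      Finset.sum_add_distrib]
  smul : ∀ (r : k) a, T (r • a) = r • T a := by
    intros; simp [← TensorProduct.smul_tmul', TensorProduct.tmul_smul, Finset.smul_sum, smul_smul,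
      mul_comm]

/-- A function that is linear in each of its two variables. -/
structure Lin₂ (k : Type*) {A B X : Type*} [CommRing k] [AddCommGroup A] [Module k A]
    [AddCommGroup B] [Module k B] [AddCommGroup X] [Module k X] (T : A → B → X) : Prop where
  left : ∀ b, Lin₁ k (fun a => T a b) := by intro _; exact {}
  right : ∀ a, Lin₁ k (T a) := by intro _; exact {}

/-- A function that is linear in each of its three variables. -/
structure Lin₃ (k : Type*) {A B C X : Type*} [CommRing k] [AddCommGroup A] [Module k A]
    [AddCommGroup B] [Module k B] [AddCommGroup C] [Module k C] [AddCommGroup X] [Module k X]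
    (T : A → B → C → X) : Prop where
  fst : ∀ b c, Lin₁ k (fun a => T a b c) := by intro _ _; exact {}
  snd : ∀ a c, Lin₁ k (fun b => T a b c) := by intro _ _; exact {}
  trd : ∀ a b, Lin₁ k (T a b) := by intro _ _; exact {}

section

variable {k A B C X : Type*} [CommRing k] [AddCommGroup A] [Module k A] [AddCommGroup B]
  [Module k B] [AddCommGroup C] [Module k C] [AddCommGroup X] [Module k X]

/-- The linear map given by a function that is linear in its variable. -/
def Lin₁.toLinearMap {T : A → X} (hT : Lin₁ k T) : A →ₗ[k] X where
  toFun := T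
  map_add' := hT.add
  map_smul' := hT.smul

theorem Lin₁.map_sum {T : A → X} (hT : Lin₁ k T) {n : ℕ} (f : Fin n → A) :
    T (∑ i, f i) = ∑ i, T (f i) :=
  _root_.map_sum hT.toLinearMap f Finset.univ

/-- The bilinear map given by a function that is linear in each variable. -/
def Lin₂.toLinearMap {T : A → B → X} (hT : Lin₂ k T) : A →ₗ[k] B →ₗ[k] X where
  toFun a := (hT.right a).toLinearMap
  map_add' a a' := LinearMap.ext fun b => (hT.left b).add a a'
  map_smul' r a := LinearMap.ext fun b => (hT.left b).smul r a

/-- The trilinear map given by a function that is linear in each variable. -/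
def Lin₃.toLinearMap {T : A → B → C → X} (hT : Lin₃ k T) : A →ₗ[k] B →ₗ[k] C →ₗ[k] X where
  toFun a := Lin₂.toLinearMap ⟨fun c => hT.snd a c, fun b => hT.trd a b⟩
  map_add' a a' := LinearMap.ext₂ fun b c => (hT.fst b c).add a a'
  map_smul' r a := LinearMap.ext₂ fun b c => (hT.fst b c).smul r a

@[simp]
theorem Lin₁.toLinearMap_apply {T : A → X} (hT : Lin₁ k T) (a : A) : hT.toLinearMap a = T a := rfl

@[simp]
theorem Lin₂.toLinearMap_apply {T : A → B → X} (hT : Lin₂ k T) (a : A) (b : B) :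
    hT.toLinearMap a b = T a b := rfl

@[simp]
theorem Lin₃.toLinearMap_apply {T : A → B → C → X} (hT : Lin₃ k T) (a : A) (b : B) (c : C) :
    hT.toLinearMap a b c = T a b c := rfl

/-- The passage to Sweedler sums: an identity of tensors, hit by the linear map `L`, becomes an
identity between sums of values of `T`. -/
theorem Lin₂.exists_lift {T : A → B → X} (hT : Lin₂ k T) :
    ∃ L : A ⊗[k] B →ₗ[k] X, ∀ a b, L (a ⊗ₜ b) = T a b :=
  ⟨TensorProduct.lift hT.toLinearMap, fun _ _ => rfl⟩

theorem Lin₃.exists_lift {T : A → B → C → X} (hT : Lin₃ k T) :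
    ∃ L : A ⊗[k] (B ⊗[k] C) →ₗ[k] X, ∀ a b c, L (a ⊗ₜ (b ⊗ₜ c)) = T a b c :=
  ⟨TensorProduct.lift (TensorProduct.uncurry (.id k) B C X ∘ₗ hT.toLinearMap), fun _ _ _ => rfl⟩

/-- The number of terms of a chosen decomposition of a tensor into pure tensors. -/
noncomputable def tensorRank (t : A ⊗[k] B) : ℕ := (TensorProduct.exists_sum_tmul_eq t).choose

/-- The left factors of the chosen decomposition. -/
noncomputable def tensorFst (t : A ⊗[k] B) : Fin (tensorRank t) → A :=
  (TensorProduct.exists_sum_tmul_eq t).choose_spec.choose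

/-- The right factors of the chosen decomposition. -/
noncomputable def tensorSnd (t : A ⊗[k] B) : Fin (tensorRank t) → B :=
  (TensorProduct.exists_sum_tmul_eq t).choose_spec.choose_spec.choose

theorem eq_sum_tensor (t : A ⊗[k] B) : t = ∑ i, tensorFst t i ⊗ₜ[k] tensorSnd t i :=
  (TensorProduct.exists_sum_tmul_eq t).choose_spec.choose_spec.choose_spec

end

/-! ## Sweedler notation for a monoidal Hom-Hopf algebra -/

namespace MonoidalHomHopfAlgebra

variable {k H : Type u} [CommRing k] [AddCommGroup H] [Module k H]
  (𝓗 : MonoidalHomHopfAlgebra k H)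

/-- The number of terms in `Δ(h) = h₁ ⊗ h₂`. -/
noncomputable def rank (h : H) : ℕ := tensorRank (𝓗.comul h)

/-- The left factors `h₁` in `Δ(h) = h₁ ⊗ h₂`. -/
noncomputable def fst (h : H) : Fin (𝓗.rank h) → H := tensorFst (𝓗.comul h)

/-- The right factors `h₂` in `Δ(h) = h₁ ⊗ h₂`. -/
noncomputable def snd (h : H) : Fin (𝓗.rank h) → H := tensorSnd (𝓗.comul h)

-- The low priority lets the rules for Δ of a product, of a twist and of 1 fire first; only what
-- they leave is expanded into the chosen sum.
@[simp low]
theorem comul_eq_sum (h : H) : 𝓗.comul h = ∑ i, 𝓗.fst h i ⊗ₜ[k] 𝓗.snd h i := eq_sum_tensor _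

attribute [simp] MonoidalHomAlgebra.twist_mul MonoidalHomAlgebra.twist_one
  MonoidalHomAlgebra.mul_one MonoidalHomAlgebra.one_mul MonoidalHomHopfAlgebra.antipode_twist
  MonoidalHomBialgebra.comul_one MonoidalHomBialgebra.counit_mul MonoidalHomBialgebra.counit_one

attribute [local simp] TensorProduct.sum_tmul TensorProduct.tmul_sum LinearMap.sum_apply

@[simp]
theorem counit_twist' (h : H) : 𝓗.counit (𝓗.twist h) = 𝓗.counit h := 𝓗.counit_twist h

@[simp]
theorem comul_twist' (h : H) : 𝓗.comul (𝓗.twist h) =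
    TensorProduct.map 𝓗.twist.toLinearMap 𝓗.twist.toLinearMap (𝓗.comul h) := 𝓗.comul_twist h

@[simp]
theorem comul_mul' (g h : H) : 𝓗.comul (𝓗.mul g h) =
    TensorProduct.map₂ 𝓗.mul 𝓗.mul (𝓗.comul g) (𝓗.comul h) := 𝓗.comul_mul g h

@[simp]
theorem comul_twist_symm (h : H) : 𝓗.comul (𝓗.twist.symm h) =
    TensorProduct.map 𝓗.twist.symm.toLinearMap 𝓗.twist.symm.toLinearMap (𝓗.comul h) := by
  obtain ⟨h, rfl⟩ := 𝓗.twist.surjective h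
  simp

@[simp]
theorem counit_twist_symm (h : H) : 𝓗.counit (𝓗.twist.symm h) = 𝓗.counit h := by
  obtain ⟨h, rfl⟩ := 𝓗.twist.surjective h
  simp

@[simp]
theorem twist_symm_mul (a b : H) :
    𝓗.twist.symm (𝓗.mul a b) = 𝓗.mul (𝓗.twist.symm a) (𝓗.twist.symm b) := by
  rw [LinearEquiv.symm_apply_eq]; simp

@[simp]
theorem twist_symm_one : 𝓗.twist.symm 𝓗.one = 𝓗.one := by
  rw [LinearEquiv.symm_apply_eq]; simp

@[simp]
theorem antipode_twist_symm (h : H) :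
    𝓗.antipode (𝓗.twist.symm h) = 𝓗.twist.symm (𝓗.antipode h) := by
  rw [LinearEquiv.eq_symm_apply, ← 𝓗.antipode_twist]; simp

@[simp]
theorem antipode_one : 𝓗.antipode 𝓗.one = 𝓗.one := by
  have := 𝓗.antipode_mul 𝓗.one
  rw [𝓗.comul_one, LinearMap.rTensor_tmul, TensorProduct.lift.tmul, 𝓗.mul_one,
    ← 𝓗.antipode_twist, 𝓗.twist_one, 𝓗.counit_one, one_smul] at this
  exact this

-- Hom-associativity oriented as a rewriting rule: products are nested to the right at the cost of
-- twists, which then move inwards. This is the normal form on which the later computations rely.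
@[simp]
theorem mul_mul (a b c : H) :
    𝓗.mul (𝓗.mul a b) c = 𝓗.mul (𝓗.twist a) (𝓗.mul b (𝓗.twist.symm c)) := by
  simp [𝓗.hom_assoc]

variable {X : Type*} [AddCommGroup X] [Module k X]

/-- The chosen decompositions are not natural: that of Δ(α⁻¹(h)) need not be the image of that of
Δ(h). Under a bilinear `T` any two decompositions of the same tensor may be exchanged. -/
theorem sum_comul_eq {h : H} {T : H → H → X} (hT : Lin₂ k T) {n : ℕ} {a b : Fin n → H}
    (hab : 𝓗.comul h = ∑ i, a i ⊗ₜ[k] b i) :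
    ∑ i, T (𝓗.fst h i) (𝓗.snd h i) = ∑ i, T (a i) (b i) := by
  obtain ⟨L, hL⟩ := hT.exists_lift
  simpa [hL] using congrArg L ((𝓗.comul_eq_sum h).symm.trans hab)

/-- `h₁₁ ⊗ h₁₂ ⊗ h₂ = α⁻¹(h₁) ⊗ h₂₁ ⊗ α(h₂₂)`. -/
theorem sum_comul_fst (h : H) (T : H → H → H → X) (hT : Lin₃ k T) :
    ∑ i, ∑ j, T (𝓗.fst (𝓗.fst h i) j) (𝓗.snd (𝓗.fst h i) j) (𝓗.snd h i) =
      ∑ i, ∑ j, T (𝓗.twist.symm (𝓗.fst h i)) (𝓗.fst (𝓗.snd h i) j)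
        (𝓗.twist (𝓗.snd (𝓗.snd h i) j)) := by
  obtain ⟨L, hL⟩ := hT.exists_lift
  -- Applying α to the last factor of Hom-coassociativity clears the α⁻¹ on h₂.
  have := congrArg (L ∘ₗ ((𝓗.twist.toLinearMap.lTensor H).lTensor H)) (𝓗.hom_coassoc h)
  simpa [hL] using this.symm

theorem sum_counit_snd (h : H) (T : H → X) (hT : Lin₁ k T) :
    ∑ i, 𝓗.counit (𝓗.snd h i) • T (𝓗.fst h i) = T (𝓗.twist.symm h) := by
  rw [← 𝓗.comul_counit]
  simp [hT.map_sum, hT.smul]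

theorem sum_counit_fst (h : H) (T : H → X) (hT : Lin₁ k T) :
    ∑ i, 𝓗.counit (𝓗.fst h i) • T (𝓗.snd h i) = T (𝓗.twist.symm h) := by
  rw [← 𝓗.counit_comul]
  simp [hT.map_sum, hT.smul]

theorem sum_antipode_mul (h : H) (T : H → X) (hT : Lin₁ k T) :
    ∑ i, T (𝓗.mul (𝓗.antipode (𝓗.fst h i)) (𝓗.snd h i)) = 𝓗.counit h • T 𝓗.one := by
  rw [← hT.smul, ← 𝓗.antipode_mul]
  simp [hT.map_sum]

theorem sum_mul_antipode (h : H) (T : H → X) (hT : Lin₁ k T) :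
    ∑ i, T (𝓗.mul (𝓗.fst h i) (𝓗.antipode (𝓗.snd h i))) = 𝓗.counit h • T 𝓗.one := by
  rw [← hT.smul, ← 𝓗.mul_antipode]
  simp [hT.map_sum]

end MonoidalHomHopfAlgebra

/-! ## The tensor category of right Hom-modules -/

namespace RightHomModule

variable {k H : Type u} [CommRing k] [AddCommGroup H] [Module k H]
  {𝓗 : MonoidalHomHopfAlgebra k H}

attribute [simp] RightHomModule.twist_act RightHomModule.act_one
attribute [local simp] TensorProduct.sum_tmul TensorProduct.tmul_sum LinearMap.sum_apply

section

variable (V : RightHomModule 𝓗)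

@[simp]
theorem twist_symm_act (v : V.carrier) (h : H) :
    V.twist.symm (V.act v h) = V.act (V.twist.symm v) (𝓗.twist.symm h) := by
  rw [LinearEquiv.symm_apply_eq]; simp

@[simp]
theorem act_act (v : V.carrier) (a b : H) :
    V.act (V.act v a) b = V.act (V.twist v) (𝓗.mul a (𝓗.twist.symm b)) := by
  simp [V.act_mul]

end

@[simp]
theorem id_lin (V : RightHomModule 𝓗) : Hom.lin (𝟙 V) = LinearMap.id := rfl

@[simp]
theorem comp_lin {U V W : RightHomModule 𝓗} (f : U ⟶ V) (g : V ⟶ W) :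
    Hom.lin (f ≫ g) = Hom.lin g ∘ₗ Hom.lin f := rfl

@[ext]
theorem hom_ext {V W : RightHomModule 𝓗} {f g : V ⟶ W} (h : Hom.lin f = Hom.lin g) : f = g :=
  Hom.ext h

theorem lin_twist {V W : RightHomModule 𝓗} (f : V ⟶ W) (v : V.carrier) :
    Hom.lin f (V.twist v) = W.twist (Hom.lin f v) := f.map_twist v

theorem lin_act {V W : RightHomModule 𝓗} (f : V ⟶ W) (v : V.carrier) (h : H) :
    Hom.lin f (V.act v h) = W.act (Hom.lin f v) h := f.map_act v h

theorem lin_twist_symm {V W : RightHomModule 𝓗} (f : V ⟶ W) (v : V.carrier) :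
    Hom.lin f (V.twist.symm v) = W.twist.symm (Hom.lin f v) := by
  rw [LinearEquiv.eq_symm_apply, ← lin_twist]; simp

attribute [simp] lin_twist lin_act lin_twist_symm

/-- The isomorphism given by a morphism with a linear inverse. -/
def isoOfHom {V W : RightHomModule 𝓗} (f : V ⟶ W) (g : W.carrier →ₗ[k] V.carrier)
    (h₁ : g ∘ₗ Hom.lin f = LinearMap.id) (h₂ : Hom.lin f ∘ₗ g = LinearMap.id) : V ≅ W where
  hom := f
  inv := ⟨g, fun w => by
      have h₁ := LinearMap.congr_fun h₁; have h₂ := LinearMap.congr_fun h₂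
      simp only [LinearMap.comp_apply, LinearMap.id_apply] at h₁ h₂
      rw [← h₁ (V.twist (g w)), f.map_twist, h₂], fun w h => by
      have h₁ := LinearMap.congr_fun h₁; have h₂ := LinearMap.congr_fun h₂
      simp only [LinearMap.comp_apply, LinearMap.id_apply] at h₁ h₂
      rw [← h₁ (V.act (g w) h), f.map_act, h₂]⟩
  hom_inv_id := hom_ext h₁
  inv_hom_id := hom_ext h₂

/-- The tensor product over `k` with the diagonal action. -/
def tensor (V W : RightHomModule 𝓗) : RightHomModule 𝓗 where
  carrier := V.carrier ⊗[k] W.carrier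
  twist := TensorProduct.congr V.twist W.twist
  act := (TensorProduct.map₂ V.act W.act).compl₂ 𝓗.comul
  twist_act m a := by
    induction m using TensorProduct.induction_on with
    | zero => simp
    | tmul v w => simp
    | add x y hx hy => simp only [map_add, LinearMap.add_apply, hx, hy]
  act_mul m a b := by
    induction m using TensorProduct.induction_on with
    | zero => simp
    | tmul v w => simp; rw [Finset.sum_comm]
    | add x y hx hy => simp only [map_add, LinearMap.add_apply, hx, hy]
  act_one m := by
    induction m using TensorProduct.induction_on with
    | zero => simp
    | tmul v w => simp
    | add x y hx hy => simp only [map_add, LinearMap.add_apply, hx, hy]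

section

variable (V W : RightHomModule 𝓗)

/-- The bilinear map `(v, w) ↦ v ⊗ w`. -/
def tmul : V.carrier →ₗ[k] W.carrier →ₗ[k] (tensor V W).carrier :=
  TensorProduct.mk k V.carrier W.carrier

theorem tmul_bijective : Function.Bijective (TensorProduct.lift (tmul V W)) := by
  have : TensorProduct.lift (tmul V W) = LinearMap.id (R := k) (M := V.carrier ⊗[k] W.carrier) :=
    TensorProduct.ext' fun _ _ => rfl
  rw [this]
  exact Function.bijective_id

@[simp]
theorem twist_tmul (v : V.carrier) (w : W.carrier) :
    (tensor V W).twist (tmul V W v w) = tmul V W (V.twist v) (W.twist w) := rfl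

@[simp]
theorem twist_symm_tmul (v : V.carrier) (w : W.carrier) :
    (tensor V W).twist.symm (tmul V W v w) = tmul V W (V.twist.symm v) (W.twist.symm w) := rfl

theorem act_tmul_eq_lift (v : V.carrier) (w : W.carrier) (h : H) :
    (tensor V W).act (tmul V W v w) h =
      TensorProduct.lift (tmul V W) (TensorProduct.map (V.act v) (W.act w) (𝓗.comul h)) := by
  have : TensorProduct.lift (tmul V W) = LinearMap.id (R := k) (M := V.carrier ⊗[k] W.carrier) :=
    TensorProduct.ext' fun _ _ => rfl
  rw [this]
  rfl

@[simp]
theorem act_tmul (v : V.carrier) (w : W.carrier) (h : H) :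
    (tensor V W).act (tmul V W v w) h =
      ∑ i, tmul V W (V.act v (𝓗.fst h i)) (W.act w (𝓗.snd h i)) := by
  simp [act_tmul_eq_lift]

variable {V W} {X : Type u} [AddCommGroup X] [Module k X]

/-- The linear map on the tensor product induced by a bilinear map. -/
def desc (f : V.carrier →ₗ[k] W.carrier →ₗ[k] X) : (tensor V W).carrier →ₗ[k] X :=
  TensorProduct.lift f

@[simp]
theorem desc_tmul (f : V.carrier →ₗ[k] W.carrier →ₗ[k] X) (v : V.carrier) (w : W.carrier) :
    desc f (tmul V W v w) = f v w := rfl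

@[elab_as_elim]
theorem tensor_induction {p : (tensor V W).carrier → Prop} (zero : p 0)
    (tmul : ∀ v w, p (tmul V W v w)) (add : ∀ x y, p x → p y → p (x + y))
    (x : (tensor V W).carrier) : p x :=
  TensorProduct.induction_on x zero tmul add

theorem tensor_ext {f g : (tensor V W).carrier →ₗ[k] X}
    (h : ∀ v w, f (tmul V W v w) = g (tmul V W v w)) : f = g :=
  TensorProduct.ext' h

theorem tensor_ext₃ {U : RightHomModule 𝓗} {f g : (tensor (tensor U V) W).carrier →ₗ[k] X}
    (h : ∀ u v w, f (tmul _ W (tmul U V u v) w) = g (tmul _ W (tmul U V u v) w)) : f = g :=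
  tensor_ext fun p w => by
    induction p using tensor_induction with
    | zero => simp
    | tmul u v => exact h u v w
    | add x y hx hy => simp only [map_add, LinearMap.add_apply, hx, hy]

theorem tensor_ext₄ {U Y : RightHomModule 𝓗}
    {f g : (tensor (tensor (tensor U V) W) Y).carrier →ₗ[k] X}
    (h : ∀ u v w y, f (tmul _ Y (tmul _ W (tmul U V u v) w) y) =
      g (tmul _ Y (tmul _ W (tmul U V u v) w) y)) : f = g :=
  tensor_ext₃ fun p w y => by
    induction p using tensor_induction with
    | zero => simp
    | tmul u v => exact h u v w y
    | add x y hx hy => simp only [map_add, LinearMap.add_apply, hx, hy]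

/-- The morphism on the tensor product induced by a bilinear map. -/
def homDesc {Z : RightHomModule 𝓗} (f : V.carrier →ₗ[k] W.carrier →ₗ[k] Z.carrier)
    (h₁ : ∀ v w, f (V.twist v) (W.twist w) = Z.twist (f v w))
    (h₂ : ∀ v w h, ∑ i, f (V.act v (𝓗.fst h i)) (W.act w (𝓗.snd h i)) = Z.act (f v w) h) :
    tensor V W ⟶ Z where
  lin := desc f
  map_twist m := by
    induction m using tensor_induction with
    | zero => simp
    | tmul v w => simp [h₁]
    | add x y hx hy => simp only [map_add, hx, hy]
  map_act m h := by
    induction m using tensor_induction with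
    | zero => simp
    | tmul v w => simp [h₂]
    | add x y hx hy => simp only [map_add, LinearMap.add_apply, hx, hy]

@[simp]
theorem homDesc_tmul {Z : RightHomModule 𝓗} (f : V.carrier →ₗ[k] W.carrier →ₗ[k] Z.carrier)
    (h₁ h₂) (v : V.carrier) (w : W.carrier) :
    Hom.lin (homDesc (V := V) (W := W) (Z := Z) f h₁ h₂) (tmul V W v w) = f v w := rfl

end

variable (𝓗) in
/-- The ground ring with the trivial action. -/
def trivial : RightHomModule 𝓗 where
  carrier := k
  twist := LinearEquiv.refl k k
  act := (LinearMap.mul k k).compl₂ 𝓗.counit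
  twist_act m a := by simp
  act_mul m a b := by simp [mul_assoc]
  act_one m := by simp

variable (𝓗) in
/-- The identification of `k` with the carrier of the unit object. -/
def unitEquiv : k ≃ₗ[k] (trivial 𝓗).carrier := LinearEquiv.refl k k

@[simp]
theorem twist_unitEquiv (x : k) : (trivial 𝓗).twist (unitEquiv 𝓗 x) = unitEquiv 𝓗 x := rfl

@[simp]
theorem twist_trivial (x : (trivial 𝓗).carrier) : (trivial 𝓗).twist x = x := rfl

theorem act_unitEquiv (x : k) (h : H) :
    (trivial 𝓗).act (unitEquiv 𝓗 x) h = unitEquiv 𝓗 (𝓗.counit h * x) :=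
  mul_comm x (𝓗.counit h)

@[simp]
theorem act_trivial (x : (trivial 𝓗).carrier) (h : H) :
    (trivial 𝓗).act x h = 𝓗.counit h • x :=
  mul_comm (G := k) x (𝓗.counit h)

/-- The tensor product of two morphisms. -/
def tensorMap {V V' W W' : RightHomModule 𝓗} (f : V ⟶ V') (g : W ⟶ W') :
    tensor V W ⟶ tensor V' W' :=
  homDesc ((tmul V' W').compl₁₂ (Hom.lin f) (Hom.lin g)) (fun v w => by simp)
    (fun v w h => by simp)

@[simp]
theorem tensorMap_tmul {V V' W W' : RightHomModule 𝓗} (f : V ⟶ V') (g : W ⟶ W') (v : V.carrier)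
    (w : W.carrier) : Hom.lin (tensorMap f g) (tmul V W v w) =
      tmul V' W' (Hom.lin f v) (Hom.lin g w) := rfl

/-- The associativity constraint `(u ⊗ v) ⊗ w ↦ μ(u) ⊗ (v ⊗ ω⁻¹(w))`. -/
def assocHom (U V W : RightHomModule 𝓗) :
    tensor (tensor U V) W ⟶ tensor U (tensor V W) :=
  homDesc (desc (Lin₃.toLinearMap (T := fun u v w =>
      tmul U (tensor V W) (U.twist u) (tmul V W v (W.twist.symm w))) {}))
    (fun p w => by
      induction p using tensor_induction with
      | zero => simp
      | tmul u v => simp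
      | add x y hx hy => simp only [map_add, LinearMap.add_apply, hx, hy])
    (fun p w h => by
      induction p using tensor_induction with
      | zero => simp
      | tmul u v =>
        -- One side involves h₁₁, h₁₂, h₂, the other h₁, h₂₁, h₂₂. The twists μ and ω⁻¹ in the
        -- constraint absorb exactly the powers of α in Hom-coassociativity.
        have := 𝓗.sum_comul_fst h (fun a b c => tmul U (tensor V W) (U.act (U.twist u) (𝓗.twist a))
          (tmul V W (V.act v b) (W.act (W.twist.symm w) (𝓗.twist.symm c)))) {}
        simpa using this
      | add x y hx hy =>
        simp only [map_add, LinearMap.add_apply, Finset.sum_add_distrib, hx, hy])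

@[simp]
theorem assocHom_tmul (U V W : RightHomModule 𝓗) (u : U.carrier) (v : V.carrier) (w : W.carrier) :
    Hom.lin (assocHom U V W) (tmul _ W (tmul U V u v) w) =
      tmul U _ (U.twist u) (tmul V W v (W.twist.symm w)) := rfl

/-- The left unit constraint `x ⊗ v ↦ xν(v)`. -/
def leftUnitHom (V : RightHomModule 𝓗) : tensor (trivial 𝓗) V ⟶ V :=
  homDesc (Lin₂.toLinearMap (T := fun x v => (unitEquiv 𝓗).symm x • V.twist v) {})
    (fun x v => by simp)
    (fun x v h => by
      have := 𝓗.sum_counit_fst h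
        (fun a => (unitEquiv 𝓗).symm x • V.act (V.twist v) (𝓗.twist a)) {}
      simpa [mul_smul] using this)

@[simp]
theorem leftUnitHom_tmul (V : RightHomModule 𝓗) (x) (v : V.carrier) :
    Hom.lin (leftUnitHom V) (tmul _ V x v) = (unitEquiv 𝓗).symm x • V.twist v := rfl

/-- The right unit constraint `v ⊗ x ↦ xν(v)`. -/
def rightUnitHom (V : RightHomModule 𝓗) : tensor V (trivial 𝓗) ⟶ V :=
  homDesc (Lin₂.toLinearMap (T := fun v x => (unitEquiv 𝓗).symm x • V.twist v) {})
    (fun x v => by simp)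
    (fun v x h => by
      have := 𝓗.sum_counit_snd h
        (fun a => (unitEquiv 𝓗).symm x • V.act (V.twist v) (𝓗.twist a)) {}
      simpa [mul_smul] using this)

@[simp]
theorem rightUnitHom_tmul (V : RightHomModule 𝓗) (x) (v : V.carrier) :
    Hom.lin (rightUnitHom V) (tmul V _ v x) = (unitEquiv 𝓗).symm x • V.twist v := rfl

/-- The associativity constraint as an isomorphism. -/
def associatorIso (U V W : RightHomModule 𝓗) :
    tensor (tensor U V) W ≅ tensor U (tensor V W) :=
  isoOfHom (assocHom U V W)
    (desc (LinearMap.flip (desc (Lin₃.toLinearMap (T := fun v w u =>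
      tmul (tensor U V) W (tmul U V (U.twist.symm u) v) (W.twist w)) {}))))
    (tensor_ext₃ fun u v w => by simp)
    (tensor_ext fun u p => by
      induction p using tensor_induction with
      | zero => simp
      | tmul v w => simp
      | add x y hx hy => simp only [map_add, hx, hy])

/-- The left unit constraint as an isomorphism. -/
def leftUnitorIso (V : RightHomModule 𝓗) : tensor (trivial 𝓗) V ≅ V :=
  isoOfHom (leftUnitHom V)
    (tmul (trivial 𝓗) V (unitEquiv 𝓗 1) ∘ₗ V.twist.symm.toLinearMap)
    (tensor_ext fun x v => by
      obtain ⟨x, rfl⟩ := (unitEquiv 𝓗).surjective x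
      -- Writing x as x • 1 lets the scalar be pulled out of the tensor.
      rw [← _root_.mul_one x, ← smul_eq_mul, map_smul]
      simp)
    (LinearMap.ext fun v => by simp)

/-- The right unit constraint as an isomorphism. -/
def rightUnitorIso (V : RightHomModule 𝓗) : tensor V (trivial 𝓗) ≅ V :=
  isoOfHom (rightUnitHom V)
    ((tmul V (trivial 𝓗)).flip (unitEquiv 𝓗 1) ∘ₗ V.twist.symm.toLinearMap)
    (tensor_ext fun v x => by
      obtain ⟨x, rfl⟩ := (unitEquiv 𝓗).surjective x
      rw [← _root_.mul_one x, ← smul_eq_mul, map_smul]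
      simp)
    (LinearMap.ext fun v => by simp)

@[simp]
theorem associatorIso_hom (U V W : RightHomModule 𝓗) :
    (associatorIso U V W).hom = assocHom U V W := rfl

@[simp]
theorem leftUnitorIso_hom (V : RightHomModule 𝓗) : (leftUnitorIso V).hom = leftUnitHom V := rfl

@[simp]
theorem rightUnitorIso_hom (V : RightHomModule 𝓗) : (rightUnitorIso V).hom = rightUnitHom V := rfl

instance : MonoidalCategoryStruct (RightHomModule 𝓗) where
  tensorObj := tensor
  whiskerLeft V _ _ f := tensorMap (𝟙 V) f
  whiskerRight f V := tensorMap f (𝟙 V)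
  tensorHom := tensorMap
  tensorUnit := trivial 𝓗
  associator := associatorIso
  leftUnitor := leftUnitorIso
  rightUnitor := rightUnitorIso

/-- All axioms are compared on pure tensors, where the twists of the constraints cancel. -/
instance : MonoidalCategory (RightHomModule 𝓗) :=
  MonoidalCategory.ofTensorHom
    (id_tensorHom_id := fun V W => hom_ext <| tensor_ext fun v w => by
      change Hom.lin (tensorMap (𝟙 V) (𝟙 W)) _ = tmul V W v w; simp)
    (id_tensorHom := fun _ _ _ _ => rfl)
    (tensorHom_id := fun _ _ => rfl)
    (tensorHom_comp_tensorHom := fun f₁ f₂ g₁ g₂ => hom_ext <| tensor_ext fun v w => by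
      change Hom.lin (tensorMap f₁ f₂ ≫ tensorMap g₁ g₂) _ =
        Hom.lin (tensorMap (f₁ ≫ g₁) (f₂ ≫ g₂)) _
      simp)
    (associator_naturality := fun f₁ f₂ f₃ => hom_ext <| tensor_ext₃ fun u v w => by
      change Hom.lin (tensorMap (tensorMap f₁ f₂) f₃ ≫ assocHom _ _ _) _ =
        Hom.lin (assocHom _ _ _ ≫ tensorMap f₁ (tensorMap f₂ f₃)) _
      simp)
    (leftUnitor_naturality := fun f => hom_ext <| tensor_ext fun x v => by
      change Hom.lin (tensorMap (𝟙 (trivial 𝓗)) f ≫ leftUnitHom _) (tmul (trivial 𝓗) _ x v) =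
        Hom.lin (leftUnitHom _ ≫ f) (tmul (trivial 𝓗) _ x v)
      simp)
    (rightUnitor_naturality := fun f => hom_ext <| tensor_ext fun v x => by
      change Hom.lin (tensorMap f (𝟙 (trivial 𝓗)) ≫ rightUnitHom _) (tmul _ (trivial 𝓗) v x) =
        Hom.lin (rightUnitHom _ ≫ f) (tmul _ (trivial 𝓗) v x)
      simp)
    (pentagon := fun W X Y Z => hom_ext <| tensor_ext₄ fun w x y z => by
      change Hom.lin (tensorMap (assocHom W X Y) (𝟙 Z) ≫ assocHom W (tensor X Y) Z ≫
        tensorMap (𝟙 W) (assocHom X Y Z)) _ =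
          Hom.lin (assocHom (tensor W X) Y Z ≫ assocHom W X (tensor Y Z)) _
      simp)
    (triangle := fun X Y => hom_ext <| tensor_ext₃ fun v x w => by
      change Hom.lin (assocHom X (trivial 𝓗) Y ≫ tensorMap (𝟙 X) (leftUnitHom Y))
        (tmul _ Y (tmul X (trivial 𝓗) v x) w) =
        Hom.lin (tensorMap (rightUnitHom X) (𝟙 Y)) (tmul _ Y (tmul X (trivial 𝓗) v x) w)
      simp)

/-- The tensor category of right Hom-modules has the diagonal tensor product over `k`. -/
def diagonalTensor : DiagonalTensor (𝟭 (RightHomModule 𝓗)) where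
  τ := tmul
  τ_bijective := tmul_bijective
  twist_τ _ _ _ _ := rfl
  act_τ := act_tmul_eq_lift
  unit := unitEquiv 𝓗
  twist_unit _ := rfl
  act_unit := act_unitEquiv
  map_τ _ _ _ _ := rfl
  associator_τ _ _ _ _ _ _ := rfl
  leftUnitor_τ _ _ _ := rfl
  rightUnitor_τ _ _ _ := rfl

end RightHomModule

/-! ## Left-covariant Hom-bimodules and their coinvariants -/

namespace LeftCovariantHomBimodule

variable {k H : Type u} [CommRing k] [AddCommGroup H] [Module k H]
  {𝓗 : MonoidalHomHopfAlgebra k H}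

attribute [local simp] TensorProduct.sum_tmul TensorProduct.tmul_sum LinearMap.sum_apply

attribute [simp] LeftCovariantHomBimodule.twist_lact LeftCovariantHomBimodule.twist_ract
  LeftCovariantHomBimodule.one_lact LeftCovariantHomBimodule.ract_one

section

variable (M : LeftCovariantHomBimodule 𝓗)

/-- The number of terms in `ρ(m) = m₍₋₁₎ ⊗ m₍₀₎`. -/
noncomputable def corank (m : M.carrier) : ℕ := tensorRank (M.lcoact m)

/-- The left factors `m₍₋₁₎` in `ρ(m) = m₍₋₁₎ ⊗ m₍₀₎`. -/
noncomputable def cofst (m : M.carrier) : Fin (M.corank m) → H := tensorFst (M.lcoact m)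

/-- The right factors `m₍₀₎` in `ρ(m) = m₍₋₁₎ ⊗ m₍₀₎`. -/
noncomputable def cosnd (m : M.carrier) : Fin (M.corank m) → M.carrier := tensorSnd (M.lcoact m)

@[simp low]
theorem lcoact_eq_sum (m : M.carrier) : M.lcoact m = ∑ i, M.cofst m i ⊗ₜ[k] M.cosnd m i :=
  eq_sum_tensor _

@[simp]
theorem twist_symm_lact (h : H) (m : M.carrier) :
    M.twist.symm (M.lact h m) = M.lact (𝓗.twist.symm h) (M.twist.symm m) := by
  rw [LinearEquiv.symm_apply_eq]; simp

@[simp]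
theorem lact_lact (a b : H) (m : M.carrier) :
    M.lact a (M.lact b m) = M.lact (𝓗.mul (𝓗.twist.symm a) b) (M.twist m) := by
  rw [← M.mul_lact]; simp

@[simp]
theorem ract_ract (m : M.carrier) (a b : H) :
    M.ract (M.ract m a) b = M.ract (M.twist m) (𝓗.mul a (𝓗.twist.symm b)) := by
  rw [← M.ract_mul]; simp

@[simp]
theorem ract_lact (m : M.carrier) (a b : H) :
    M.ract (M.lact a m) b = M.lact (𝓗.twist a) (M.ract m (𝓗.twist.symm b)) := by
  rw [← M.lact_ract]; simp

@[simp]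
theorem lcoact_twist' (m : M.carrier) : M.lcoact (M.twist m) =
    TensorProduct.map 𝓗.twist.toLinearMap M.twist.toLinearMap (M.lcoact m) := M.lcoact_twist m

@[simp]
theorem lcoact_twist_symm (m : M.carrier) : M.lcoact (M.twist.symm m) =
    TensorProduct.map 𝓗.twist.symm.toLinearMap M.twist.symm.toLinearMap (M.lcoact m) := by
  obtain ⟨m, rfl⟩ := M.twist.surjective m
  simp

-- Left covariance with right factor 1. Since (hm)1 = μ(hm), the condition is used for α⁻¹(h) after
-- the vector has been written as μ(m).
@[simp]
theorem lcoact_lact (h : H) (m : M.carrier) : M.lcoact (M.lact h m) =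
    TensorProduct.map₂ 𝓗.mul M.lact (𝓗.comul h) (M.lcoact m) := by
  obtain ⟨m, rfl⟩ := M.twist.surjective m
  have := M.left_covariant (𝓗.twist.symm h) m 𝓗.one
  rw [𝓗.twist_one, M.ract_one, M.twist_lact, LinearEquiv.apply_symm_apply, 𝓗.comul_one] at this
  rw [this, M.lcoact_twist, M.lcoact_eq_sum]
  simp only [map_sum, LinearMap.sum_apply, TensorProduct.map_tmul, TensorProduct.map₂_apply_tmul,
    LinearEquiv.coe_coe, 𝓗.mul_one, M.ract_one]

@[simp]
theorem lcoact_ract (m : M.carrier) (h : H) : M.lcoact (M.ract m h) =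
    TensorProduct.map₂ 𝓗.mul M.ract (M.lcoact m) (𝓗.comul h) := by
  obtain ⟨m, rfl⟩ := M.twist.surjective m
  obtain ⟨h, rfl⟩ := 𝓗.twist.surjective h
  have := M.left_covariant 𝓗.one m h
  rw [M.one_lact, 𝓗.twist_one, 𝓗.comul_one] at this
  rw [this, M.lcoact_twist, 𝓗.comul_twist, M.lcoact_eq_sum, 𝓗.comul_eq_sum]
  simp only [map_sum, LinearMap.sum_apply, TensorProduct.map_tmul, TensorProduct.map₂_apply_tmul,
    LinearEquiv.coe_coe, 𝓗.one_mul, M.one_lact, 𝓗.twist_mul, M.twist_ract]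

variable {X : Type*} [AddCommGroup X] [Module k X]

/-- `m₍₋₁₎₁ ⊗ m₍₋₁₎₂ ⊗ m₍₀₎ = α⁻¹(m₍₋₁₎) ⊗ m₍₀₎₍₋₁₎ ⊗ μ(m₍₀₎₍₀₎)`. -/
theorem sum_lcoact_fst (m : M.carrier) (T : H → H → M.carrier → X) (hT : Lin₃ k T) :
    ∑ i, ∑ j, T (𝓗.fst (M.cofst m i) j) (𝓗.snd (M.cofst m i) j) (M.cosnd m i) =
      ∑ i, ∑ j, T (𝓗.twist.symm (M.cofst m i)) (M.cofst (M.cosnd m i) j)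
        (M.twist (M.cosnd (M.cosnd m i) j)) := by
  obtain ⟨L, hL⟩ := hT.exists_lift
  have := congrArg (L ∘ₗ ((M.twist.toLinearMap.lTensor H).lTensor H)) (M.lcoact_coassoc m)
  simpa [hL] using this

theorem sum_counit_cofst (m : M.carrier) (T : M.carrier → X) (hT : Lin₁ k T) :
    ∑ i, 𝓗.counit (M.cofst m i) • T (M.cosnd m i) = T (M.twist.symm m) := by
  rw [← M.lcoact_counit]
  simp [hT.map_sum, hT.smul]

theorem leftProjection_apply (m : M.carrier) :
    leftProjection M m = ∑ i, M.lact (𝓗.antipode (M.cofst m i)) (M.cosnd m i) := by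
  simp [leftProjection]

@[simp]
theorem leftProjection_twist (m : M.carrier) :
    leftProjection M (M.twist m) = M.twist (leftProjection M m) := by
  simp [leftProjection]

@[simp]
theorem leftProjection_twist_symm (m : M.carrier) :
    leftProjection M (M.twist.symm m) = M.twist.symm (leftProjection M m) := by
  simp [leftProjection]

/-- `m = m₍₋₁₎P_L(m₍₀₎)`. -/
theorem sum_lact_leftProjection (m : M.carrier) :
    ∑ i, M.lact (M.cofst m i) (leftProjection M (M.cosnd m i)) = m := by
  -- Coassociativity turns m₍₋₁₎(S(m₍₀₎₍₋₁₎)m₍₀₎₍₀₎) into (m₍₋₁₎₁S(m₍₋₁₎₂))m₍₀₎, which the antipode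
  -- and the counit collapse to m.
  have h₁ := M.sum_lcoact_fst m (fun a b c => M.lact (𝓗.mul a (𝓗.antipode b)) c) {}
  have h₂ := fun i => 𝓗.sum_mul_antipode (M.cofst m i) (fun a => M.lact a (M.cosnd m i)) {}
  have h₃ := M.sum_counit_cofst m (fun m => M.twist m) {}
  simp only [h₂, M.one_lact, h₃] at h₁
  simpa [leftProjection_apply] using h₁.symm

/-- The diagonal left action on `H ⊗ M`. -/
def diagonalAct : H →ₗ[k] (H ⊗[k] M.carrier) →ₗ[k] (H ⊗[k] M.carrier) :=
  TensorProduct.map₂ 𝓗.mul M.lact ∘ₗ 𝓗.comul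

theorem diagonalAct_apply (h : H) (t : H ⊗[k] M.carrier) : M.diagonalAct h t =
    TensorProduct.map₂ 𝓗.mul M.lact (𝓗.comul h) t := rfl

theorem diagonalAct_diagonalAct (a b : H) (t : H ⊗[k] M.carrier) :
    M.diagonalAct a (M.diagonalAct b t) = M.diagonalAct (𝓗.mul (𝓗.twist.symm a) b)
      (TensorProduct.map 𝓗.twist.toLinearMap M.twist.toLinearMap t) := by
  induction t using TensorProduct.induction_on with
  | zero => simp
  | tmul h m =>
    simp [diagonalAct_apply]
  | add x y hx hy => simp only [map_add, hx, hy]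

theorem diagonalAct_one (t : H ⊗[k] M.carrier) : M.diagonalAct 𝓗.one t =
    TensorProduct.map 𝓗.twist.toLinearMap M.twist.toLinearMap t := by
  induction t using TensorProduct.induction_on with
  | zero => simp
  | tmul h m => simp [diagonalAct_apply]
  | add x y hx hy => simp only [map_add, hx, hy]

/-- A linear map `X` with `m₍₋₁₎X(m₍₀₎) = ρ(m)` that commutes with the automorphisms is
`m ↦ S(m₍₋₁₎)ρ(m₍₀₎)`. -/
theorem eq_sum_of_sum_diagonalAct (Φ : M.carrier →ₗ[k] H ⊗[k] M.carrier)
    (hΦ : ∀ m, Φ (M.twist m) =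
      TensorProduct.map 𝓗.twist.toLinearMap M.twist.toLinearMap (Φ m))
    (h : ∀ m, ∑ i, M.diagonalAct (M.cofst m i) (Φ (M.cosnd m i)) = M.lcoact m) (m : M.carrier) :
    Φ m = ∑ i, M.diagonalAct (𝓗.antipode (M.cofst m i)) (M.lcoact (M.cosnd m i)) := by
  -- The convolution inverse S cancels the action: with ρ(m₍₀₎) replaced by m₍₀₎₍₋₁₎Φ(m₍₀₎₍₀₎),
  -- coassociativity produces S(m₍₋₁₎₁)m₍₋₁₎₂ in front of Φ(m₍₀₎).
  have h₁ := M.sum_lcoact_fst m (fun a b c => M.diagonalAct (𝓗.mul (𝓗.antipode a) b) (Φ c)) {}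
  have h₂ := fun i => 𝓗.sum_antipode_mul (M.cofst m i)
    (fun a => M.diagonalAct a (Φ (M.cosnd m i))) {}
  have h₃ := M.sum_counit_cofst m (fun m => Φ (M.twist m)) {}
  simp only [h₂, diagonalAct_one, ← hΦ, h₃] at h₁
  simp only [← h, map_sum, diagonalAct_diagonalAct, ← hΦ]
  simpa using h₁

/-- `P_L(m)` is coinvariant. -/
theorem lcoact_leftProjection (m : M.carrier) : M.lcoact (leftProjection M m) =
    𝓗.one ⊗ₜ[k] leftProjection M (M.twist.symm m) := by
  -- Both ρ ∘ P_L and m ↦ 1 ⊗ P_L(μ⁻¹(m)) solve m₍₋₁₎Φ(m₍₀₎) = ρ(m), and the solution is unique.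
  -- Arguing by uniqueness avoids any formula for Δ ∘ S.
  have h₁ := M.eq_sum_of_sum_diagonalAct (M.lcoact ∘ₗ leftProjection M) (fun m => by
      simp only [LinearMap.comp_apply, leftProjection_twist, M.lcoact_twist]) (fun m => by
      conv_rhs => rw [← M.sum_lact_leftProjection m]
      simp only [map_sum, lcoact_lact]
      rfl) m
  have h₂ := M.eq_sum_of_sum_diagonalAct (TensorProduct.mk k H M.carrier 𝓗.one ∘ₗ
      leftProjection M ∘ₗ M.twist.symm.toLinearMap) (fun m => by simp) (fun m => by
      -- Coassociativity brings the sum to m₍₋₁₎ ⊗ m₍₀₎₍₋₁₎P_L(m₍₀₎₍₀₎), and the inner part is m₍₀₎.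
      have := M.sum_lcoact_fst m
        (fun a b c => 𝓗.twist a ⊗ₜ[k] M.lact b (M.twist.symm (leftProjection M c))) {}
      have h := fun i => M.sum_lact_leftProjection (M.cosnd m i)
      simp only [leftProjection_twist, LinearEquiv.apply_symm_apply, LinearEquiv.symm_apply_apply,
        ← TensorProduct.tmul_sum, h] at this
      simpa [diagonalAct_apply] using this) m
  exact h₁.trans h₂.symm

/-- Membership in the left Hom-coinvariants, unfolded. -/
theorem mem_leftCoinvariants {m : M.carrier} :
    m ∈ leftCoinvariants M ↔ M.lcoact m = 𝓗.one ⊗ₜ[k] M.twist.symm m := Iff.rfl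

variable {M}

/-- Because S(1) = 1, P_L(v) = 1μ⁻¹(v) = v. Together with the coinvariance of P_L(m) this makes P_L
a projection onto the coinvariants. -/
theorem leftProjection_of_lcoact {v : M.carrier} (hv : M.lcoact v = 𝓗.one ⊗ₜ[k] M.twist.symm v) :
    leftProjection M v = v := by
  simp [leftProjection, hv]

@[simp]
theorem leftProjection_leftProjection (m : M.carrier) :
    leftProjection M (leftProjection M m) = leftProjection M m :=
  leftProjection_of_lcoact (by rw [lcoact_leftProjection, leftProjection_twist_symm])

/-- Here ρ(hv) = α(h₁) ⊗ h₂μ⁻¹(v), so P_L(hv) contains S(h₁)h₂, which is ε(h)1. -/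
theorem leftProjection_lact_of_lcoact {v : M.carrier}
    (hv : M.lcoact v = 𝓗.one ⊗ₜ[k] M.twist.symm v) (h : H) :
    leftProjection M (M.lact h v) = 𝓗.counit h • M.twist v := by
  have := 𝓗.sum_antipode_mul h (fun a => M.lact a v) {}
  rw [leftProjection]
  simp only [LinearMap.comp_apply, lcoact_lact, hv]
  simpa using this

variable (M)

-- Writing m = m₍₋₁₎P_L(m₍₀₎) reduces to a product of an element of H with a coinvariant;
-- multiplicativity of ε and the counit then remove m₍₋₁₎.
@[simp]
theorem leftProjection_lact (h : H) (m : M.carrier) :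
    leftProjection M (M.lact h m) = 𝓗.counit h • M.twist (leftProjection M m) := by
  have h₁ := fun i => leftProjection_lact_of_lcoact (v := M.twist (leftProjection M (M.cosnd m i)))
    (by simp only [M.lcoact_twist, lcoact_leftProjection]; simp)
    (𝓗.mul (𝓗.twist.symm h) (M.cofst m i))
  have h₃ := M.sum_counit_cofst m (fun m => 𝓗.counit h • M.twist (M.twist (leftProjection M m))) {}
  conv_lhs => rw [← M.sum_lact_leftProjection m]
  simp only [map_sum, lact_lact, h₁]
  simpa [smul_smul, mul_comm] using h₃

/-- `P_L(P_L(m)h) = P_L(mh)`. -/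
@[simp]
theorem leftProjection_ract_leftProjection (m : M.carrier) (h : H) :
    leftProjection M (M.ract (leftProjection M m) h) = leftProjection M (M.ract m h) := by
  -- Expand only the m on the right. Left and right actions commute, so m₍₋₁₎ comes to the front and
  -- P_L reduces it to ε(m₍₋₁₎).
  conv_rhs => rw [← M.sum_lact_leftProjection m]
  have := M.sum_counit_cofst m (fun m => M.twist (leftProjection M
    (M.ract (leftProjection M m) (𝓗.twist.symm h)))) {}
  simp only [map_sum, LinearMap.sum_apply, ract_lact, leftProjection_lact, 𝓗.counit_twist, this]
  simp [← leftProjection_twist]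

/-- The reconstruction m = m₍₋₁₎P_L(m₍₀₎) for m = vh: by covariance ρ(vh) = α(h₁) ⊗ μ⁻¹(v)h₂. -/
theorem ract_eq_sum_of_lcoact {v : M.carrier}
    (hv : M.lcoact v = 𝓗.one ⊗ₜ[k] M.twist.symm v) (h : H) :
    M.ract v h = ∑ i, M.lact (𝓗.twist (𝓗.fst h i))
      (leftProjection M (M.ract (M.twist.symm v) (𝓗.snd h i))) := by
  have h' : ∀ L : H ⊗[k] M.carrier →ₗ[k] M.carrier, L (M.lcoact (M.ract v h)) =
      ∑ i, L (𝓗.twist (𝓗.fst h i) ⊗ₜ[k] M.ract (M.twist.symm v) (𝓗.snd h i)) := fun L => by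
    rw [lcoact_ract, hv]; simp
  have := h' (TensorProduct.lift (M.lact.compl₂ (leftProjection M)))
  rw [lcoact_eq_sum] at this
  simp only [map_sum, TensorProduct.lift.tmul, LinearMap.compl₂_apply] at this
  rw [← this, sum_lact_leftProjection]

end

end LeftCovariantHomBimodule

/-! ## The free functor -/

namespace RightHomModule

variable {k H : Type u} [CommRing k] [AddCommGroup H] [Module k H]
  {𝓗 : MonoidalHomHopfAlgebra k H}

attribute [local simp] TensorProduct.sum_tmul TensorProduct.tmul_sum LinearMap.sum_apply

/-- The left-covariant Hom-bimodule `H ⊗ V`. -/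
def free (V : RightHomModule 𝓗) : LeftCovariantHomBimodule 𝓗 where
  carrier := H ⊗[k] V.carrier
  twist := TensorProduct.congr 𝓗.twist V.twist
  lact := (TensorProduct.mapBilinear (.id k) H V.carrier H V.carrier).flip V.twist.toLinearMap ∘ₗ 𝓗.mul ∘ₗ
    𝓗.twist.symm.toLinearMap
  ract := (TensorProduct.map₂ 𝓗.mul V.act).compl₂ 𝓗.comul
  lcoact := 𝓗.twist.toLinearMap.rTensor _ ∘ₗ (TensorProduct.assoc k H H V.carrier).toLinearMap ∘ₗ
    TensorProduct.map 𝓗.comul V.twist.symm.toLinearMap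
  twist_lact a m := by
    induction m using TensorProduct.induction_on with
    | zero => simp
    | tmul g v => simp
    | add x y hx hy => simp only [map_add, hx, hy]
  twist_ract m a := by
    induction m using TensorProduct.induction_on with
    | zero => simp
    | tmul g v => simp
    | add x y hx hy => simp only [map_add, LinearMap.add_apply, hx, hy]
  mul_lact a b m := by
    induction m using TensorProduct.induction_on with
    | zero => simp
    | tmul g v => simp
    | add x y hx hy => simp only [map_add, hx, hy]
  one_lact m := by
    induction m using TensorProduct.induction_on with
    | zero => simp
    | tmul g v => simp
    | add x y hx hy => simp only [map_add, hx, hy]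
  ract_mul m a b := by
    induction m using TensorProduct.induction_on with
    | zero => simp
    | tmul g v => simp; rw [Finset.sum_comm]
    | add x y hx hy => simp only [map_add, LinearMap.add_apply, hx, hy]
  ract_one m := by
    induction m using TensorProduct.induction_on with
    | zero => simp
    | tmul g v => simp
    | add x y hx hy => simp only [map_add, LinearMap.add_apply, hx, hy]
  lact_ract a m b := by
    induction m using TensorProduct.induction_on with
    | zero => simp
    | tmul g v => simp
    | add x y hx hy => simp only [map_add, LinearMap.add_apply, hx, hy]
  lcoact_twist m := by
    induction m using TensorProduct.induction_on with
    | zero => simp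
    | tmul g v => simp
    | add x y hx hy => simp only [map_add, hx, hy]
  lcoact_coassoc m := by
    induction m using TensorProduct.induction_on with
    | zero => simp
    | tmul g v =>
      have := 𝓗.sum_comul_fst g (fun a b c => 𝓗.twist a ⊗ₜ[k] (𝓗.twist b ⊗ₜ[k]
        (𝓗.twist.symm c ⊗ₜ[k] V.twist.symm (V.twist.symm v)))) {}
      simpa using this
    | add x y hx hy => simp only [map_add, hx, hy]
  lcoact_counit m := by
    induction m using TensorProduct.induction_on with
    | zero => simp
    | tmul g v =>
      have := 𝓗.sum_counit_fst g (fun a => a ⊗ₜ[k] V.twist.symm v) {}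
      simpa using this
    | add x y hx hy => simp only [map_add, hx, hy]
  left_covariant h m g := by
    induction m using TensorProduct.induction_on with
    | zero => simp
    | tmul a v =>
      -- Only Δ(g) needs regrouping: the coaction of a product splits g₁ again, while ρ(m)Δ(g)
      -- splits g₂. The sums over Δ(h) and Δ(a) are only reordered.
      have := 𝓗.sum_comul_fst g (fun b c d => ∑ i, ∑ j,
        𝓗.mul (𝓗.twist (𝓗.fst h j)) (𝓗.mul (𝓗.twist (𝓗.fst a i)) (𝓗.twist b)) ⊗ₜ[k]
          (𝓗.mul (𝓗.snd h j) (𝓗.mul (𝓗.snd a i) c) ⊗ₜ[k] V.act v d)) {}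
      simp only [LinearEquiv.apply_symm_apply] at this
      simp
      refine this.trans (Finset.sum_congr rfl fun _ _ => Finset.sum_comm)
    | add x y hx hy => simp only [map_add, LinearMap.add_apply, hx, hy]

section

variable (V : RightHomModule 𝓗)

/-- The bilinear map `(g, v) ↦ g ⊗ v`. -/
def freeMk : H →ₗ[k] V.carrier →ₗ[k] V.free.carrier := TensorProduct.mk k H V.carrier

theorem lift_freeMk :
    TensorProduct.lift V.freeMk = LinearMap.id (R := k) (M := H ⊗[k] V.carrier) :=
  TensorProduct.ext' fun _ _ => rfl

theorem freeMk_bijective : Function.Bijective (TensorProduct.lift V.freeMk) := by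
  rw [lift_freeMk]
  exact Function.bijective_id

@[simp]
theorem twist_freeMk (g : H) (v : V.carrier) :
    V.free.twist (V.freeMk g v) = V.freeMk (𝓗.twist g) (V.twist v) := rfl

@[simp]
theorem twist_symm_freeMk (g : H) (v : V.carrier) :
    V.free.twist.symm (V.freeMk g v) = V.freeMk (𝓗.twist.symm g) (V.twist.symm v) := rfl

@[simp]
theorem lact_freeMk (h g : H) (v : V.carrier) :
    V.free.lact h (V.freeMk g v) = V.freeMk (𝓗.mul (𝓗.twist.symm h) g) (V.twist v) := rfl

theorem ract_freeMk_eq_lift (g : H) (v : V.carrier) (h : H) : V.free.ract (V.freeMk g v) h =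
    TensorProduct.lift V.freeMk (TensorProduct.map (𝓗.mul g) (V.act v) (𝓗.comul h)) := by
  rw [lift_freeMk]
  rfl

@[simp]
theorem ract_freeMk (g : H) (v : V.carrier) (h : H) : V.free.ract (V.freeMk g v) h =
    ∑ i, V.freeMk (𝓗.mul g (𝓗.fst h i)) (V.act v (𝓗.snd h i)) := by
  simp [ract_freeMk_eq_lift]

theorem lcoact_freeMk_eq_map (g : H) (v : V.carrier) : V.free.lcoact (V.freeMk g v) =
    TensorProduct.map 𝓗.twist.toLinearMap (V.freeMk.flip (V.twist.symm v)) (𝓗.comul g) := by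
  change LinearMap.rTensor _ 𝓗.twist.toLinearMap (TensorProduct.assoc k H H V.carrier
    (𝓗.comul g ⊗ₜ[k] V.twist.symm v)) = _
  generalize 𝓗.comul g = t
  induction t using TensorProduct.induction_on with
  | zero => simp only [TensorProduct.zero_tmul, map_zero]; rfl
  | tmul a b => rfl
  | add x y hx hy => simp only [TensorProduct.add_tmul, map_add, hx, hy]; rfl

@[simp]
theorem lcoact_freeMk (g : H) (v : V.carrier) : V.free.lcoact (V.freeMk g v) =
    ∑ i, 𝓗.twist (𝓗.fst g i) ⊗ₜ[k] V.freeMk (𝓗.snd g i) (V.twist.symm v) := by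
  simp [lcoact_freeMk_eq_map]

variable {V} {X : Type u} [AddCommGroup X] [Module k X]

/-- The linear map on `H ⊗ V` induced by a bilinear map. -/
def freeDesc (f : H →ₗ[k] V.carrier →ₗ[k] X) : V.free.carrier →ₗ[k] X := TensorProduct.lift f

@[simp]
theorem freeDesc_freeMk (f : H →ₗ[k] V.carrier →ₗ[k] X) (g : H) (v : V.carrier) :
    freeDesc f (V.freeMk g v) = f g v := rfl

@[elab_as_elim]
theorem free_induction {p : V.free.carrier → Prop} (zero : p 0) (tmul : ∀ g v, p (V.freeMk g v))
    (add : ∀ x y, p x → p y → p (x + y)) (x : V.free.carrier) : p x :=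
  TensorProduct.induction_on x zero tmul add

theorem free_ext {f g : V.free.carrier →ₗ[k] X}
    (h : ∀ a v, f (V.freeMk a v) = g (V.freeMk a v)) : f = g :=
  TensorProduct.ext' h

/-- The morphism on `H ⊗ V` induced by a bilinear map. -/
def freeHomDesc {M : LeftCovariantHomBimodule 𝓗} (f : H →ₗ[k] V.carrier →ₗ[k] M.carrier)
    (twist : ∀ g v, f (𝓗.twist g) (V.twist v) = M.twist (f g v))
    (lact : ∀ h g v, f (𝓗.mul (𝓗.twist.symm h) g) (V.twist v) = M.lact h (f g v))
    (ract : ∀ g v h, ∑ i, f (𝓗.mul g (𝓗.fst h i)) (V.act v (𝓗.snd h i)) = M.ract (f g v) h)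
    (lcoact : ∀ g v, M.lcoact (f g v) =
      ∑ i, 𝓗.twist (𝓗.fst g i) ⊗ₜ[k] f (𝓗.snd g i) (V.twist.symm v)) : V.free ⟶ M where
  lin := freeDesc f
  map_twist m := by
    induction m using free_induction with
    | zero => simp
    | tmul g v => simp [twist]
    | add x y hx hy => simp only [map_add, hx, hy]
  map_lact h m := by
    induction m using free_induction with
    | zero => simp
    | tmul g v => simp [lact]
    | add x y hx hy => simp only [map_add, hx, hy]
  map_ract m h := by
    induction m using free_induction with
    | zero => simp
    | tmul g v => simp [ract]
    | add x y hx hy => simp only [map_add, LinearMap.add_apply, hx, hy]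
  map_lcoact m := by
    induction m using free_induction with
    | zero => simp
    | tmul g v => rw [freeDesc_freeMk, lcoact]; simp
    | add x y hx hy => simp only [map_add, hx, hy]

end

end RightHomModule

/-! ### Morphisms of left-covariant Hom-bimodules -/

namespace LeftCovariantHomBimodule

variable {k H : Type u} [CommRing k] [AddCommGroup H] [Module k H]
  {𝓗 : MonoidalHomHopfAlgebra k H}

attribute [local simp] TensorProduct.sum_tmul TensorProduct.tmul_sum LinearMap.sum_apply

@[simp]
theorem id_lin (M : LeftCovariantHomBimodule 𝓗) : Hom.lin (𝟙 M) = LinearMap.id := rfl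

@[simp]
theorem comp_lin {L M N : LeftCovariantHomBimodule 𝓗} (f : L ⟶ M) (g : M ⟶ N) :
    Hom.lin (f ≫ g) = Hom.lin g ∘ₗ Hom.lin f := rfl

@[ext]
theorem hom_ext {M N : LeftCovariantHomBimodule 𝓗} {f g : M ⟶ N} (h : Hom.lin f = Hom.lin g) :
    f = g :=
  Hom.ext h

section

variable {M N : LeftCovariantHomBimodule 𝓗} (f : M ⟶ N)

@[simp]
theorem lin_twist (m : M.carrier) : Hom.lin f (M.twist m) = N.twist (Hom.lin f m) := f.map_twist m

@[simp]
theorem lin_twist_symm (m : M.carrier) :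
    Hom.lin f (M.twist.symm m) = N.twist.symm (Hom.lin f m) := by
  rw [LinearEquiv.eq_symm_apply, ← lin_twist]; simp

@[simp]
theorem lin_lact (h : H) (m : M.carrier) : Hom.lin f (M.lact h m) = N.lact h (Hom.lin f m) :=
  f.map_lact h m

@[simp]
theorem lin_ract (m : M.carrier) (h : H) : Hom.lin f (M.ract m h) = N.ract (Hom.lin f m) h :=
  f.map_ract m h

@[simp]
theorem lcoact_lin (m : M.carrier) :
    N.lcoact (Hom.lin f m) = (Hom.lin f).lTensor H (M.lcoact m) :=
  f.map_lcoact m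

@[simp]
theorem lin_leftProjection (m : M.carrier) :
    Hom.lin f (leftProjection M m) = leftProjection N (Hom.lin f m) := by
  simp [leftProjection]

/-- The isomorphism given by a morphism with a linear inverse. -/
def isoOfHom (g : N.carrier →ₗ[k] M.carrier)
    (h₁ : g ∘ₗ Hom.lin f = LinearMap.id) (h₂ : Hom.lin f ∘ₗ g = LinearMap.id) : M ≅ N where
  hom := f
  inv := ⟨g, fun n => by
      obtain ⟨m, rfl⟩ : ∃ m, Hom.lin f m = n := ⟨g n, LinearMap.congr_fun h₂ n⟩
      have h₁ : ∀ m, g (Hom.lin f m) = m := LinearMap.congr_fun h₁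
      rw [← lin_twist, h₁, h₁], fun h n => by
      obtain ⟨m, rfl⟩ : ∃ m, Hom.lin f m = n := ⟨g n, LinearMap.congr_fun h₂ n⟩
      have h₁ : ∀ m, g (Hom.lin f m) = m := LinearMap.congr_fun h₁
      rw [← lin_lact, h₁, h₁], fun n h => by
      obtain ⟨m, rfl⟩ : ∃ m, Hom.lin f m = n := ⟨g n, LinearMap.congr_fun h₂ n⟩
      have h₁ : ∀ m, g (Hom.lin f m) = m := LinearMap.congr_fun h₁
      rw [← lin_ract, h₁, h₁], fun n => by
      obtain ⟨m, rfl⟩ : ∃ m, Hom.lin f m = n := ⟨g n, LinearMap.congr_fun h₂ n⟩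
      have h₁' : ∀ m, g (Hom.lin f m) = m := LinearMap.congr_fun h₁
      rw [lcoact_lin, h₁', ← LinearMap.lTensor_comp_apply, h₁, LinearMap.lTensor_id_apply]⟩
  hom_inv_id := hom_ext h₁
  inv_hom_id := hom_ext h₂

end

/-! ## The coinvariants functor -/

section

variable (M : LeftCovariantHomBimodule 𝓗)

/-- `P_L` as a map onto the coinvariants. -/
noncomputable def toLeftCoinvariants : M.carrier →ₗ[k] leftCoinvariants M :=
  (leftProjection M).codRestrict (leftCoinvariants M) fun m => by
    rw [mem_leftCoinvariants, lcoact_leftProjection, leftProjection_twist_symm]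

@[simp]
theorem coe_toLeftCoinvariants (m : M.carrier) :
    (M.toLeftCoinvariants m : M.carrier) = leftProjection M m := rfl

/-- The right Hom-module of left Hom-coinvariants. -/
noncomputable def coinvariants : RightHomModule 𝓗 where
  carrier := leftCoinvariants M
  twist := LinearEquiv.ofLinearMap
    (M.twist.toLinearMap.restrict fun m hm => by
      rw [mem_leftCoinvariants] at hm ⊢; rw [LinearEquiv.coe_coe, M.lcoact_twist, hm]; simp)
    (M.twist.symm.toLinearMap.restrict fun m hm => by
      rw [mem_leftCoinvariants] at hm ⊢; rw [LinearEquiv.coe_coe, lcoact_twist_symm, hm]; simp)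
    (by ext; simp) (by ext; simp)
  act := (M.ract ∘ₗ (leftCoinvariants M).subtype).compr₂ M.toLeftCoinvariants
  twist_act m a := Subtype.ext <| by simp [← leftProjection_twist]
  -- The identity P_L(P_L(m)h) = P_L(mh) reduces this to the right action on M.
  act_mul m a b := Subtype.ext <| by simp
  act_one m := Subtype.ext <| by
    have := leftProjection_of_lcoact (v := (m : M.carrier)) m.2
    simp [this]

/-- The inclusion of the coinvariants. -/
noncomputable def incl : M.coinvariants.carrier →ₗ[k] M.carrier := (leftCoinvariants M).subtype

/-- The projection `P_L` onto the coinvariants. -/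
noncomputable def proj : M.carrier →ₗ[k] M.coinvariants.carrier := M.toLeftCoinvariants

theorem incl_injective : Function.Injective M.incl := Subtype.val_injective

theorem incl_range : LinearMap.range M.incl = leftCoinvariants M := Submodule.range_subtype _

@[simp]
theorem incl_proj (m : M.carrier) : M.incl (M.proj m) = leftProjection M m := rfl

theorem lcoact_incl' (v : M.coinvariants.carrier) :
    M.lcoact (M.incl v) = 𝓗.one ⊗ₜ[k] M.twist.symm (M.incl v) := v.2

@[simp]
theorem incl_twist (v : M.coinvariants.carrier) :
    M.incl (M.coinvariants.twist v) = M.twist (M.incl v) := rfl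

@[simp]
theorem incl_twist_symm (v : M.coinvariants.carrier) :
    M.incl (M.coinvariants.twist.symm v) = M.twist.symm (M.incl v) := rfl

@[simp]
theorem lcoact_incl (v : M.coinvariants.carrier) :
    M.lcoact (M.incl v) = 𝓗.one ⊗ₜ[k] M.incl (M.coinvariants.twist.symm v) := v.2

@[simp]
theorem incl_act (v : M.coinvariants.carrier) (h : H) :
    M.incl (M.coinvariants.act v h) = leftProjection M (M.ract (M.incl v) h) := rfl

@[simp]
theorem leftProjection_incl (v : M.coinvariants.carrier) :
    leftProjection M (M.incl v) = M.incl v :=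
  leftProjection_of_lcoact v.2

@[simp]
theorem proj_incl (v : M.coinvariants.carrier) : M.proj (M.incl v) = v :=
  M.incl_injective (by simp)

theorem proj_twist (m : M.carrier) : M.proj (M.twist m) = M.coinvariants.twist (M.proj m) :=
  M.incl_injective (by simp)

theorem proj_twist_symm (m : M.carrier) :
    M.proj (M.twist.symm m) = M.coinvariants.twist.symm (M.proj m) :=
  M.incl_injective (by simp)

@[simp]
theorem proj_lact (h : H) (m : M.carrier) :
    M.proj (M.lact h m) = 𝓗.counit h • M.coinvariants.twist (M.proj m) :=
  M.incl_injective (by simp)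

theorem proj_ract_incl (v : M.coinvariants.carrier) (h : H) :
    M.proj (M.ract (M.incl v) h) = M.coinvariants.act v h :=
  M.incl_injective (by simp)

/-- `vh = α(h₁)(ν⁻¹(v) ◁ h₂)` for coinvariant `v`. -/
theorem ract_incl (v : M.coinvariants.carrier) (h : H) : M.ract (M.incl v) h =
    TensorProduct.lift ((M.lact ∘ₗ 𝓗.twist.toLinearMap).compl₂
      (M.incl ∘ₗ M.coinvariants.act (M.coinvariants.twist.symm v))) (𝓗.comul h) := by
  simpa using M.ract_eq_sum_of_lcoact (M.lcoact_incl' v) h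

variable {M} {N : LeftCovariantHomBimodule 𝓗}

/-- The restriction of a morphism to the coinvariants. -/
noncomputable def coinvariantsMap (f : M ⟶ N) : M.coinvariants ⟶ N.coinvariants where
  lin := N.proj ∘ₗ Hom.lin f ∘ₗ M.incl
  map_twist v := by simp [proj_twist]
  map_act v h := N.incl_injective (by simp)

-- The projection in `coinvariantsMap` does nothing: a morphism commutes with P_L, so it sends
-- coinvariants to vectors fixed by P_L.
@[simp]
theorem incl_coinvariantsMap (f : M ⟶ N) (v : M.coinvariants.carrier) :
    N.incl (RightHomModule.Hom.lin (coinvariantsMap f) v) = Hom.lin f (M.incl v) := by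
  change N.incl (N.proj (Hom.lin f (M.incl v))) = _
  simp [← lin_leftProjection]

end

end LeftCovariantHomBimodule

/-! ## The equivalence -/

section

variable {k H : Type u} [CommRing k] [AddCommGroup H] [Module k H]
  {𝓗 : MonoidalHomHopfAlgebra k H}

attribute [local simp] TensorProduct.sum_tmul TensorProduct.tmul_sum LinearMap.sum_apply

open RightHomModule LeftCovariantHomBimodule

/-- `id ⊗ f`. -/
def RightHomModule.freeMap {V W : RightHomModule 𝓗} (f : V ⟶ W) : V.free ⟶ W.free :=
  freeHomDesc (W.freeMk.compl₂ (RightHomModule.Hom.lin f)) (by simp) (by simp) (by simp) (by simp)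

@[simp]
theorem RightHomModule.freeMap_freeMk {V W : RightHomModule 𝓗} (f : V ⟶ W) (g : H)
    (v : V.carrier) : LeftCovariantHomBimodule.Hom.lin (freeMap f) (V.freeMk g v) =
      W.freeMk g (RightHomModule.Hom.lin f v) := rfl

variable (𝓗) in
/-- The functor `V ↦ H ⊗ V`. -/
def freeFunctor : RightHomModule 𝓗 ⥤ LeftCovariantHomBimodule 𝓗 where
  obj := free
  map := freeMap
  map_id V := LeftCovariantHomBimodule.hom_ext <| free_ext fun g v => by simp
  map_comp f g := LeftCovariantHomBimodule.hom_ext <| free_ext fun g v => by simp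

variable (𝓗) in
/-- The functor of left Hom-coinvariants. -/
noncomputable def coinvariantsFunctor : LeftCovariantHomBimodule 𝓗 ⥤ RightHomModule 𝓗 where
  obj := coinvariants
  map := coinvariantsMap
  map_id M := RightHomModule.hom_ext <| LinearMap.ext fun v => M.incl_injective (by simp)
  map_comp {L M N} f g := RightHomModule.hom_ext <| LinearMap.ext fun v =>
    N.incl_injective (by simp)

/-- The counit `H ⊗ ^{coH}M → M`, `h ⊗ m ↦ hm`. -/
noncomputable def LeftCovariantHomBimodule.counitHom (M : LeftCovariantHomBimodule 𝓗) :
    M.coinvariants.free ⟶ M :=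
  freeHomDesc (M.lact.compl₂ M.incl) (by simp) (by simp)
    -- Right linearity is the formula vh = α(h₁)(ν⁻¹(v) ◁ h₂). The rule `incl_act` is switched off
    -- because it would unfold ◁ into P_L(vh) again.
    (fun g v h => by simp [ract_incl, -incl_act, ← incl_twist])
    (fun g v => by simp)

@[simp]
theorem LeftCovariantHomBimodule.counitHom_freeMk (M : LeftCovariantHomBimodule 𝓗) (h : H)
    (v : M.coinvariants.carrier) : Hom.lin M.counitHom (M.coinvariants.freeMk h v) =
      M.lact h (M.incl v) := rfl

/-- The counit is an isomorphism with inverse `m ↦ m₍₋₁₎ ⊗ P_L(m₍₀₎)`. -/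
noncomputable def LeftCovariantHomBimodule.counitEquiv (M : LeftCovariantHomBimodule 𝓗) :
    M.coinvariants.free ≅ M :=
  isoOfHom M.counitHom
    (TensorProduct.lift (M.coinvariants.freeMk.compl₂ M.proj) ∘ₗ M.lcoact)
    (free_ext fun h v => by
      have := 𝓗.sum_counit_snd h (fun a => M.coinvariants.freeMk (𝓗.twist a) v) {}
      simpa [proj_twist_symm] using this)
    (LinearMap.ext fun m => by
      have := M.sum_lact_leftProjection m
      simpa using this)

-- S(α(g₁))(g₂ ⊗ ν⁻¹(v)) = S(g₁)g₂ ⊗ v, and the antipode axiom applies. Hence every coinvariant of H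
-- ⊗ V has the form 1 ⊗ v.
@[simp]
theorem RightHomModule.leftProjection_freeMk (V : RightHomModule 𝓗) (g : H) (v : V.carrier) :
    leftProjection V.free (V.freeMk g v) = 𝓗.counit g • V.freeMk 𝓗.one v := by
  have := 𝓗.sum_antipode_mul g (fun a => V.freeMk a v) {}
  simpa [leftProjection_apply, leftProjection] using this

/-- The unit `v ↦ 1 ⊗ ν⁻¹(v)`. -/
noncomputable def RightHomModule.unitHom (V : RightHomModule 𝓗) : V ⟶ V.free.coinvariants where
  lin := V.free.proj ∘ₗ V.freeMk 𝓗.one ∘ₗ V.twist.symm.toLinearMap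
  map_twist v := by simp [← proj_twist]
  map_act v h := V.free.incl_injective (by
    have := 𝓗.sum_counit_fst h (fun a => V.freeMk 𝓗.one (V.act (V.twist.symm v) a)) {}
    simpa using this.symm)

@[simp]
theorem RightHomModule.incl_unitHom (V : RightHomModule 𝓗) (v : V.carrier) :
    V.free.incl (RightHomModule.Hom.lin V.unitHom v) = V.freeMk 𝓗.one (V.twist.symm v) := by
  change V.free.incl (V.free.proj (V.freeMk 𝓗.one (V.twist.symm v))) = _
  simp

/-- The unit as an isomorphism. -/
noncomputable def RightHomModule.unitEquivalence (V : RightHomModule 𝓗) :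
    V ≅ V.free.coinvariants :=
  RightHomModule.isoOfHom V.unitHom
    (freeDesc (Lin₂.toLinearMap (T := fun g v => 𝓗.counit g • V.twist v) {}) ∘ₗ V.free.incl)
    (LinearMap.ext fun v => by simp)
    (LinearMap.ext fun x => V.free.incl_injective (by
      -- The inverse of the unit is g ⊗ v ↦ ε(g)ν(v). Followed by v ↦ 1 ⊗ ν⁻¹(v) it is P_L, the
      -- identity on coinvariants.
      have h : V.freeMk 𝓗.one ∘ₗ V.twist.symm.toLinearMap ∘ₗ freeDesc
          (Lin₂.toLinearMap (T := fun g v => 𝓗.counit g • V.twist v) {}) =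
            leftProjection V.free := free_ext fun g v => by simp
      have := LinearMap.congr_fun h (V.free.incl x)
      simpa using this))

variable (𝓗) in
/-- `H ⊗ -` and `^{coH}(-)` are mutually inverse equivalences. -/
noncomputable def freeEquivalence : RightHomModule 𝓗 ≌ LeftCovariantHomBimodule 𝓗 where
  functor := freeFunctor 𝓗
  inverse := coinvariantsFunctor 𝓗
  unitIso := NatIso.ofComponents RightHomModule.unitEquivalence fun {V W} f =>
    RightHomModule.hom_ext <| LinearMap.ext fun v => W.free.incl_injective <| by
      change W.free.incl (RightHomModule.Hom.lin (f ≫ W.unitHom) v) =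
        W.free.incl (RightHomModule.Hom.lin (V.unitHom ≫ coinvariantsMap (freeMap f)) v)
      simp
  counitIso := NatIso.ofComponents LeftCovariantHomBimodule.counitEquiv fun {M N} f =>
    LeftCovariantHomBimodule.hom_ext <| free_ext (V := M.coinvariants) fun h v => by
      change Hom.lin (freeMap (coinvariantsMap f) ≫ N.counitHom) (M.coinvariants.freeMk h v) =
        Hom.lin (M.counitHom ≫ f) (M.coinvariants.freeMk h v)
      simp
  -- The composite sends h ⊗ v to h(1 ⊗ ν⁻¹(v)) = α⁻¹(h)1 ⊗ v = h ⊗ v.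
  functor_unitIso_comp V := LeftCovariantHomBimodule.hom_ext <| free_ext fun h v => by
    change Hom.lin (freeMap V.unitHom ≫ V.free.counitHom) (V.freeMk h v) = V.freeMk h v
    simp

variable (𝓗) in
/-- `H ⊗ -` is the free functor. -/
noncomputable def freeFunctorData :
    FreeFunctor (𝟭 (RightHomModule 𝓗)) (𝟭 (LeftCovariantHomBimodule 𝓗))
      (freeEquivalence 𝓗).functor where
  ι := freeMk
  ι_bijective := freeMk_bijective
  twist_ι _ _ _ := rfl
  lact_ι _ _ _ _ := rfl
  ract_ι := ract_freeMk_eq_lift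
  lcoact_ι := lcoact_freeMk_eq_map
  map_ι _ _ _ := rfl

variable (𝓗) in
/-- `^{coH}(-)` is the functor of coinvariants. -/
noncomputable def coinvariantsFunctorData :
    CoinvariantsFunctor (𝟭 (RightHomModule 𝓗)) (𝟭 (LeftCovariantHomBimodule 𝓗))
      (freeEquivalence 𝓗).inverse where
  κ := incl
  κ_injective := incl_injective
  κ_range := incl_range
  κ_twist _ _ := rfl
  κ_act _ _ _ := rfl
  κ_map := incl_coinvariantsMap

end

/-! ## The tensor structure of the free functor -/

/-- The chosen factors h₁, h₂ do not depend linearly on h; the sum does, being a linear map applied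
to Δ(h). This supplies linearity where the default `{}` cannot find it. -/
theorem MonoidalHomHopfAlgebra.lin_sum_comul {k H : Type u} {X : Type*} [CommRing k]
    [AddCommGroup H]
    [Module k H] [AddCommGroup X] [Module k X] (𝓗 : MonoidalHomHopfAlgebra k H) {T : H → H → X}
    (hT : Lin₂ k T) : Lin₁ k fun h => ∑ i, T (𝓗.fst h i) (𝓗.snd h i) := by
  have : (fun h => ∑ i, T (𝓗.fst h i) (𝓗.snd h i)) =
      TensorProduct.lift hT.toLinearMap ∘ₗ 𝓗.comul := by
    ext h; simp
  rw [this]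
  exact ⟨map_add _, map_smul _⟩

section

variable {k H : Type u} [CommRing k] [AddCommGroup H] [Module k H]
  {𝓗 : MonoidalHomHopfAlgebra k H}

attribute [local simp] TensorProduct.sum_tmul TensorProduct.tmul_sum LinearMap.sum_apply

variable {C D : Type*} [Category* C] [Category* D] {U : C ⥤ RightHomModule 𝓗}
  {U' : D ⥤ LeftCovariantHomBimodule 𝓗}

namespace FreeFunctor

variable {F : C ⥤ D} (f : FreeFunctor U U' F)

attribute [simp] FreeFunctor.twist_ι FreeFunctor.lact_ι FreeFunctor.ract_ι FreeFunctor.lcoact_ι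
  FreeFunctor.map_ι

@[simp]
theorem twist_symm_ι (V : C) (g : H) (v : (U.obj V).carrier) :
    (U'.obj (F.obj V)).twist.symm (f.ι V g v) =
      f.ι V (𝓗.twist.symm g) ((U.obj V).twist.symm v) := by
  rw [LinearEquiv.symm_apply_eq]; simp

@[elab_as_elim]
theorem induction {V : C} {p : (U'.obj (F.obj V)).carrier → Prop} (zero : p 0)
    (ι : ∀ g v, p (f.ι V g v)) (add : ∀ x y, p x → p y → p (x + y))
    (x : (U'.obj (F.obj V)).carrier) : p x := by
  obtain ⟨t, rfl⟩ := (f.ι_bijective V).surjective x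
  induction t using TensorProduct.induction_on with
  | zero => simpa using zero
  | tmul g v => exact ι g v
  | add x y hx hy => rw [map_add]; exact add _ _ hx hy

variable {X : Type*} [AddCommGroup X] [Module k X]

theorem ext {V : C} {p q : (U'.obj (F.obj V)).carrier →ₗ[k] X}
    (h : ∀ g v, p (f.ι V g v) = q (f.ι V g v)) : p = q :=
  LinearMap.ext fun x => by
    induction x using f.induction with
    | zero => simp
    | ι g v => exact h g v
    | add x y hx hy => simp only [map_add, hx, hy]

theorem ext₂ {V W : C}
    {p q : (U'.obj (F.obj V)).carrier →ₗ[k] (U'.obj (F.obj W)).carrier →ₗ[k] X}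
    (h : ∀ g v h w, p (f.ι V g v) (f.ι W h w) = q (f.ι V g v) (f.ι W h w)) : p = q :=
  f.ext fun g v => f.ext (h g v)

/-- The linear map on `F V` induced by a bilinear map. -/
noncomputable def desc {V : C} (p : H →ₗ[k] (U.obj V).carrier →ₗ[k] X) :
    (U'.obj (F.obj V)).carrier →ₗ[k] X :=
  TensorProduct.lift p ∘ₗ (LinearEquiv.ofBijective _ (f.ι_bijective V)).symm.toLinearMap

@[simp]
theorem desc_ι {V : C} (p : H →ₗ[k] (U.obj V).carrier →ₗ[k] X) (g : H) (v : (U.obj V).carrier) :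
    f.desc p (f.ι V g v) = p g v := by
  have : (LinearEquiv.ofBijective _ (f.ι_bijective V)).symm (f.ι V g v) = g ⊗ₜ v := by
    rw [LinearEquiv.symm_apply_eq]; simp
  simp [desc, this]

variable [MonoidalCategory C] (S : DiagonalTensor U)

attribute [simp] DiagonalTensor.twist_τ DiagonalTensor.act_τ DiagonalTensor.map_τ
  DiagonalTensor.associator_τ DiagonalTensor.leftUnitor_τ DiagonalTensor.rightUnitor_τ
  DiagonalTensor.twist_unit DiagonalTensor.act_unit

@[simp]
theorem _root_.DiagonalTensor.twist_symm_τ (V W : C) (v : (U.obj V).carrier)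
    (w : (U.obj W).carrier) : (U.obj (tensorObj V W)).twist.symm (S.τ V W v w) =
      S.τ V W ((U.obj V).twist.symm v) ((U.obj W).twist.symm w) := by
  rw [LinearEquiv.symm_apply_eq]; simp

/-- `φ₂((g ⊗ v) ⊗ (h ⊗ w)) = gα(h₁) ⊗ (ν⁻¹(v) ◁ h₂ ⊗ w)`. -/
noncomputable def prod (V W : C) : (U'.obj (F.obj V)).carrier →ₗ[k]
    (U'.obj (F.obj W)).carrier →ₗ[k] (U'.obj (F.obj (tensorObj V W))).carrier :=
  f.desc (Lin₂.toLinearMap (T := fun g v => f.desc (Lin₂.toLinearMap (T := fun h w =>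
    ∑ i, f.ι (tensorObj V W) (𝓗.mul g (𝓗.twist (𝓗.fst h i)))
      (S.τ V W ((U.obj V).act ((U.obj V).twist.symm v) (𝓗.snd h i)) w))
    ⟨fun w => 𝓗.lin_sum_comul (T := fun a b => f.ι (tensorObj V W) (𝓗.mul g (𝓗.twist a))
      (S.τ V W ((U.obj V).act ((U.obj V).twist.symm v) b) w)) {}, fun _ => {}⟩))
    ⟨fun v => ⟨fun g g' => f.ext fun h w => by simp [Finset.sum_add_distrib],
      fun r g => f.ext fun h w => by simp [Finset.smul_sum]⟩,
      fun g => ⟨fun v v' => f.ext fun h w => by simp [Finset.sum_add_distrib],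
      fun r v => f.ext fun h w => by simp [Finset.smul_sum]⟩⟩)

theorem prod_ι (V W : C) (g h : H) (v : (U.obj V).carrier) (w : (U.obj W).carrier) :
    f.prod S V W (f.ι V g v) (f.ι W h w) = TensorProduct.lift (f.ι (tensorObj V W))
      (TensorProduct.map (𝓗.mul g ∘ₗ 𝓗.twist.toLinearMap)
        ((S.τ V W).flip w ∘ₗ (U.obj V).act ((U.obj V).twist.symm v)) (𝓗.comul h)) := by
  simp [prod]

theorem twist_prod (V W : C) (a b) : (U'.obj (F.obj (tensorObj V W))).twist (f.prod S V W a b) =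
    f.prod S V W ((U'.obj (F.obj V)).twist a) ((U'.obj (F.obj W)).twist b) := by
  have : (f.prod S V W).compr₂ (U'.obj (F.obj (tensorObj V W))).twist.toLinearMap =
      (f.prod S V W).compl₁₂ (U'.obj (F.obj V)).twist.toLinearMap
        (U'.obj (F.obj W)).twist.toLinearMap := f.ext₂ fun g v h w => by simp [prod_ι]
  exact LinearMap.congr_fun₂ this a b

theorem lact_prod (V W : C) (h : H) (a b) :
    (U'.obj (F.obj (tensorObj V W))).lact h (f.prod S V W a b) =
      f.prod S V W ((U'.obj (F.obj V)).lact (𝓗.twist.symm h) a)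
        ((U'.obj (F.obj W)).twist b) := by
  have : (f.prod S V W).compr₂ ((U'.obj (F.obj (tensorObj V W))).lact h) =
      (f.prod S V W).compl₁₂ ((U'.obj (F.obj V)).lact (𝓗.twist.symm h))
        (U'.obj (F.obj W)).twist.toLinearMap := f.ext₂ fun g v h w => by simp [prod_ι]
  exact LinearMap.congr_fun₂ this a b

/-- On the left the diagonal action on v ⊗ w splits h₂ again, on the right φ₂ splits h₁.
Hom-coassociativity for h reconciles the two. -/
theorem ract_prod (V W : C) (h : H) (a b) :
    (U'.obj (F.obj (tensorObj V W))).ract (f.prod S V W a b) h =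
      f.prod S V W ((U'.obj (F.obj V)).twist a)
        ((U'.obj (F.obj W)).ract b (𝓗.twist.symm h)) := by
  have : (f.prod S V W).compr₂ ((U'.obj (F.obj (tensorObj V W))).ract.flip h) =
      (f.prod S V W).compl₁₂ (U'.obj (F.obj V)).twist.toLinearMap
        ((U'.obj (F.obj W)).ract.flip (𝓗.twist.symm h)) := f.ext₂ fun g v x w => by
    have := 𝓗.sum_comul_fst h (fun a b c => ∑ i, f.ι (V ⊗ W)
      (𝓗.mul (𝓗.twist g) (𝓗.mul (𝓗.twist (𝓗.fst x i)) a)) (S.τ V W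
        ((U.obj V).act v (𝓗.mul (𝓗.snd x i) (𝓗.twist.symm b)))
          ((U.obj W).act w (𝓗.twist.symm c)))) {}
    simp only [LinearEquiv.symm_apply_apply] at this
    simp [prod_ι]
    rw [Finset.sum_comm]
    exact (Finset.sum_congr rfl fun _ _ => Finset.sum_comm).trans this.symm
  exact LinearMap.congr_fun₂ this a b

/-- For b = x ⊗ w, the coaction of φ₂(a, b) splits x₁, while φ₂ after the coaction of b splits x₂.
-/
theorem lcoact_prod (V W : C) (a b) :
    (U'.obj (F.obj (tensorObj V W))).lcoact (f.prod S V W a b) =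
      TensorProduct.map₂ 𝓗.mul (f.prod S V W) ((U'.obj (F.obj V)).lcoact a)
        ((U'.obj (F.obj W)).lcoact b) := by
  have : (f.prod S V W).compr₂ (U'.obj (F.obj (tensorObj V W))).lcoact =
      (TensorProduct.map₂ 𝓗.mul (f.prod S V W)).compl₁₂ (U'.obj (F.obj V)).lcoact
        (U'.obj (F.obj W)).lcoact := f.ext₂ fun g v x w => by
    have := 𝓗.sum_comul_fst x (fun a b c => ∑ i,
      𝓗.mul (𝓗.twist (𝓗.fst g i)) (𝓗.twist (𝓗.twist a)) ⊗ₜ[k]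
        f.ι (V ⊗ W) (𝓗.mul (𝓗.snd g i) (𝓗.twist b)) (S.τ V W
          ((U.obj V).act ((U.obj V).twist.symm ((U.obj V).twist.symm v)) (𝓗.twist.symm c))
            ((U.obj W).twist.symm w))) {}
    simp only [LinearEquiv.symm_apply_apply, LinearEquiv.apply_symm_apply] at this
    simp [prod_ι]
    exact this.trans (Finset.sum_congr rfl fun _ _ => Finset.sum_comm)
  exact LinearMap.congr_fun₂ this a b

theorem map_prod {V V' W W' : C} (p : V ⟶ V') (q : W ⟶ W') (a b) :
    LeftCovariantHomBimodule.Hom.lin (U'.map (F.map (tensorHom p q))) (f.prod S V W a b) =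
      f.prod S V' W' (LeftCovariantHomBimodule.Hom.lin (U'.map (F.map p)) a)
        (LeftCovariantHomBimodule.Hom.lin (U'.map (F.map q)) b) := by
  have : (f.prod S V W).compr₂
        (LeftCovariantHomBimodule.Hom.lin (U'.map (F.map (tensorHom p q)))) =
      (f.prod S V' W').compl₁₂ (LeftCovariantHomBimodule.Hom.lin (U'.map (F.map p)))
        (LeftCovariantHomBimodule.Hom.lin (U'.map (F.map q))) := f.ext₂ fun g v x w => by
    simp [prod_ι]
  exact LinearMap.congr_fun₂ this a b

/-- φ₂ is balanced because Δ is multiplicative: both sides contain h₁x₁ in the first factor and the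
action by h₂x₂ in the second, up to twists. This uses Hom-associativity of the product and of the
action, but no coassociativity. -/
theorem prod_ract (V W : C) (h : H) (a b) :
    f.prod S V W ((U'.obj (F.obj V)).ract a h) b =
      f.prod S V W ((U'.obj (F.obj V)).twist a)
        ((U'.obj (F.obj W)).lact h ((U'.obj (F.obj W)).twist.symm b)) := by
  have : (f.prod S V W) ∘ₗ ((U'.obj (F.obj V)).ract.flip h) =
      (f.prod S V W).compl₁₂ (U'.obj (F.obj V)).twist.toLinearMap
        ((U'.obj (F.obj W)).lact h ∘ₗ (U'.obj (F.obj W)).twist.symm.toLinearMap) :=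
      f.ext₂ fun g v x w => by
    simp [prod_ι]
    rw [Finset.sum_comm]
  exact LinearMap.congr_fun₂ this a b

/-- For c = x ⊗ z, the left side splits x₂ through the diagonal action on v ⊗ w, and the right side
splits x₁ through the outer φ₂. -/
theorem associator_prod (V W Z : C) (a b c) :
    LeftCovariantHomBimodule.Hom.lin (U'.map (F.map (associator V W Z).hom))
        (f.prod S (tensorObj V W) Z (f.prod S V W a b) c) =
      f.prod S V (tensorObj W Z) ((U'.obj (F.obj V)).twist a)
        (f.prod S W Z b ((U'.obj (F.obj Z)).twist.symm c)) := by
  induction a using f.induction with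
  | zero => simp
  | add x y hx hy => simp only [map_add, LinearMap.add_apply, hx, hy]
  | ι g v =>
  induction b using f.induction with
  | zero => simp
  | add x y hx hy => simp only [map_add, LinearMap.add_apply, hx, hy]
  | ι h w =>
  induction c using f.induction with
  | zero => simp
  | add x y hx hy => simp only [map_add, hx, hy]
  | ι x z =>
  have := 𝓗.sum_comul_fst x (fun a b c => ∑ i, f.ι (V ⊗ W ⊗ Z)
    (𝓗.mul (𝓗.twist g) (𝓗.mul (𝓗.twist (𝓗.fst h i)) (𝓗.twist a))) (S.τ V (W ⊗ Z)
      ((U.obj V).act v (𝓗.mul (𝓗.snd h i) b)) (S.τ W Z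
        ((U.obj W).act ((U.obj W).twist.symm w) (𝓗.twist.symm c))
          ((U.obj Z).twist.symm z)))) {}
  simp only [LinearEquiv.symm_apply_apply, LinearEquiv.apply_symm_apply] at this
  simp [prod_ι]
  rw [Finset.sum_comm]
  exact (Finset.sum_congr rfl fun _ _ => Finset.sum_comm).trans this.symm

@[simp]
theorem _root_.DiagonalTensor.twist_symm_unit (x : k) :
    (U.obj (𝟙_ C)).twist.symm (S.unit x) = S.unit x := by
  rw [LinearEquiv.symm_apply_eq]; simp

/-- The trivial action on k turns g₂ into ε(g₂), and the counit removes the splitting of g. -/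
theorem leftUnitor_prod (V : C) (h : H) (a) :
    LeftCovariantHomBimodule.Hom.lin (U'.map (F.map (leftUnitor V).hom))
      (f.prod S (𝟙_ C) V (f.ι (𝟙_ C) (𝓗.twist.symm h) (S.unit 1)) a) =
        (U'.obj (F.obj V)).lact h a := by
  induction a using f.induction with
  | zero => simp
  | add x y hx hy => simp only [map_add, hx, hy]
  | ι g v =>
  have := 𝓗.sum_counit_snd g (fun a =>
    f.ι V (𝓗.mul (𝓗.twist.symm h) (𝓗.twist a)) ((U.obj V).twist v)) {}
  simpa [prod_ι] using this

theorem rightUnitor_prod (V : C) (h : H) (a) :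
    LeftCovariantHomBimodule.Hom.lin (U'.map (F.map (rightUnitor V).hom))
      (f.prod S V (𝟙_ C) a (f.ι (𝟙_ C) (𝓗.twist.symm h) (S.unit 1))) =
        (U'.obj (F.obj V)).ract a h := by
  induction a using f.induction with
  | zero => simp
  | add x y hx hy => simp only [map_add, LinearMap.add_apply, hx, hy]
  | ι g v => simp [prod_ι]

/-- A right inverse of `φ₂`, `g ⊗ (v ⊗ w) ↦ (α⁻¹(g) ⊗ v) ⊗ (1 ⊗ w)`. -/
noncomputable def prodSection (V W : C) : (U'.obj (F.obj (tensorObj V W))).carrier →ₗ[k]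
    (U'.obj (F.obj V)).carrier ⊗[k] (U'.obj (F.obj W)).carrier :=
  f.desc (LinearMap.lcomp k _
      (LinearEquiv.ofBijective _ (S.τ_bijective V W)).symm.toLinearMap ∘ₗ
    (TensorProduct.mapBilinear (.id k) _ _ _ _).flip (f.ι W 𝓗.one) ∘ₗ f.ι V ∘ₗ
      𝓗.twist.symm.toLinearMap)

theorem prodSection_ι (V W : C) (g : H) (v : (U.obj V).carrier) (w : (U.obj W).carrier) :
    f.prodSection S V W (f.ι (tensorObj V W) g (S.τ V W v w)) =
      f.ι V (𝓗.twist.symm g) v ⊗ₜ[k] f.ι W 𝓗.one w := by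
  have : (LinearEquiv.ofBijective _ (S.τ_bijective V W)).symm (S.τ V W v w) = v ⊗ₜ w := by
    rw [LinearEquiv.symm_apply_eq]; simp
  simp [prodSection, this]

theorem prod_surjective (V W : C) :
    Function.Surjective (TensorProduct.lift (f.prod S V W)) := fun x => by
  rw [← LinearMap.mem_range]
  induction x using f.induction with
  | zero => exact zero_mem _
  | add x y hx hy => exact add_mem hx hy
  | ι g t =>
  obtain ⟨t, rfl⟩ := (S.τ_bijective V W).surjective t
  induction t using TensorProduct.induction_on with
  | zero => simp
  | add x y hx hy => rw [map_add, map_add]; exact add_mem hx hy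
  -- φ₂((α⁻¹(g) ⊗ v) ⊗ (1 ⊗ w)) = g ⊗ (v ⊗ w), as Δ(1) = 1 ⊗ 1 and ν⁻¹(v) ◁ 1 = v.
  | tmul v w => exact ⟨f.ι V (𝓗.twist.symm g) v ⊗ₜ f.ι W 𝓗.one w, by simp [prod_ι]⟩

/-- On generators the difference is a single balancing relation: the section sends φ₂((g ⊗ v) ⊗ (h ⊗
w)) to (α⁻¹(g) ⊗ ν⁻¹(v))h ⊗ (1 ⊗ w), whose balanced partner is (g ⊗ v) ⊗ h(1 ⊗ ω⁻¹(w)) = (g ⊗ v) ⊗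
(h ⊗ w). -/
theorem prodSection_prod_sub_mem (V W : C) (a b) :
    f.prodSection S V W (f.prod S V W a b) - a ⊗ₜ[k] b ∈
      balancingRelations (U'.obj (F.obj V)) (U'.obj (F.obj W)) := by
  induction a using f.induction with
  | zero => simp
  | add x y hx hy =>
    convert add_mem hx hy using 1
    simp only [map_add, LinearMap.add_apply, TensorProduct.add_tmul]; abel
  | ι g v =>
  induction b using f.induction with
  | zero => simp
  | add x y hx hy =>
    convert add_mem hx hy using 1
    simp only [map_add, TensorProduct.tmul_add]; abel
  | ι h w =>
  refine Submodule.subset_span ⟨f.ι V (𝓗.twist.symm g) ((U.obj V).twist.symm v), h,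
    f.ι W 𝓗.one w, ?_⟩
  simp [prod_ι, prodSection_ι]

end FreeFunctor

/-! ### Balancing relations and kernels of balanced maps -/

theorem map_mem_balancingRelations {M M' N N' : LeftCovariantHomBimodule 𝓗} (p : M ⟶ M')
    (q : N ⟶ N') {t : M.carrier ⊗[k] N.carrier} (ht : t ∈ balancingRelations M N) :
    TensorProduct.map (LeftCovariantHomBimodule.Hom.lin p) (LeftCovariantHomBimodule.Hom.lin q) t ∈
      balancingRelations M' N' := by
  induction ht using Submodule.span_induction with
  | zero => simp
  | add x y _ _ hx hy => rw [map_add]; exact add_mem hx hy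
  | smul r x _ hx => rw [map_smul]; exact Submodule.smul_mem _ r hx
  | mem x hx =>
    obtain ⟨m, h, n, rfl⟩ := hx
    exact Submodule.subset_span ⟨LeftCovariantHomBimodule.Hom.lin p m, h,
      LeftCovariantHomBimodule.Hom.lin q n, by simp⟩

/-- A balanced bilinear map with a section modulo the balancing relations has the balancing
relations as its kernel. -/
theorem ker_lift_eq_balancingRelations {M N : LeftCovariantHomBimodule 𝓗} {X : Type*}
    [AddCommGroup X] [Module k X] (β : M.carrier →ₗ[k] N.carrier →ₗ[k] X)
    (hβ : ∀ m h n, β (M.ract m h) n = β (M.twist m) (N.lact h (N.twist.symm n)))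
    (s : X →ₗ[k] M.carrier ⊗[k] N.carrier)
    (hs : ∀ m n, s (β m n) - m ⊗ₜ[k] n ∈ balancingRelations M N) :
    LinearMap.ker (TensorProduct.lift β) = balancingRelations M N := by
  refine le_antisymm (fun t ht => ?_) (Submodule.span_le.2 ?_)
  -- Modulo the relations s ∘ β is the identity, so a tensor killed by β is itself a relation.
  · have : s (TensorProduct.lift β t) - t ∈ balancingRelations M N := by
      clear ht
      induction t using TensorProduct.induction_on with
      | zero => simp
      | tmul m n => exact hs m n
      | add x y hx hy =>
        convert add_mem hx hy using 1
        simp only [map_add]; abel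
    rw [LinearMap.mem_ker.1 ht, map_zero, zero_sub] at this
    simpa using neg_mem this
  · rintro _ ⟨m, h, n, rfl⟩
    simp [hβ]

end

/-! ## Transport of the tensor structure along an equivalence -/

section

variable {k H : Type u} [CommRing k] [AddCommGroup H] [Module k H]
  {𝓗 : MonoidalHomHopfAlgebra k H}

attribute [local simp] TensorProduct.sum_tmul TensorProduct.tmul_sum LinearMap.sum_apply

variable {C D : Type*} [Category* C] [Category* D] {U : C ⥤ RightHomModule 𝓗}
  {U' : D ⥤ LeftCovariantHomBimodule 𝓗}

theorem lin_map_comp {L M N : D} (p : L ⟶ M) (q : M ⟶ N) (x : (U'.obj L).carrier) :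
    LeftCovariantHomBimodule.Hom.lin (U'.map (p ≫ q)) x =
      LeftCovariantHomBimodule.Hom.lin (U'.map q)
        (LeftCovariantHomBimodule.Hom.lin (U'.map p) x) := by
  rw [U'.map_comp]; rfl

theorem lin_map_id {M : D} (x : (U'.obj M).carrier) :
    LeftCovariantHomBimodule.Hom.lin (U'.map (𝟙 M)) x = x := by
  rw [U'.map_id]; rfl

variable (e : C ≌ D)

variable (U') in
/-- The inverse of the counit on elements. -/
def counitInvLin (M : D) : (U'.obj M).carrier →ₗ[k]
    (U'.obj (e.functor.obj (e.inverse.obj M))).carrier :=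
  LeftCovariantHomBimodule.Hom.lin (U'.map (e.counitInv.app M))

variable (U') in
/-- The counit on elements. -/
def counitLin (M : D) : (U'.obj (e.functor.obj (e.inverse.obj M))).carrier →ₗ[k]
    (U'.obj M).carrier :=
  LeftCovariantHomBimodule.Hom.lin (U'.map (e.counit.app M))

@[simp]
theorem counitLin_counitInvLin (M : D) (m : (U'.obj M).carrier) :
    counitLin U' e M (counitInvLin U' e M m) = m := by
  rw [counitLin, counitInvLin, ← lin_map_comp]
  simp

@[simp]
theorem counitInvLin_counitLin (M : D) (m) :
    counitInvLin U' e M (counitLin U' e M m) = m := by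
  rw [counitLin, counitInvLin, ← lin_map_comp]
  simp

theorem lin_map_counitInvLin {M N : D} (p : M ⟶ N) (m : (U'.obj M).carrier) :
    LeftCovariantHomBimodule.Hom.lin (U'.map (e.functor.map (e.inverse.map p)))
      (counitInvLin U' e M m) =
        counitInvLin U' e N (LeftCovariantHomBimodule.Hom.lin (U'.map p) m) := by
  rw [counitInvLin, counitInvLin, ← lin_map_comp, ← lin_map_comp]
  simp

/-- A triangle identity of the equivalence. It lets F of the inverse unit cancel the inverse counit
in the transported constraints. -/
theorem counitInvLin_functor (V : C) (x : (U'.obj (e.functor.obj V)).carrier) :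
    counitInvLin U' e (e.functor.obj V) x =
      LeftCovariantHomBimodule.Hom.lin (U'.map (e.functor.map (e.unit.app V))) x := by
  rw [counitInvLin, Equivalence.counitInv_app_functor]

theorem lin_map_unitInv_counitInvLin (V : C) (x : (U'.obj (e.functor.obj V)).carrier) :
    LeftCovariantHomBimodule.Hom.lin (U'.map (e.functor.map (e.unitInv.app V)))
      (counitInvLin U' e (e.functor.obj V) x) = x := by
  have h : e.functor.map (e.unit.app V) ≫ e.functor.map (e.unitInv.app V) =
      𝟙 (e.functor.obj V) := by simp
  rw [counitInvLin_functor, ← lin_map_comp, h]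
  exact lin_map_id _

theorem counitInvLin_bijective (M : D) : Function.Bijective (counitInvLin U' e M) :=
  Function.bijective_iff_has_inverse.2 ⟨counitLin U' e M, counitLin_counitInvLin e M,
    counitInvLin_counitLin e M⟩

section

variable (M : D)

@[simp]
theorem counitInvLin_twist (m : (U'.obj M).carrier) :
    counitInvLin U' e M ((U'.obj M).twist m) = (U'.obj _).twist (counitInvLin U' e M m) :=
  LeftCovariantHomBimodule.lin_twist _ _

@[simp]
theorem counitInvLin_twist_symm (m : (U'.obj M).carrier) :
    counitInvLin U' e M ((U'.obj M).twist.symm m) =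
      (U'.obj _).twist.symm (counitInvLin U' e M m) :=
  LeftCovariantHomBimodule.lin_twist_symm _ _

@[simp]
theorem counitInvLin_lact (h : H) (m : (U'.obj M).carrier) :
    counitInvLin U' e M ((U'.obj M).lact h m) = (U'.obj _).lact h (counitInvLin U' e M m) :=
  LeftCovariantHomBimodule.lin_lact _ _ _

@[simp]
theorem counitInvLin_ract (m : (U'.obj M).carrier) (h : H) :
    counitInvLin U' e M ((U'.obj M).ract m h) = (U'.obj _).ract (counitInvLin U' e M m) h :=
  LeftCovariantHomBimodule.lin_ract _ _ _

theorem lcoact_counitInvLin (m : (U'.obj M).carrier) :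
    (U'.obj _).lcoact (counitInvLin U' e M m) =
      (counitInvLin U' e M).lTensor H ((U'.obj M).lcoact m) :=
  LeftCovariantHomBimodule.lcoact_lin _ _

end

variable [MonoidalCategory C] (S : DiagonalTensor U) (f : FreeFunctor U U' e.functor)

/-- The identification of `H` with `H ⊗ k`, `h ↦ α⁻¹(h) ⊗ 1`. -/
noncomputable def FreeFunctor.unitEquiv {F : C ⥤ D} (f : FreeFunctor U U' F) :
    H ≃ₗ[k] (U'.obj (F.obj (𝟙_ C))).carrier :=
  𝓗.twist.symm ≪≫ₗ (TensorProduct.rid k H).symm ≪≫ₗ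
    TensorProduct.congr (.refl k H) S.unit ≪≫ₗ LinearEquiv.ofBijective _ (f.ι_bijective (𝟙_ C))

@[simp]
theorem FreeFunctor.unitEquiv_apply {F : C ⥤ D} (f : FreeFunctor U U' F) (h : H) :
    f.unitEquiv S h = f.ι (𝟙_ C) (𝓗.twist.symm h) (S.unit 1) := by
  simp [unitEquiv]

/-- The tensor product in the category transported along `e`. -/
noncomputable def FreeFunctor.transportMk (M N : D) : (U'.obj M).carrier →ₗ[k]
    (U'.obj N).carrier →ₗ[k] (U'.obj (e.functor.obj (e.inverse.obj M ⊗ e.inverse.obj N))).carrier :=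
  (f.prod S (e.inverse.obj M) (e.inverse.obj N)).compl₁₂
      (counitInvLin U' e M) (counitInvLin U' e N)

theorem FreeFunctor.transportMk_apply (M N : D) (m n) : f.transportMk e S M N m n =
    f.prod S (e.inverse.obj M) (e.inverse.obj N) (counitInvLin U' e M m)
      (counitInvLin U' e N n) := rfl

theorem FreeFunctor.transportMk_surjective (M N : D) :
    Function.Surjective (TensorProduct.lift (f.transportMk e S M N)) := by
  have : TensorProduct.lift (f.transportMk e S M N) =
      TensorProduct.lift (f.prod S (e.inverse.obj M) (e.inverse.obj N)) ∘ₗ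
        TensorProduct.map (counitInvLin U' e M) (counitInvLin U' e N) :=
    TensorProduct.ext' fun m n => rfl
  rw [this, LinearMap.coe_comp]
  exact (f.prod_surjective S _ _).comp (TensorProduct.map_surjective
    (counitInvLin_bijective e M).2 (counitInvLin_bijective e N).2)

/-- The counits are morphisms of bimodules, so they carry balancing relations between FGM and FGN to
those between M and N. The section is that of φ₂ followed by the counits. -/
theorem FreeFunctor.ker_transportMk (M N : D) :
    LinearMap.ker (TensorProduct.lift (f.transportMk e S M N)) =
      balancingRelations (U'.obj M) (U'.obj N) := by
  refine ker_lift_eq_balancingRelations _ (fun m h n => ?_)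
    (TensorProduct.map (counitLin U' e M) (counitLin U' e N) ∘ₗ
      f.prodSection S (e.inverse.obj M) (e.inverse.obj N)) (fun m n => ?_)
  · simp [transportMk_apply, prod_ract]
  · have := map_mem_balancingRelations (U'.map (e.counit.app M)) (U'.map (e.counit.app N))
      (f.prodSection_prod_sub_mem S (e.inverse.obj M) (e.inverse.obj N)
        (counitInvLin U' e M m) (counitInvLin U' e N n))
    rw [map_sub, TensorProduct.map_tmul] at this
    change TensorProduct.map (counitLin U' e M) (counitLin U' e N) _ -
      counitLin U' e M _ ⊗ₜ counitLin U' e N _ ∈ _ at this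
    simpa [transportMk_apply] using this

theorem FreeFunctor.twist_transportMk (M N : D) (m n) :
    (U'.obj _).twist (f.transportMk e S M N m n) =
      f.transportMk e S M N ((U'.obj M).twist m) ((U'.obj N).twist n) := by
  simp [transportMk_apply, twist_prod]

theorem FreeFunctor.lact_transportMk (M N : D) (h : H) (m n) :
    (U'.obj _).lact h (f.transportMk e S M N m n) =
      f.transportMk e S M N ((U'.obj M).lact (𝓗.twist.symm h) m) ((U'.obj N).twist n) := by
  simp [transportMk_apply, lact_prod]

theorem FreeFunctor.ract_transportMk (M N : D) (m n) (h : H) :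
    (U'.obj _).ract (f.transportMk e S M N m n) h =
      f.transportMk e S M N ((U'.obj M).twist m) ((U'.obj N).ract n (𝓗.twist.symm h)) := by
  simp [transportMk_apply, ract_prod]

theorem FreeFunctor.lcoact_transportMk (M N : D) (m n) :
    (U'.obj _).lcoact (f.transportMk e S M N m n) =
      TensorProduct.map₂ 𝓗.mul (f.transportMk e S M N) ((U'.obj M).lcoact m)
        ((U'.obj N).lcoact n) := by
  rw [transportMk_apply, lcoact_prod, lcoact_counitInvLin, lcoact_counitInvLin]
  simp [transportMk_apply]

theorem FreeFunctor.twist_unitEquiv {F : C ⥤ D} (f : FreeFunctor U U' F) (h : H) :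
    (U'.obj (F.obj (𝟙_ C))).twist (f.unitEquiv S h) = f.unitEquiv S (𝓗.twist h) := by
  simp

theorem FreeFunctor.lact_unitEquiv {F : C ⥤ D} (f : FreeFunctor U U' F) (g h : H) :
    (U'.obj (F.obj (𝟙_ C))).lact g (f.unitEquiv S h) = f.unitEquiv S (𝓗.mul g h) := by
  simp

/-- As k carries the trivial action, (α⁻¹(h) ⊗ 1)g = α⁻¹(h)g₁ ⊗ ε(g₂), and the counit turns g₁ε(g₂)
into α⁻¹(g). -/
theorem FreeFunctor.ract_unitEquiv {F : C ⥤ D} (f : FreeFunctor U U' F) (g h : H) :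
    (U'.obj (F.obj (𝟙_ C))).ract (f.unitEquiv S h) g = f.unitEquiv S (𝓗.mul h g) := by
  have := 𝓗.sum_counit_snd g
    (fun a => f.ι (𝟙_ C) (𝓗.mul (𝓗.twist.symm h) a) (S.unit 1)) {}
  rw [unitEquiv_apply S f (𝓗.mul h g), 𝓗.twist_symm_mul, ← this]
  simp only [unitEquiv_apply, ract_ι, 𝓗.comul_eq_sum, map_sum, TensorProduct.map_tmul,
    TensorProduct.lift.tmul, S.act_unit, _root_.mul_one]
  refine Finset.sum_congr rfl fun i _ => ?_
  rw [← map_smul, ← map_smul, smul_eq_mul, _root_.mul_one]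

theorem FreeFunctor.lcoact_unitEquiv {F : C ⥤ D} (f : FreeFunctor U U' F) (h : H) :
    (U'.obj (F.obj (𝟙_ C))).lcoact (f.unitEquiv S h) =
      (f.unitEquiv S).toLinearMap.lTensor H (𝓗.comul h) := by
  simp

/-- Iterated transported products contain `e.inverse.obj (e.functor.obj V)`. Naturality of φ₂ and
the triangle identity strip this layer; the two variants that follow act on the other factor and in
the opposite direction. -/
theorem FreeFunctor.map_unitInv_prod (V Z : C) (a c) :
    LeftCovariantHomBimodule.Hom.lin (U'.map (e.functor.map (e.unitInv.app V ▷ Z)))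
      (f.prod S (e.inverse.obj (e.functor.obj V)) Z (counitInvLin U' e (e.functor.obj V) a) c) =
        f.prod S V Z a c := by
  have := f.map_prod S (V := e.inverse.obj (e.functor.obj V)) (V' := V) (e.unitInv.app V) (𝟙 Z)
    (counitInvLin U' e (e.functor.obj V) a) c
  rw [tensorHom_id] at this
  rw [this, lin_map_unitInv_counitInvLin, e.functor.map_id, lin_map_id]

theorem FreeFunctor.map_prod_unitInv (V Z : C) (a c) :
    LeftCovariantHomBimodule.Hom.lin (U'.map (e.functor.map (Z ◁ e.unitInv.app V)))
      (f.prod S Z (e.inverse.obj (e.functor.obj V)) c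
        (counitInvLin U' e (e.functor.obj V) a)) = f.prod S Z V c a := by
  have := f.map_prod S (W := e.inverse.obj (e.functor.obj V)) (W' := V) (𝟙 Z) (e.unitInv.app V)
    c (counitInvLin U' e (e.functor.obj V) a)
  rw [id_tensorHom] at this
  rw [this, lin_map_unitInv_counitInvLin, e.functor.map_id, lin_map_id]

theorem FreeFunctor.map_prod_unit (V Z : C) (a c) :
    LeftCovariantHomBimodule.Hom.lin (U'.map (e.functor.map (Z ◁ e.unit.app V)))
      (f.prod S Z V c a) = f.prod S Z (e.inverse.obj (e.functor.obj V)) c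
        (counitInvLin U' e (e.functor.obj V) a) := by
  have := f.map_prod S (W := V) (W' := e.inverse.obj (e.functor.obj V)) (𝟙 Z) (e.unit.app V) c a
  rw [id_tensorHom] at this
  rw [this, counitInvLin_functor, e.functor.map_id, lin_map_id]

/-- By definition the transported associator is F of the inverse unit whiskered by GP, then the
associator of C, then the unit whiskered by GM. The outer maps only strip or insert GF, leaving
`associator_prod`. -/
theorem FreeFunctor.associator_transportMk (M N P : D) (m n p) :
    letI := Monoidal.transport e
    LeftCovariantHomBimodule.Hom.lin (U'.map (associator M N P).hom)
      (f.transportMk e S (tensorObj M N) P (f.transportMk e S M N m n) p) =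
        f.transportMk e S M (tensorObj N P) ((U'.obj M).twist m)
          (f.transportMk e S N P n ((U'.obj P).twist.symm p)) := by
  have h₁ := f.map_unitInv_prod e S (e.inverse.obj M ⊗ e.inverse.obj N) (e.inverse.obj P)
    (f.transportMk e S M N m n) (counitInvLin U' e P p)
  have h₂ := f.map_prod_unit e S (e.inverse.obj N ⊗ e.inverse.obj P) (e.inverse.obj M)
    (f.transportMk e S N P n ((U'.obj P).twist.symm p))
    (counitInvLin U' e M ((U'.obj M).twist m))
  refine Eq.trans ?_ h₂
  change LeftCovariantHomBimodule.Hom.lin (U'.map (e.functor.map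
      ((e.unitInv.app (e.inverse.obj M ⊗ e.inverse.obj N) ▷ e.inverse.obj P) ≫
        (α_ (e.inverse.obj M) (e.inverse.obj N) (e.inverse.obj P)).hom ≫
          (e.inverse.obj M ◁ e.unit.app (e.inverse.obj N ⊗ e.inverse.obj P))))) _ = _
  rw [e.functor.map_comp, e.functor.map_comp, lin_map_comp, lin_map_comp]
  refine congrArg _ ((congrArg _ h₁).trans ((f.associator_prod S _ _ _ _ _ _).trans ?_))
  simp [transportMk_apply]

theorem FreeFunctor.leftUnitor_transportMk (M : D) (h : H) (m) :
    letI := Monoidal.transport e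
    LeftCovariantHomBimodule.Hom.lin (U'.map (leftUnitor M).hom)
      (f.transportMk e S (𝟙_ D) M (f.unitEquiv S h) m) = (U'.obj M).lact h m := by
  change LeftCovariantHomBimodule.Hom.lin (U'.map (e.functor.map
      ((e.unitInv.app (𝟙_ C) ▷ e.inverse.obj M) ≫ (λ_ (e.inverse.obj M)).hom) ≫ e.counit.app M))
      (f.prod S _ (e.inverse.obj M) (counitInvLin U' e (e.functor.obj (𝟙_ C)) (f.unitEquiv S h))
        (counitInvLin U' e M m)) = _
  rw [e.functor.map_comp, lin_map_comp, lin_map_comp]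
  have h₁ := f.map_unitInv_prod e S (𝟙_ C) (e.inverse.obj M) (f.unitEquiv S h)
    (counitInvLin U' e M m)
  refine (congrArg _ ((congrArg _ h₁).trans ?_)).trans (counitLin_counitInvLin e M _)
  rw [unitEquiv_apply, leftUnitor_prod, counitInvLin_lact]

theorem FreeFunctor.rightUnitor_transportMk (M : D) (h : H) (m) :
    letI := Monoidal.transport e
    LeftCovariantHomBimodule.Hom.lin (U'.map (rightUnitor M).hom)
      (f.transportMk e S M (𝟙_ D) m (f.unitEquiv S h)) = (U'.obj M).ract m h := by
  change LeftCovariantHomBimodule.Hom.lin (U'.map (e.functor.map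
      ((e.inverse.obj M ◁ e.unitInv.app (𝟙_ C)) ≫ (ρ_ (e.inverse.obj M)).hom) ≫ e.counit.app M))
      (f.prod S (e.inverse.obj M) _ (counitInvLin U' e M m)
        (counitInvLin U' e (e.functor.obj (𝟙_ C)) (f.unitEquiv S h))) = _
  rw [e.functor.map_comp, lin_map_comp, lin_map_comp]
  have h₁ := f.map_prod_unitInv e S (𝟙_ C) (e.inverse.obj M) (f.unitEquiv S h)
    (counitInvLin U' e M m)
  refine (congrArg _ ((congrArg _ h₁).trans ?_)).trans (counitLin_counitInvLin e M _)
  rw [unitEquiv_apply, rightUnitor_prod, counitInvLin_ract]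

/-- The tensor structure transported along `e`. -/
noncomputable def FreeFunctor.transport :
    letI := Monoidal.transport e
    BalancedTensor U' :=
  letI := Monoidal.transport e
  { τ := f.transportMk e S
    τ_surjective := f.transportMk_surjective e S
    τ_ker := f.ker_transportMk e S
    twist_τ := f.twist_transportMk e S
    lact_τ := f.lact_transportMk e S
    ract_τ := f.ract_transportMk e S
    lcoact_τ := f.lcoact_transportMk e S
    unit := f.unitEquiv S
    twist_unit := f.twist_unitEquiv S
    lact_unit := f.lact_unitEquiv S
    ract_unit := fun h g => f.ract_unitEquiv S g h
    lcoact_unit := f.lcoact_unitEquiv S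
    map_τ := fun {M M' N N'} p q m n => by
      refine (f.map_prod S (e.inverse.map p) (e.inverse.map q) _ _).trans ?_
      rw [lin_map_counitInvLin, lin_map_counitInvLin]
      rfl
    associator_τ := f.associator_transportMk e S
    leftUnitor_τ := f.leftUnitor_transportMk e S
    rightUnitor_τ := fun M m h => f.rightUnitor_transportMk e S M h m }

/-- The hexagon for μ = F(η⁻¹ ⊗ η⁻¹) with F removed, η being the unit of the equivalence. There `a`,
`b`, `c` and `p₁`, `p₂`, `q₁`, `q₂` are components of η⁻¹, `r` is a component of η, `hp` and `hq`
are naturality of η⁻¹, and `hr` is invertibility. -/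
theorem whiskerRight_tensorHom_associator {X Y Z X' Y' Z' P P' Q Q' : C} {a : X' ⟶ X}
    {b : Y' ⟶ Y} {c : Z' ⟶ Z} {p : P' ⟶ P} {p₁ : P ⟶ X ⊗ Y} {p₂ : P' ⟶ X' ⊗ Y'} {q : Q' ⟶ Q}
    {q₁ : Q ⟶ Y ⊗ Z} {q₂ : Q' ⟶ Y' ⊗ Z'} {r : Y' ⊗ Z' ⟶ Q'} (hp : p ≫ p₁ = p₂ ≫ (a ⊗ₘ b))
    (hq : q ≫ q₁ = q₂ ≫ (b ⊗ₘ c)) (hr : r ≫ q₂ = 𝟙 _) :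
    (p ▷ Z') ≫ (p₁ ⊗ₘ c) ≫ (α_ X Y Z).hom =
      ((p₂ ▷ Z') ≫ (α_ X' Y' Z').hom ≫ (X' ◁ r)) ≫ (X' ◁ q) ≫ (a ⊗ₘ q₁) := by
  have hq' : r ≫ q ≫ q₁ = b ⊗ₘ c := by rw [hq, ← Category.assoc, hr, Category.id_comp]
  rw [← tensorHom_id, ← tensorHom_id, ← id_tensorHom, ← id_tensorHom,
    tensorHom_comp_tensorHom_assoc, hp]
  simp only [Category.assoc, tensorHom_comp_tensorHom, Category.id_comp, hq']
  rw [← associator_naturality, tensorHom_comp_tensorHom_assoc, Category.id_comp]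

/-- The variable `i` stands for the inverse functor applied to an identity; its equality with the
identity is kept as a hypothesis so that the composite has the shape required by left unitality. -/
theorem whiskerRight_leftUnitor_comp {I X X' : C} {i : I ⟶ I} (hi : i = 𝟙 I) (a : I ⟶ 𝟙_ C)
    (u : X' ⟶ X) :
    (a ▷ X' ≫ (λ_ X').hom) ≫ u = (i ▷ X') ≫ (a ⊗ₘ u) ≫ (λ_ X).hom := by
  simp [hi, MonoidalCategory.tensorHom_def]

theorem whiskerLeft_rightUnitor_comp {I X X' : C} {i : I ⟶ I} (hi : i = 𝟙 I) (a : I ⟶ 𝟙_ C)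
    (u : X' ⟶ X) :
    (X' ◁ a ≫ (ρ_ X').hom) ≫ u = (X' ◁ i) ≫ (u ⊗ₘ a) ≫ (ρ_ X).hom := by
  simp [hi, MonoidalCategory.tensorHom_def']

/-- The functor of an equivalence is monoidal for the transported tensor structure. -/
noncomputable def CategoryTheory.Equivalence.transportCoreMonoidal :
    letI := Monoidal.transport e
    e.functor.CoreMonoidal :=
  letI := Monoidal.transport e
  -- The transported unit is F(𝟙) itself, so ε is the identity. The product FX ⊗ FY is F(GFX ⊗ GFY),
  -- so μ is F of the inverse units, as given in the next field.
  { εIso := Iso.refl _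
    μIso := fun X Y => e.functor.mapIso ((e.unitIso.app X).symm ⊗ᵢ (e.unitIso.app Y).symm)
    μIso_hom_natural_left := fun {X Y} p Z => by
      change e.functor.map (e.inverse.map (e.functor.map p) ▷ _) ≫
        e.functor.map (e.unitInv.app Y ⊗ₘ e.unitInv.app Z) =
          e.functor.map (e.unitInv.app X ⊗ₘ e.unitInv.app Z) ≫ e.functor.map (p ▷ Z)
      rw [← e.functor.map_comp, ← e.functor.map_comp, ← tensorHom_id, ← tensorHom_id,
        tensorHom_comp_tensorHom, tensorHom_comp_tensorHom]
      refine congrArg e.functor.map (congrArg₂ _ (e.unitInv_naturality p) ?_)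
      exact (Category.id_comp _).trans (Category.comp_id _).symm
    μIso_hom_natural_right := fun {X Y} Z p => by
      change e.functor.map (_ ◁ e.inverse.map (e.functor.map p)) ≫
        e.functor.map (e.unitInv.app Z ⊗ₘ e.unitInv.app Y) =
          e.functor.map (e.unitInv.app Z ⊗ₘ e.unitInv.app X) ≫ e.functor.map (Z ◁ p)
      rw [← e.functor.map_comp, ← e.functor.map_comp, ← id_tensorHom, ← id_tensorHom,
        tensorHom_comp_tensorHom, tensorHom_comp_tensorHom]
      refine congrArg e.functor.map (congrArg₂ _ ?_ (e.unitInv_naturality p))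
      exact (Category.id_comp _).trans (Category.comp_id _).symm
    associativity := fun X Y Z => by
      have := congrArg e.functor.map (whiskerRight_tensorHom_associator
        (e.unitInv_naturality (e.unitInv.app X ⊗ₘ e.unitInv.app Y))
        (e.unitInv_naturality (e.unitInv.app Y ⊗ₘ e.unitInv.app Z))
        (e.unitIso.hom_inv_id_app _))
      rw [e.functor.map_comp, e.functor.map_comp, e.functor.map_comp _ (_ ≫ _),
        e.functor.map_comp (_ ◁ _)] at this
      exact this
    left_unitality := fun X => by
      have := congrArg e.functor.map (whiskerRight_leftUnitor_comp
        (e.inverse.map_id (e.functor.obj (𝟙_ C))) (e.unitInv.app (𝟙_ C)) (e.unitInv.app X))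
      rw [e.functor.map_comp, e.functor.map_comp _ (_ ≫ _), e.functor.map_comp (_ ⊗ₘ _),
        ← e.counit_app_functor] at this
      exact this
    right_unitality := fun X => by
      have := congrArg e.functor.map (whiskerLeft_rightUnitor_comp
        (e.inverse.map_id (e.functor.obj (𝟙_ C))) (e.unitInv.app (𝟙_ C)) (e.unitInv.app X))
      rw [e.functor.map_comp, e.functor.map_comp _ (_ ≫ _), e.functor.map_comp (_ ⊗ₘ _),
        ← e.counit_app_functor] at this
      exact this }

theorem FreeFunctor.isTensorEquivalence_transport (g : CoinvariantsFunctor U U' e.inverse)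
    (hc : ∀ M h m, LeftCovariantHomBimodule.Hom.lin (U'.map (e.counitIso.hom.app M))
      (f.ι (e.inverse.obj M) h m) = (U'.obj M).lact h (g.κ M m)) :
    letI := Monoidal.transport e
    IsTensorEquivalence S (f.transport e S) e f g := by
  let := Monoidal.transport e
  let : e.functor.Monoidal := e.transportCoreMonoidal.toMonoidal
  -- G gets the structure adjoint to that of F; its compatibility with the equivalence then holds by
  -- definition.
  let : e.inverse.Monoidal := e.inverseMonoidal
  refine ⟨hc, inferInstance, inferInstance, ⟨rfl, fun _ _ => rfl⟩, fun h => ?_, fun V W a v h w => ?_⟩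
  · refine (lin_map_id _).trans ?_
    exact f.unitEquiv_apply S h
  -- By naturality of φ₂ the inverse units act on each argument, where they cancel the inverse
  -- counits contained in `transportMk`.
  · refine (f.map_prod S (e.unitInv.app V) (e.unitInv.app W) _ _).trans ?_
    rw [lin_map_unitInv_counitInvLin, lin_map_unitInv_counitInvLin]
    exact f.prod_ι S V W a h v w

end

/-! ### Linearity of composites and of sums -/

section

variable {k A B X : Type*} [CommRing k] [AddCommGroup A] [Module k A] [AddCommGroup B]
  [Module k B] [AddCommGroup X] [Module k X]

theorem Lin₁.comp {T : B → X} (hT : Lin₁ k T) (L : A →ₗ[k] B) : Lin₁ k fun a => T (L a) :=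
  ⟨fun a a' => by rw [map_add, hT.add], fun r a => by rw [map_smul, hT.smul]⟩

theorem Lin₁.sum {n : ℕ} {T : Fin n → A → X} (hT : ∀ i, Lin₁ k (T i)) :
    Lin₁ k fun a => ∑ i, T i a :=
  ⟨fun a a' => by simp only [(hT _).add, Finset.sum_add_distrib],
    fun r a => by simp only [(hT _).smul, Finset.smul_sum]⟩

end

/-- `h₁₁ ⊗ h₁₂ ⊗ α⁻¹(h₂) = α⁻¹(h₁) ⊗ h₂₁ ⊗ h₂₂`. -/
theorem MonoidalHomHopfAlgebra.sum_comul_fst_twist_symm {k H : Type u} {X : Type*}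
    [CommRing k] [AddCommGroup H] [Module k H] [AddCommGroup X] [Module k X] (𝓗 : MonoidalHomHopfAlgebra k H)
    (h : H) (T : H → H → H → X) (hT : Lin₃ k T) :
    ∑ i, ∑ j, T (𝓗.fst (𝓗.fst h i) j) (𝓗.snd (𝓗.fst h i) j) (𝓗.twist.symm (𝓗.snd h i)) =
      ∑ i, ∑ j, T (𝓗.twist.symm (𝓗.fst h i)) (𝓗.fst (𝓗.snd h i) j) (𝓗.snd (𝓗.snd h i) j) := by
  have := 𝓗.sum_comul_fst h (fun a b c => T a b (𝓗.twist.symm c))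
    ⟨fun b c => hT.fst b _, fun a c => hT.snd a _, fun a b =>
      (hT.trd a b).comp 𝓗.twist.symm.toLinearMap⟩
  simpa only [LinearEquiv.symm_apply_apply] using this

/-! ## The tensor category of Yetter-Drinfel'd Hom-modules -/

namespace YetterDrinfeldHomModule

variable {k H : Type u} [CommRing k] [AddCommGroup H] [Module k H]
  {𝓗 : MonoidalHomHopfAlgebra k H}

attribute [local simp] TensorProduct.sum_tmul TensorProduct.tmul_sum LinearMap.sum_apply

section

variable (V : YetterDrinfeldHomModule 𝓗)

/-- The number of terms in `v₍₀₎ ⊗ v₍₁₎`. -/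
noncomputable def corank (v : V.carrier) : ℕ := tensorRank (V.coact v)

/-- The left factors `v₍₀₎` in `v₍₀₎ ⊗ v₍₁₎`. -/
noncomputable def cofst (v : V.carrier) : Fin (V.corank v) → V.carrier := tensorFst (V.coact v)

/-- The right factors `v₍₁₎` in `v₍₀₎ ⊗ v₍₁₎`. -/
noncomputable def cosnd (v : V.carrier) : Fin (V.corank v) → H := tensorSnd (V.coact v)

@[simp low]
theorem coact_eq_sum (v : V.carrier) : V.coact v = ∑ i, V.cofst v i ⊗ₜ[k] V.cosnd v i :=
  eq_sum_tensor _

@[simp]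
theorem coact_twist' (v : V.carrier) : V.coact (V.twist v) =
    TensorProduct.map V.twist.toLinearMap 𝓗.twist.toLinearMap (V.coact v) := V.coact_twist v

@[simp]
theorem coact_twist_symm (v : V.carrier) : V.coact (V.twist.symm v) =
    TensorProduct.map V.twist.symm.toLinearMap 𝓗.twist.symm.toLinearMap (V.coact v) := by
  obtain ⟨v, rfl⟩ := V.twist.surjective v
  simp

variable {X : Type*} [AddCommGroup X] [Module k X]

/-- `v₍₀₎₍₀₎ ⊗ v₍₀₎₍₁₎ ⊗ v₍₁₎ = ν⁻¹(v₍₀₎) ⊗ v₍₁₎₁ ⊗ α(v₍₁₎₂)`. -/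
theorem sum_coact_fst (v : V.carrier) (T : V.carrier → H → H → X) (hT : Lin₃ k T) :
    ∑ i, ∑ j, T (V.cofst (V.cofst v i) j) (V.cosnd (V.cofst v i) j) (V.cosnd v i) =
      ∑ i, ∑ j, T (V.twist.symm (V.cofst v i)) (𝓗.fst (V.cosnd v i) j)
        (𝓗.twist (𝓗.snd (V.cosnd v i) j)) := by
  obtain ⟨L, hL⟩ := hT.exists_lift
  have := congrArg (L ∘ₗ ((𝓗.twist.toLinearMap.lTensor H).lTensor V.carrier)) (V.coact_coassoc v)
  simpa [hL] using this.symm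

theorem sum_counit_cosnd (v : V.carrier) (T : V.carrier → X) (hT : Lin₁ k T) :
    ∑ i, 𝓗.counit (V.cosnd v i) • T (V.cofst v i) = T (V.twist.symm v) := by
  rw [← V.coact_counit]
  simp [hT.map_sum, hT.smul]

theorem lin_sum_coact {T : V.carrier → H → X} (hT : Lin₂ k T) :
    Lin₁ k fun v => ∑ i, T (V.cofst v i) (V.cosnd v i) := by
  have : (fun v => ∑ i, T (V.cofst v i) (V.cosnd v i)) =
      TensorProduct.lift hT.toLinearMap ∘ₗ V.coact := by
    ext v; simp
  rw [this]
  exact ⟨map_add _, map_smul _⟩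

/-- `v₍₀₎ ◁ α⁻¹(h₁) ⊗ v₍₁₎α⁻¹(h₂) = (v ◁ h₂)₍₀₎ ⊗ α⁻¹(h₁)α⁻¹((v ◁ h₂)₍₁₎)`. -/
theorem sum_coact_act (v : V.carrier) (h : H) (T : V.carrier → H → X) (hT : Lin₂ k T) :
    ∑ i, ∑ j, T (V.cofst (V.act v (𝓗.snd h i)) j) (𝓗.mul (𝓗.twist.symm (𝓗.fst h i))
      (𝓗.twist.symm (V.cosnd (V.act v (𝓗.snd h i)) j))) =
        ∑ i, ∑ j, T (V.act (V.cofst v j) (𝓗.twist.symm (𝓗.fst h i)))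
          (𝓗.mul (V.cosnd v j) (𝓗.twist.symm (𝓗.snd h i))) := by
  obtain ⟨L, hL⟩ := hT.exists_lift
  have := congrArg L (V.yetter_drinfeld v h)
  simp [hL] at this
  rw [← this]

end

/-- A morphism of right Hom-modules that is colinear. -/
def homMk {V W : YetterDrinfeldHomModule 𝓗} (f : V.toRightHomModule ⟶ W.toRightHomModule)
    (hf : ∀ v, W.coact (RightHomModule.Hom.lin f v) =
      (RightHomModule.Hom.lin f).rTensor H (V.coact v)) : V ⟶ W :=
  ⟨f, hf⟩

/-- Faithfulness of the forgetful functor: equations between morphisms need only be checked for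
right Hom-modules. -/
theorem forget_map_injective {V W : YetterDrinfeldHomModule 𝓗} {f g : V ⟶ W}
    (h : (forget 𝓗).map f = (forget 𝓗).map g) : f = g :=
  Hom.ext (congrArg RightHomModule.Hom.lin h)

/-- An isomorphism of right Hom-modules that is colinear. -/
def isoMk {V W : YetterDrinfeldHomModule 𝓗} (f : V.toRightHomModule ≅ W.toRightHomModule)
    (hf : ∀ v, W.coact (RightHomModule.Hom.lin f.hom v) =
      (RightHomModule.Hom.lin f.hom).rTensor H (V.coact v)) : V ≅ W where
  hom := homMk f.hom hf
  inv := homMk f.inv fun w => by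
    have h₁ : RightHomModule.Hom.lin f.inv ∘ₗ RightHomModule.Hom.lin f.hom = LinearMap.id :=
      congrArg RightHomModule.Hom.lin f.hom_inv_id
    have h₂ : RightHomModule.Hom.lin f.hom (RightHomModule.Hom.lin f.inv w) = w :=
      LinearMap.congr_fun (congrArg RightHomModule.Hom.lin f.inv_hom_id) w
    conv_rhs => rw [← h₂, hf, ← LinearMap.rTensor_comp_apply, h₁, LinearMap.rTensor_id_apply]
  hom_inv_id := forget_map_injective f.hom_inv_id
  inv_hom_id := forget_map_injective f.inv_hom_id

/-- The underlying morphism of right Hom-modules. -/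
def underlying {V W : YetterDrinfeldHomModule 𝓗} (f : V ⟶ W) :
    V.toRightHomModule ⟶ W.toRightHomModule := f.toHom

@[simp]
theorem coact_lin {V W : YetterDrinfeldHomModule 𝓗} (f : V ⟶ W) (v : V.carrier) :
    W.coact (RightHomModule.Hom.lin (underlying f) v) =
      (RightHomModule.Hom.lin (underlying f)).rTensor H (V.coact v) := f.map_coact v

open RightHomModule (tmul tensor_induction)

section

variable (V W : YetterDrinfeldHomModule 𝓗)

/-- The diagonal coaction. -/
noncomputable def tensorCoact :
    (RightHomModule.tensor V.toRightHomModule W.toRightHomModule).carrier →ₗ[k]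
      (RightHomModule.tensor V.toRightHomModule W.toRightHomModule).carrier ⊗[k] H :=
  RightHomModule.desc ((TensorProduct.map₂ (tmul V.toRightHomModule W.toRightHomModule)
    𝓗.mul).compl₁₂ V.coact W.coact)

theorem tensorCoact_tmul_eq (v : V.carrier) (w : W.carrier) :
    tensorCoact V W (tmul V.toRightHomModule W.toRightHomModule v w) =
      TensorProduct.map₂ (tmul V.toRightHomModule W.toRightHomModule) 𝓗.mul (V.coact v)
        (W.coact w) := rfl

@[simp]
theorem tensorCoact_tmul (v : V.carrier) (w : W.carrier) :
    tensorCoact V W (tmul V.toRightHomModule W.toRightHomModule v w) =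
      ∑ i, ∑ j, tmul V.toRightHomModule W.toRightHomModule (V.cofst v i) (W.cofst w j) ⊗ₜ[k]
        𝓗.mul (V.cosnd v i) (W.cosnd w j) := by
  rw [tensorCoact_tmul_eq, Finset.sum_comm]; simp

/-- Coassociativity of W is applied inside that of V; the remainder reorders sums. -/
theorem sum_coact_coassoc (v : V.carrier) (w : W.carrier) :
    ∑ i, ∑ j, ∑ l, ∑ a, tmul V.toRightHomModule W.toRightHomModule
        (V.twist.symm (V.cofst v i)) (W.twist.symm (W.cofst w j)) ⊗ₜ[k]
          (𝓗.mul (𝓗.fst (V.cosnd v i) a) (𝓗.fst (W.cosnd w j) l) ⊗ₜ[k]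
            𝓗.mul (𝓗.snd (V.cosnd v i) a) (𝓗.snd (W.cosnd w j) l)) =
      ∑ i, ∑ j, ∑ a, ∑ l, tmul V.toRightHomModule W.toRightHomModule
        (V.cofst (V.cofst v i) a) (W.cofst (W.cofst w j) l) ⊗ₜ[k]
          (𝓗.mul (V.cosnd (V.cofst v i) a) (W.cosnd (W.cofst w j) l) ⊗ₜ[k]
            𝓗.mul (𝓗.twist.symm (V.cosnd v i)) (𝓗.twist.symm (W.cosnd w j))) := by
  have h₁ := V.sum_coact_fst v (fun a b c => ∑ i, ∑ j,
    tmul V.toRightHomModule W.toRightHomModule a (W.cofst (W.cofst w i) j) ⊗ₜ[k]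
      (𝓗.mul b (W.cosnd (W.cofst w i) j) ⊗ₜ[k]
        𝓗.mul (𝓗.twist.symm c) (𝓗.twist.symm (W.cosnd w i)))) {}
  have h₂ := fun i j => W.sum_coact_fst w (fun a b c =>
    tmul V.toRightHomModule W.toRightHomModule (V.twist.symm (V.cofst v i)) a ⊗ₜ[k]
      (𝓗.mul (𝓗.fst (V.cosnd v i) j) b ⊗ₜ[k]
        𝓗.mul (𝓗.snd (V.cosnd v i) j) (𝓗.twist.symm c))) {}
  simp only [LinearEquiv.symm_apply_apply, h₂] at h₁
  refine Eq.trans ?_ (h₁.symm.trans (Finset.sum_congr rfl fun x _ => Finset.sum_comm))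
  exact Finset.sum_congr rfl fun x _ =>
    (Finset.sum_congr rfl fun _ _ => Finset.sum_comm).trans Finset.sum_comm

theorem tensorCoact_coassoc_tmul (v : V.carrier) (w : W.carrier) :
    TensorProduct.map
        (RightHomModule.tensor V.toRightHomModule W.toRightHomModule).twist.symm.toLinearMap
        𝓗.comul (tensorCoact V W (tmul V.toRightHomModule W.toRightHomModule v w)) =
      TensorProduct.assoc k _ H H (TensorProduct.map (tensorCoact V W)
        𝓗.twist.symm.toLinearMap
          (tensorCoact V W (tmul V.toRightHomModule W.toRightHomModule v w))) := by
  have := sum_coact_coassoc V W v w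
  simpa using this

theorem tensorCoact_counit_tmul (v : V.carrier) (w : W.carrier) :
    TensorProduct.rid k _ (𝓗.counit.lTensor _
      (tensorCoact V W (tmul V.toRightHomModule W.toRightHomModule v w))) =
        tmul V.toRightHomModule W.toRightHomModule (V.twist.symm v) (W.twist.symm w) := by
  have h₁ := V.sum_counit_cosnd v (fun a =>
    tmul V.toRightHomModule W.toRightHomModule a (W.twist.symm w)) {}
  have h₂ := fun i => W.sum_counit_cosnd w (fun b =>
    tmul V.toRightHomModule W.toRightHomModule (V.cofst v i) b) {}
  simp only [← h₂, Finset.smul_sum, smul_smul] at h₁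
  simpa using h₁

/-- The condition for W is used with parameter h₂, then the condition for V with parameter h₁.
Coassociativity regroups the factors of h before, between and after: the first regrouping brings
together the factors meeting w, the second those meeting v. -/
theorem sum_tensor_yetter_drinfeld (v : V.carrier) (w : W.carrier) (h : H) :
    ∑ x, ∑ j, ∑ d, ∑ a, tmul V.toRightHomModule W.toRightHomModule
        (V.act (V.cofst v j) (𝓗.fst (𝓗.twist.symm (𝓗.fst h x)) a))
        (W.act (W.cofst w d) (𝓗.snd (𝓗.twist.symm (𝓗.fst h x)) a)) ⊗ₜ[k]
          𝓗.mul (𝓗.twist (V.cosnd v j))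
            (𝓗.mul (W.cosnd w d) (𝓗.twist.symm (𝓗.twist.symm (𝓗.snd h x)))) =
      ∑ x, ∑ a, ∑ j, ∑ d, tmul V.toRightHomModule W.toRightHomModule
        (V.cofst (V.act v (𝓗.fst (𝓗.snd h x) a)) j)
        (W.cofst (W.act w (𝓗.snd (𝓗.snd h x) a)) d) ⊗ₜ[k]
          𝓗.mul (𝓗.twist.symm (𝓗.fst h x))
            (𝓗.mul (𝓗.twist.symm (V.cosnd (V.act v (𝓗.fst (𝓗.snd h x) a)) j))
              (𝓗.twist.symm (W.cosnd (W.act w (𝓗.snd (𝓗.snd h x) a)) d))) := by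
  -- The chosen decomposition of Δ(α⁻¹(h₁)) is exchanged for the image under α⁻¹ of that of Δ(h₁).
  have h₀ := fun x => 𝓗.sum_comul_eq (X := _) (T := fun a b => ∑ d, ∑ j,
    tmul V.toRightHomModule W.toRightHomModule (V.act (V.cofst v j) a) (W.act (W.cofst w d) b) ⊗ₜ[k]
      𝓗.mul (𝓗.twist (V.cosnd v j))
        (𝓗.mul (W.cosnd w d) (𝓗.twist.symm (𝓗.twist.symm (𝓗.snd h x))))) {}
    (a := fun i => 𝓗.twist.symm (𝓗.fst (𝓗.fst h x) i))
    (b := fun i => 𝓗.twist.symm (𝓗.snd (𝓗.fst h x) i))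
    ((𝓗.comul_twist_symm (𝓗.fst h x)).trans (by simp))
  have h₁ := 𝓗.sum_comul_fst h (fun a b c => ∑ d, ∑ j,
    tmul V.toRightHomModule W.toRightHomModule (V.act (V.cofst v j) (𝓗.twist.symm a))
      (W.act (W.cofst w d) (𝓗.twist.symm b)) ⊗ₜ[k] 𝓗.mul (𝓗.twist (V.cosnd v j))
        (𝓗.mul (W.cosnd w d) (𝓗.twist.symm (𝓗.twist.symm c)))) {}
  have h₂ := fun x => W.sum_coact_act w (𝓗.snd h x) (fun m y => ∑ j,
    tmul V.toRightHomModule W.toRightHomModule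
      (V.act (V.cofst v j) (𝓗.twist.symm (𝓗.twist.symm (𝓗.fst h x)))) m ⊗ₜ[k]
        𝓗.mul (𝓗.twist (V.cosnd v j)) y) {}
  have h₃ := 𝓗.sum_comul_fst_twist_symm h (fun a b c => ∑ d, ∑ j,
    tmul V.toRightHomModule W.toRightHomModule (V.act (V.cofst v j) (𝓗.twist.symm a))
      (W.cofst (W.act w c) d) ⊗ₜ[k] 𝓗.mul (𝓗.twist (V.cosnd v j))
        (𝓗.mul (𝓗.twist.symm b) (𝓗.twist.symm (W.cosnd (W.act w c) d))))
    -- Linearity in `c` must be supplied, since the summands use chosen factors of the coaction of w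
    -- ◁ c.
    ⟨fun _ _ => {}, fun _ _ => {}, fun a b => (W.lin_sum_coact (T := fun m y => ∑ j,
      tmul V.toRightHomModule W.toRightHomModule (V.act (V.cofst v j) (𝓗.twist.symm a)) m ⊗ₜ[k]
        𝓗.mul (𝓗.twist (V.cosnd v j)) (𝓗.mul (𝓗.twist.symm b) (𝓗.twist.symm y))) {}).comp
          (W.act w)⟩
  have h₄ := fun x => V.sum_coact_act v (𝓗.fst h x) (fun m y => ∑ d,
    tmul V.toRightHomModule W.toRightHomModule m
      (W.cofst (W.act w (𝓗.twist.symm (𝓗.snd h x))) d) ⊗ₜ[k]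
        𝓗.mul y (W.cosnd (W.act w (𝓗.twist.symm (𝓗.snd h x))) d)) {}
  have h₅ := 𝓗.sum_comul_fst_twist_symm h (fun a b c => ∑ j, ∑ d,
    tmul V.toRightHomModule W.toRightHomModule (V.cofst (V.act v b) j)
      (W.cofst (W.act w c) d) ⊗ₜ[k] 𝓗.mul a
        (𝓗.mul (𝓗.twist.symm (V.cosnd (V.act v b) j))
          (𝓗.twist.symm (W.cosnd (W.act w c) d))))
    ⟨fun _ _ => {}, fun a c => (V.lin_sum_coact (T := fun m y => ∑ d,
      tmul V.toRightHomModule W.toRightHomModule m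
      (W.cofst (W.act w c) d) ⊗ₜ[k] 𝓗.mul a (𝓗.mul (𝓗.twist.symm y)
          (𝓗.twist.symm (W.cosnd (W.act w c) d)))) {}).comp (V.act v),
      fun a b => Lin₁.sum fun j => (W.lin_sum_coact (T := fun m y =>
        tmul V.toRightHomModule W.toRightHomModule (V.cofst (V.act v b) j) m ⊗ₜ[k] 𝓗.mul a
        (𝓗.mul (𝓗.twist.symm (V.cosnd (V.act v b) j)) (𝓗.twist.symm y))) {}).comp
          (W.act w)⟩
  simp only [LinearEquiv.symm_apply_apply] at h₁
  simp only [𝓗.mul_mul, LinearEquiv.apply_symm_apply] at h₄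
  refine Eq.trans (Finset.sum_congr rfl fun x _ => ?_) (h₁.trans ((Finset.sum_congr rfl
    fun x _ => (h₂ x).symm).trans (h₃.symm.trans ((Finset.sum_congr rfl fun x _ =>
      (Finset.sum_congr rfl fun _ _ => Finset.sum_comm).trans (h₄ x).symm).trans h₅))))
  rw [← h₀ x]
  exact (Finset.sum_congr rfl fun _ _ => Finset.sum_comm).trans (Finset.sum_comm.trans
    (Finset.sum_congr rfl fun _ _ => Finset.sum_comm))

theorem tensor_yetter_drinfeld_tmul (v : V.carrier) (w : W.carrier) (h : H) :
    TensorProduct.map₂ (RightHomModule.tensor V.toRightHomModule W.toRightHomModule).act 𝓗.mul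
      (tensorCoact V W (tmul V.toRightHomModule W.toRightHomModule v w))
        (TensorProduct.map 𝓗.twist.symm.toLinearMap 𝓗.twist.symm.toLinearMap (𝓗.comul h)) =
      (𝓗.twist.symm.toLinearMap ∘ₗ TensorProduct.lift 𝓗.mul.flip).lTensor _
        (TensorProduct.assoc k _ H H
          ((tensorCoact V W ∘ₗ (RightHomModule.tensor V.toRightHomModule W.toRightHomModule).act
            (tmul V.toRightHomModule W.toRightHomModule v w)).rTensor H
              (TensorProduct.comm k H H (𝓗.comul h)))) := by
  have := sum_tensor_yetter_drinfeld V W v w h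
  simpa using this

end

end YetterDrinfeldHomModule

/-! ### Tensor products, unit and constraints with coactions -/

namespace YetterDrinfeldHomModule

variable {k H : Type u} [CommRing k] [AddCommGroup H] [Module k H]
  {𝓗 : MonoidalHomHopfAlgebra k H}

attribute [local simp] TensorProduct.sum_tmul TensorProduct.tmul_sum LinearMap.sum_apply

open RightHomModule (tmul tensor_induction tensor_ext tensor_ext₃ trivial unitEquiv tensorMap
  assocHom leftUnitHom rightUnitHom associatorIso leftUnitorIso rightUnitorIso)

/-- The tensor product over `k` with the diagonal action and coaction. -/
@[reducible]
noncomputable def tensor (V W : YetterDrinfeldHomModule 𝓗) : YetterDrinfeldHomModule 𝓗 where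
  toRightHomModule := RightHomModule.tensor V.toRightHomModule W.toRightHomModule
  coact := tensorCoact V W
  coact_twist x := by
    induction x using tensor_induction with
    | zero => simp
    | tmul v w => rw [RightHomModule.twist_tmul, tensorCoact_tmul_eq, V.coact_twist, W.coact_twist]; simp; exact Finset.sum_comm
    | add x y hx hy => simp only [map_add, hx, hy]
  coact_coassoc x := by
    induction x using tensor_induction with
    | zero => simp
    | tmul v w => exact tensorCoact_coassoc_tmul V W v w
    | add x y hx hy => simp only [map_add, hx, hy]
  coact_counit x := by
    induction x using tensor_induction with
    | zero => simp
    | tmul v w => exact tensorCoact_counit_tmul V W v w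
    | add x y hx hy => simp only [map_add, hx, hy]
  yetter_drinfeld x h := by
    induction x using tensor_induction with
    | zero => simp
    | tmul v w => exact tensor_yetter_drinfeld_tmul V W v w h
    | add x y hx hy =>
      simp only [map_add, LinearMap.comp_add, LinearMap.rTensor_add, LinearMap.add_apply, hx, hy]

variable (𝓗) in
/-- The ground ring with the trivial action and coaction. -/
@[reducible]
noncomputable def unitObject : YetterDrinfeldHomModule 𝓗 where
  toRightHomModule := trivial 𝓗
  coact := (TensorProduct.mk k (trivial 𝓗).carrier H).flip 𝓗.one
  coact_twist x := by simp
  coact_coassoc x := by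
    have : ((trivial 𝓗).twist.symm x) = x := rfl
    simp [this]
  coact_counit x := by
    have : ((trivial 𝓗).twist.symm x) = x := rfl
    simp [this]
  yetter_drinfeld x h := by
    -- Both sides of the Yetter-Drinfel'd condition equal x ⊗ α⁻¹(h), one by each counit axiom.
    have h₁ := 𝓗.sum_counit_fst h (fun a => x ⊗ₜ[k] a) {}
    have h₂ := 𝓗.sum_counit_snd h (fun a => x ⊗ₜ[k] a) {}
    simpa [TensorProduct.smul_tmul'] using h₁.trans h₂.symm

section

variable {V V' W W' : YetterDrinfeldHomModule 𝓗}

theorem coact_tmul_eq (v : V.carrier) (w : W.carrier) :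
    (tensor V W).coact (tmul V.toRightHomModule W.toRightHomModule v w) =
      TensorProduct.map₂ (tmul V.toRightHomModule W.toRightHomModule) 𝓗.mul (V.coact v)
        (W.coact w) := rfl

theorem coact_unitObject (x : (trivial 𝓗).carrier) :
    (unitObject 𝓗).coact x = x ⊗ₜ[k] 𝓗.one := rfl

end

/-- The tensor product of two morphisms. -/
noncomputable def tensorHom {V V' W W' : YetterDrinfeldHomModule 𝓗} (f : V ⟶ V') (g : W ⟶ W') :
    tensor V W ⟶ tensor V' W' :=
  homMk (tensorMap (underlying f) (underlying g)) fun x => by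
    induction x using tensor_induction with
    | zero => simp
    | tmul v w =>
      rw [RightHomModule.tensorMap_tmul]
      refine (coact_tmul_eq _ _).trans ?_
      rw [coact_lin, coact_lin, coact_tmul_eq, V.coact_eq_sum, W.coact_eq_sum]
      simp
    | add x y hx hy => simp only [map_add, hx, hy]

/-- The associativity constraint. -/
noncomputable def associatorYD (U V W : YetterDrinfeldHomModule 𝓗) :
    tensor (tensor U V) W ≅ tensor U (tensor V W) :=
  isoMk (associatorIso U.toRightHomModule V.toRightHomModule W.toRightHomModule) <|
    LinearMap.congr_fun (f := (tensor U (tensor V W)).coact ∘ₗ RightHomModule.Hom.lin (assocHom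
        U.toRightHomModule V.toRightHomModule W.toRightHomModule))
      (g := (RightHomModule.Hom.lin (assocHom U.toRightHomModule V.toRightHomModule
        W.toRightHomModule)).rTensor H ∘ₗ (tensor (tensor U V) W).coact)
      (tensor_ext₃ fun u v w => by
        simp only [LinearMap.comp_apply, RightHomModule.assocHom_tmul]
        rw [coact_tmul_eq, coact_tmul_eq, coact_tmul_eq, coact_tmul_eq, U.coact_twist,
          W.coact_twist_symm]
        simp)

/-- The left unit constraint. -/
noncomputable def leftUnitorYD (V : YetterDrinfeldHomModule 𝓗) :
    tensor (unitObject 𝓗) V ≅ V :=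
  isoMk (leftUnitorIso V.toRightHomModule) fun x => by
    induction x using tensor_induction with
    | zero => simp
    | tmul x v =>
      rw [coact_tmul_eq, coact_unitObject]
      simp [Finset.smul_sum, TensorProduct.smul_tmul']
    | add x y hx hy => simp only [map_add, hx, hy]

/-- The right unit constraint. -/
noncomputable def rightUnitorYD (V : YetterDrinfeldHomModule 𝓗) :
    tensor V (unitObject 𝓗) ≅ V :=
  isoMk (rightUnitorIso V.toRightHomModule) fun x => by
    induction x using tensor_induction with
    | zero => simp
    | tmul v x =>
      rw [coact_tmul_eq, coact_unitObject]
      simp [Finset.smul_sum, TensorProduct.smul_tmul']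
    | add x y hx hy => simp only [map_add, hx, hy]

noncomputable instance : MonoidalCategoryStruct (YetterDrinfeldHomModule 𝓗) where
  tensorObj := tensor
  whiskerLeft V _ _ f := tensorHom (𝟙 V) f
  whiskerRight f V := tensorHom f (𝟙 V)
  tensorHom := tensorHom
  tensorUnit := unitObject 𝓗
  associator := associatorYD
  leftUnitor := leftUnitorYD
  rightUnitor := rightUnitorYD

/-- The constraints have those of right Hom-modules as underlying maps, so faithfulness of the
forgetful functor transfers every axiom. -/
noncomputable instance : MonoidalCategory (YetterDrinfeldHomModule 𝓗) :=
  MonoidalCategory.ofTensorHom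
    (id_tensorHom_id := fun V W => forget_map_injective
      (id_tensorHom_id V.toRightHomModule W.toRightHomModule))
    (id_tensorHom := fun _ _ _ _ => rfl)
    (tensorHom_id := fun _ _ => rfl)
    (tensorHom_comp_tensorHom := fun f₁ f₂ g₁ g₂ => forget_map_injective
      (tensorHom_comp_tensorHom (underlying f₁) (underlying f₂) (underlying g₁) (underlying g₂)))
    (associator_naturality := fun f₁ f₂ f₃ => forget_map_injective
      (associator_naturality (underlying f₁) (underlying f₂) (underlying f₃)))
    (leftUnitor_naturality := fun f => forget_map_injective
      (leftUnitor_naturality (underlying f)))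
    (rightUnitor_naturality := fun f => forget_map_injective
      (rightUnitor_naturality (underlying f)))
    (pentagon := fun W X Y Z => forget_map_injective (MonoidalCategory.pentagon
      W.toRightHomModule X.toRightHomModule Y.toRightHomModule Z.toRightHomModule))
    (triangle := fun X Y => forget_map_injective
      (MonoidalCategory.triangle X.toRightHomModule Y.toRightHomModule))

variable (𝓗) in
/-- The tensor category of Yetter-Drinfel'd Hom-modules has the diagonal tensor product. -/
noncomputable def yetterDrinfeldTensor : YetterDrinfeldTensor 𝓗 where
  τ V W := tmul V.toRightHomModule W.toRightHomModule
  τ_bijective V W := RightHomModule.tmul_bijective V.toRightHomModule W.toRightHomModule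
  twist_τ _ _ _ _ := rfl
  act_τ V W := RightHomModule.act_tmul_eq_lift V.toRightHomModule W.toRightHomModule
  unit := unitEquiv 𝓗
  twist_unit _ := rfl
  act_unit := RightHomModule.act_unitEquiv
  map_τ _ _ _ _ := rfl
  associator_τ _ _ _ _ _ _ := rfl
  leftUnitor_τ _ _ _ := rfl
  rightUnitor_τ _ _ _ := rfl
  coact_τ _ _ _ _ := rfl
  coact_unit _ := rfl

end YetterDrinfeldHomModule

/-! ## Bicovariant Hom-bimodules -/

namespace BicovariantHomBimodule

variable {k H : Type u} [CommRing k] [AddCommGroup H] [Module k H]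
  {𝓗 : MonoidalHomHopfAlgebra k H}

attribute [local simp] TensorProduct.sum_tmul TensorProduct.tmul_sum LinearMap.sum_apply

section

variable (M : BicovariantHomBimodule 𝓗)

/-- The number of terms in `σ(m) = m₍[0]₎ ⊗ m₍[1]₎`. -/
noncomputable def rcorank (m : M.carrier) : ℕ := tensorRank (M.rcoact m)

/-- The left factors `m₍[0]₎` in `σ(m) = m₍[0]₎ ⊗ m₍[1]₎`. -/
noncomputable def rcofst (m : M.carrier) : Fin (M.rcorank m) → M.carrier := tensorFst (M.rcoact m)

/-- The right factors `m₍[1]₎` in `σ(m) = m₍[0]₎ ⊗ m₍[1]₎`. -/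
noncomputable def rcosnd (m : M.carrier) : Fin (M.rcorank m) → H := tensorSnd (M.rcoact m)

@[simp low]
theorem rcoact_eq_sum (m : M.carrier) : M.rcoact m = ∑ i, M.rcofst m i ⊗ₜ[k] M.rcosnd m i :=
  eq_sum_tensor _

@[simp]
theorem rcoact_twist' (m : M.carrier) : M.rcoact (M.twist m) =
    TensorProduct.map M.twist.toLinearMap 𝓗.twist.toLinearMap (M.rcoact m) := M.rcoact_twist m

@[simp]
theorem rcoact_twist_symm (m : M.carrier) : M.rcoact (M.twist.symm m) =
    TensorProduct.map M.twist.symm.toLinearMap 𝓗.twist.symm.toLinearMap (M.rcoact m) := by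
  obtain ⟨m, rfl⟩ := M.twist.surjective m
  simp

@[simp]
theorem rcoact_lact (h : H) (m : M.carrier) : M.rcoact (M.lact h m) =
    TensorProduct.map₂ M.lact 𝓗.mul (𝓗.comul h) (M.rcoact m) := by
  obtain ⟨m, rfl⟩ := M.twist.surjective m
  have := M.right_covariant (𝓗.twist.symm h) m 𝓗.one
  rw [𝓗.twist_one, M.ract_one, M.twist_lact, LinearEquiv.apply_symm_apply, 𝓗.comul_one] at this
  rw [this, M.rcoact_twist, M.rcoact_eq_sum]
  simp only [map_sum, LinearMap.sum_apply, TensorProduct.map_tmul, TensorProduct.map₂_apply_tmul,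
    LinearEquiv.coe_coe, 𝓗.mul_one, M.ract_one]

@[simp]
theorem rcoact_ract (m : M.carrier) (h : H) : M.rcoact (M.ract m h) =
    TensorProduct.map₂ M.ract 𝓗.mul (M.rcoact m) (𝓗.comul h) := by
  obtain ⟨m, rfl⟩ := M.twist.surjective m
  obtain ⟨h, rfl⟩ := 𝓗.twist.surjective h
  have := M.right_covariant 𝓗.one m h
  rw [M.one_lact, 𝓗.twist_one, 𝓗.comul_one] at this
  rw [this, M.rcoact_twist, 𝓗.comul_twist, M.rcoact_eq_sum, 𝓗.comul_eq_sum]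
  simp only [map_sum, LinearMap.sum_apply, TensorProduct.map_tmul, TensorProduct.map₂_apply_tmul,
    LinearEquiv.coe_coe, 𝓗.one_mul, M.one_lact, 𝓗.twist_mul, M.twist_ract]

end

/-- A morphism of left-covariant Hom-bimodules that is right colinear. -/
def homMk {M N : BicovariantHomBimodule 𝓗}
    (f : M.toLeftCovariantHomBimodule ⟶ N.toLeftCovariantHomBimodule)
    (hf : ∀ m, N.rcoact (LeftCovariantHomBimodule.Hom.lin f m) =
      (LeftCovariantHomBimodule.Hom.lin f).rTensor H (M.rcoact m)) : M ⟶ N :=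
  ⟨f, hf⟩

theorem forget_map_injective {M N : BicovariantHomBimodule 𝓗} {f g : M ⟶ N}
    (h : (forget 𝓗).map f = (forget 𝓗).map g) : f = g :=
  Hom.ext (congrArg LeftCovariantHomBimodule.Hom.lin h)

/-- An isomorphism of left-covariant Hom-bimodules that is right colinear. -/
def isoMk {M N : BicovariantHomBimodule 𝓗}
    (f : M.toLeftCovariantHomBimodule ≅ N.toLeftCovariantHomBimodule)
    (hf : ∀ m, N.rcoact (LeftCovariantHomBimodule.Hom.lin f.hom m) =
      (LeftCovariantHomBimodule.Hom.lin f.hom).rTensor H (M.rcoact m)) : M ≅ N where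
  hom := homMk f.hom hf
  inv := homMk f.inv fun n => by
    have h₁ : LeftCovariantHomBimodule.Hom.lin f.inv ∘ₗ LeftCovariantHomBimodule.Hom.lin f.hom =
      LinearMap.id := congrArg LeftCovariantHomBimodule.Hom.lin f.hom_inv_id
    have h₂ : LeftCovariantHomBimodule.Hom.lin f.hom (LeftCovariantHomBimodule.Hom.lin f.inv n) =
      n := LinearMap.congr_fun (congrArg LeftCovariantHomBimodule.Hom.lin f.inv_hom_id) n
    conv_rhs => rw [← h₂, hf, ← LinearMap.rTensor_comp_apply, h₁, LinearMap.rTensor_id_apply]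
  hom_inv_id := forget_map_injective f.hom_inv_id
  inv_hom_id := forget_map_injective f.inv_hom_id

/-- The underlying morphism of left-covariant Hom-bimodules. -/
def underlying {M N : BicovariantHomBimodule 𝓗} (f : M ⟶ N) :
    M.toLeftCovariantHomBimodule ⟶ N.toLeftCovariantHomBimodule := f.toHom

@[simp]
theorem rcoact_lin {M N : BicovariantHomBimodule 𝓗} (f : M ⟶ N) (m : M.carrier) :
    N.rcoact (LeftCovariantHomBimodule.Hom.lin (underlying f) m) =
      (LeftCovariantHomBimodule.Hom.lin (underlying f)).rTensor H (M.rcoact m) := f.map_rcoact m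

end BicovariantHomBimodule

/-! ## The free bicovariant Hom-bimodule -/

namespace YetterDrinfeldHomModule

variable {k H : Type u} [CommRing k] [AddCommGroup H] [Module k H]
  {𝓗 : MonoidalHomHopfAlgebra k H}

attribute [local simp] TensorProduct.sum_tmul TensorProduct.tmul_sum LinearMap.sum_apply

open RightHomModule (freeMk freeDesc free_induction)

variable (V : YetterDrinfeldHomModule 𝓗)

/-- `(v ◁ α(h₂))₍₀₎ ⊗ h₁α⁻¹((v ◁ α(h₂))₍₁₎) = v₍₀₎ ◁ h₁ ⊗ v₍₁₎h₂`. -/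
theorem sum_coact_act_twist {X : Type*} [AddCommGroup X] [Module k X] (v : V.carrier) (h : H)
    (T : V.carrier → H → X) (hT : Lin₂ k T) :
    ∑ i, ∑ j, T (V.cofst (V.act v (𝓗.twist (𝓗.snd h i))) j) (𝓗.mul (𝓗.fst h i)
      (𝓗.twist.symm (V.cosnd (V.act v (𝓗.twist (𝓗.snd h i))) j))) =
        ∑ i, ∑ j, T (V.act (V.cofst v j) (𝓗.fst h i)) (𝓗.mul (V.cosnd v j) (𝓗.snd h i)) := by
  obtain ⟨L, hL⟩ := hT.exists_lift
  have := congrArg L (V.yetter_drinfeld v (𝓗.twist h))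
  simp [hL] at this
  rw [← this]

/-- The right coaction `σ(g ⊗ v) = (g₁ ⊗ v₍₀₎) ⊗ g₂v₍₁₎`. -/
noncomputable def freeCoact : V.toRightHomModule.free.carrier →ₗ[k]
    V.toRightHomModule.free.carrier ⊗[k] H :=
  freeDesc ((TensorProduct.map₂ V.toRightHomModule.freeMk 𝓗.mul).compl₁₂ 𝓗.comul V.coact)

@[simp]
theorem freeCoact_freeMk (g : H) (v : V.carrier) :
    V.freeCoact (V.toRightHomModule.freeMk g v) =
      TensorProduct.map₂ V.toRightHomModule.freeMk 𝓗.mul (𝓗.comul g) (V.coact v) := rfl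

theorem freeCoact_twist (m : V.toRightHomModule.free.carrier) :
    V.freeCoact (V.toRightHomModule.free.twist m) =
      TensorProduct.map V.toRightHomModule.free.twist.toLinearMap 𝓗.twist.toLinearMap
        (V.freeCoact m) := by
  induction m using free_induction with
  | zero => simp
  | tmul g v =>
    simp
  | add x y hx hy => simp only [map_add, hx, hy]

theorem freeCoact_counit (m : V.toRightHomModule.free.carrier) :
    TensorProduct.rid k _ (𝓗.counit.lTensor _ (V.freeCoact m)) =
      V.toRightHomModule.free.twist.symm m := by
  induction m using free_induction with
  | zero => simp
  | tmul g v =>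
    have h₁ := 𝓗.sum_counit_snd g (fun a => V.toRightHomModule.freeMk a (V.twist.symm v)) {}
    have h₂ := fun i => V.sum_counit_cosnd v (fun b => V.toRightHomModule.freeMk (𝓗.fst g i) b) {}
    simp only [← h₂, Finset.smul_sum, smul_smul] at h₁
    simp
    exact Finset.sum_comm.trans h₁
  | add x y hx hy => simp only [map_add, hx, hy]

/-- Coassociativity of H for g followed by coassociativity of V for v, up to the order of summation.
-/
theorem freeCoact_coassoc (m : V.toRightHomModule.free.carrier) :
    TensorProduct.map V.toRightHomModule.free.twist.symm.toLinearMap 𝓗.comul (V.freeCoact m) =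
      TensorProduct.assoc k _ H H
        (TensorProduct.map V.freeCoact 𝓗.twist.symm.toLinearMap (V.freeCoact m)) := by
  induction m using free_induction with
  | zero => simp
  | tmul g v =>
    have h₁ := 𝓗.sum_comul_fst_twist_symm g (fun a b c => ∑ i, ∑ j,
      V.toRightHomModule.freeMk a (V.cofst (V.cofst v i) j) ⊗ₜ[k]
        (𝓗.mul b (V.cosnd (V.cofst v i) j) ⊗ₜ[k] 𝓗.mul c (𝓗.twist.symm (V.cosnd v i)))) {}
    have h₂ := fun i j => V.sum_coact_fst v (fun a b c =>
      V.toRightHomModule.freeMk (𝓗.twist.symm (𝓗.fst g i)) a ⊗ₜ[k]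
        (𝓗.mul (𝓗.fst (𝓗.snd g i) j) b ⊗ₜ[k]
          𝓗.mul (𝓗.snd (𝓗.snd g i) j) (𝓗.twist.symm c))) {}
    simp only [LinearEquiv.symm_apply_apply] at h₂
    have h₃ := h₁.trans (Finset.sum_congr rfl fun i _ => Finset.sum_congr rfl fun j _ => h₂ i j)
    simp
    refine Eq.trans ?_ (h₃.symm.trans ?_)
    · exact (Finset.sum_congr rfl fun _ _ => Finset.sum_congr rfl fun _ _ =>
        Finset.sum_comm).trans (Finset.sum_comm.trans
          (Finset.sum_congr rfl fun _ _ => Finset.sum_comm))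
    · exact (Finset.sum_congr rfl fun _ _ => Finset.sum_comm).trans (Finset.sum_comm.trans
        (Finset.sum_congr rfl fun _ _ => Finset.sum_congr rfl fun _ _ => Finset.sum_comm))
  | add x y hx hy => simp only [map_add, hx, hy]

theorem freeCoact_lact (h : H) (m : V.toRightHomModule.free.carrier) :
    V.freeCoact (V.toRightHomModule.free.lact h m) =
      TensorProduct.map₂ V.toRightHomModule.free.lact 𝓗.mul (𝓗.comul h) (V.freeCoact m) := by
  induction m using free_induction with
  | zero => simp
  | tmul g v =>
    simp
  | add x y hx hy => simp only [map_add, hx, hy]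

/-- The place where the Yetter-Drinfel'd condition enters. The left side contains h₁₂ times the
second factor of the coaction of v ◁ h₂; coassociativity makes both parts come from h₂, the
condition replaces them by v₍₀₎ ◁ h₂₁ and v₍₁₎h₂₂, and coassociativity is undone. -/
theorem freeCoact_ract (m : V.toRightHomModule.free.carrier) (h : H) :
    V.freeCoact (V.toRightHomModule.free.ract m h) =
      TensorProduct.map₂ V.toRightHomModule.free.ract 𝓗.mul (V.freeCoact m) (𝓗.comul h) := by
  induction m using free_induction with
  | zero => simp
  | tmul g v =>
    have h₁ := 𝓗.sum_comul_fst h (fun a b c => ∑ i, ∑ j,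
      V.toRightHomModule.freeMk (𝓗.mul (𝓗.fst g j) a) (V.cofst (V.act v c) i) ⊗ₜ[k]
        𝓗.mul (𝓗.twist (𝓗.snd g j)) (𝓗.mul b (𝓗.twist.symm (V.cosnd (V.act v c) i))))
      ⟨fun _ _ => {}, fun _ _ => {}, fun a b => (V.lin_sum_coact (T := fun m y => ∑ j,
        V.toRightHomModule.freeMk (𝓗.mul (𝓗.fst g j) a) m ⊗ₜ[k]
          𝓗.mul (𝓗.twist (𝓗.snd g j)) (𝓗.mul b (𝓗.twist.symm y))) {}).comp (V.act v)⟩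
    have h₂ := fun x => V.sum_coact_act_twist v (𝓗.snd h x) (fun m y => ∑ j,
      V.toRightHomModule.freeMk (𝓗.mul (𝓗.fst g j) (𝓗.twist.symm (𝓗.fst h x))) m ⊗ₜ[k]
        𝓗.mul (𝓗.twist (𝓗.snd g j)) y) {}
    have h₃ := 𝓗.sum_comul_fst_twist_symm h (fun a b c => ∑ i, ∑ j,
      V.toRightHomModule.freeMk (𝓗.mul (𝓗.fst g j) a) (V.act (V.cofst v i) b) ⊗ₜ[k]
        𝓗.mul (𝓗.twist (𝓗.snd g j)) (𝓗.mul (V.cosnd v i) c)) {}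
    have h₄ := h₁.trans ((Finset.sum_congr rfl fun x _ => h₂ x).trans h₃.symm)
    simp
    refine (Finset.sum_congr rfl fun _ _ => Finset.sum_comm).trans (h₄.trans ?_)
    exact Finset.sum_congr rfl fun _ _ => Finset.sum_comm.trans
      (Finset.sum_congr rfl fun _ _ => Finset.sum_comm)
  | add x y hx hy => simp only [map_add, LinearMap.add_apply, hx, hy]

/-- Only coassociativity of H is used: the left coaction does not split v, and the right one splits
it once on either side. -/
theorem freeCoact_hom_commutative (m : V.toRightHomModule.free.carrier) :
    V.freeCoact.lTensor H (V.toRightHomModule.free.lcoact m) =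
      TensorProduct.map 𝓗.twist.toLinearMap (𝓗.twist.symm.toLinearMap.lTensor _)
        (TensorProduct.assoc k H _ H
          (V.toRightHomModule.free.lcoact.rTensor H (V.freeCoact m))) := by
  induction m using free_induction with
  | zero => simp
  | tmul g v =>
    have := 𝓗.sum_comul_fst_twist_symm g (fun a b c => ∑ j, 𝓗.twist (𝓗.twist a) ⊗ₜ[k]
      (V.toRightHomModule.freeMk b (V.twist.symm (V.cofst v j)) ⊗ₜ[k]
        𝓗.mul c (𝓗.twist.symm (V.cosnd v j)))) {}
    simp only [LinearEquiv.apply_symm_apply] at this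
    simp
    refine (Finset.sum_congr rfl fun _ _ => Finset.sum_comm).trans (this.symm.trans ?_)
    exact (Finset.sum_congr rfl fun _ _ => Finset.sum_comm).trans Finset.sum_comm
  | add x y hx hy => simp only [map_add, hx, hy]

end YetterDrinfeldHomModule

section

variable {k H : Type u} [CommRing k] [AddCommGroup H] [Module k H]
  {𝓗 : MonoidalHomHopfAlgebra k H}

attribute [local simp] TensorProduct.sum_tmul TensorProduct.tmul_sum LinearMap.sum_apply

/-- The bicovariant Hom-bimodule `H ⊗ V`. -/
@[reducible]
noncomputable def YetterDrinfeldHomModule.free (V : YetterDrinfeldHomModule 𝓗) :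
    BicovariantHomBimodule 𝓗 where
  toLeftCovariantHomBimodule := V.toRightHomModule.free
  rcoact := V.freeCoact
  rcoact_twist := V.freeCoact_twist
  rcoact_coassoc := V.freeCoact_coassoc
  rcoact_counit := V.freeCoact_counit
  right_covariant h m g := by
    rw [V.freeCoact_ract, V.freeCoact_lact, 𝓗.comul_twist, 𝓗.comul_twist]
    generalize V.freeCoact m = t
    induction t using TensorProduct.induction_on with
    | zero => simp
    | tmul m a => simp
    | add x y hx hy => simp only [map_add, LinearMap.add_apply, hx, hy]
  hom_commutative := V.freeCoact_hom_commutative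

/-! ## The Yetter-Drinfel'd Hom-module of coinvariants -/

namespace BicovariantHomBimodule

variable (M : BicovariantHomBimodule 𝓗)

/-- The restriction of the right coaction to the left Hom-coinvariants. -/
noncomputable def coinvariantsCoact : M.toLeftCovariantHomBimodule.coinvariants.carrier →ₗ[k]
    M.toLeftCovariantHomBimodule.coinvariants.carrier ⊗[k] H :=
  M.proj.rTensor H ∘ₗ M.rcoact ∘ₗ M.incl

theorem coinvariantsCoact_apply (v : M.toLeftCovariantHomBimodule.coinvariants.carrier) :
    M.coinvariantsCoact v = M.proj.rTensor H (M.rcoact (M.incl v)) := rfl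

/-- Hom-commutativity expresses (P_L ⊗ id)σ(m) through m₍₋₁₎ ⊗ σ(m₍₀₎). For coinvariant m the latter
is 1 ⊗ σ(μ⁻¹(m)), so P_L ⊗ id fixes σ(m). -/
theorem rTensor_leftProjection_rcoact (m : M.carrier) :
    (leftProjection M.toLeftCovariantHomBimodule).rTensor H (M.rcoact m) =
      (TensorProduct.lift (M.lact ∘ₗ 𝓗.antipode ∘ₗ 𝓗.twist.symm.toLinearMap)).rTensor H
        ((TensorProduct.assoc k H M.carrier H).symm
          ((𝓗.twist.toLinearMap.lTensor M.carrier).lTensor H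
            (M.rcoact.lTensor H (M.lcoact m)))) := by
  rw [M.hom_commutative]
  simp [LeftCovariantHomBimodule.leftProjection_apply]

theorem rTensor_incl_coinvariantsCoact
    (v : M.toLeftCovariantHomBimodule.coinvariants.carrier) :
    M.incl.rTensor H (M.coinvariantsCoact v) = M.rcoact (M.incl v) := by
  have h : M.incl ∘ₗ M.proj = leftProjection M.toLeftCovariantHomBimodule := rfl
  rw [coinvariantsCoact_apply, ← LinearMap.rTensor_comp_apply, h, rTensor_leftProjection_rcoact,
    LeftCovariantHomBimodule.lcoact_incl, LeftCovariantHomBimodule.incl_twist_symm]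
  simp

theorem proj_comp_incl : M.proj ∘ₗ M.incl = LinearMap.id :=
  LinearMap.ext M.toLeftCovariantHomBimodule.proj_incl

/-- P_L splits the inclusion of the coinvariants, so injectivity survives tensoring without any
flatness. Identities in the coinvariants may thus be checked inside M. -/
theorem rTensor_incl_injective (Y : Type u) [AddCommGroup Y] [Module k Y] :
    Function.Injective (M.incl.rTensor Y) := fun x y h => by
  have := congrArg (M.proj.rTensor Y) h
  simpa only [← LinearMap.rTensor_comp_apply, proj_comp_incl, LinearMap.rTensor_id_apply] using this

theorem coinvariantsCoact_twist (v : M.toLeftCovariantHomBimodule.coinvariants.carrier) :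
    M.coinvariantsCoact (M.toLeftCovariantHomBimodule.coinvariants.twist v) =
      TensorProduct.map M.toLeftCovariantHomBimodule.coinvariants.twist.toLinearMap
        𝓗.twist.toLinearMap (M.coinvariantsCoact v) := by
  simp [coinvariantsCoact_apply, LeftCovariantHomBimodule.proj_twist]

theorem coinvariantsCoact_twist_symm (v : M.toLeftCovariantHomBimodule.coinvariants.carrier) :
    M.coinvariantsCoact (M.toLeftCovariantHomBimodule.coinvariants.twist.symm v) =
      TensorProduct.map M.toLeftCovariantHomBimodule.coinvariants.twist.symm.toLinearMap
        𝓗.twist.symm.toLinearMap (M.coinvariantsCoact v) := by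
  simp [coinvariantsCoact_apply, LeftCovariantHomBimodule.proj_twist_symm]

theorem coinvariantsCoact_counit (v : M.toLeftCovariantHomBimodule.coinvariants.carrier) :
    TensorProduct.rid k _ (𝓗.counit.lTensor _ (M.coinvariantsCoact v)) =
      M.toLeftCovariantHomBimodule.coinvariants.twist.symm v := by
  have := congrArg M.proj (M.rcoact_counit (M.incl v))
  rw [← LeftCovariantHomBimodule.incl_twist_symm, LeftCovariantHomBimodule.proj_incl] at this
  rw [← this, coinvariantsCoact_apply]
  simp

theorem rTensor_incl_assoc_coinvariantsCoact
    (t : M.toLeftCovariantHomBimodule.coinvariants.carrier ⊗[k] H) :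
    M.incl.rTensor (H ⊗[k] H) (TensorProduct.assoc k _ H H
      (TensorProduct.map M.coinvariantsCoact 𝓗.twist.symm.toLinearMap t)) =
        TensorProduct.assoc k _ H H
          (TensorProduct.map M.rcoact 𝓗.twist.symm.toLinearMap (M.incl.rTensor H t)) := by
  induction t using TensorProduct.induction_on with
  | zero => simp
  | tmul v h =>
    rw [TensorProduct.map_tmul, LinearMap.rTensor_tmul, TensorProduct.map_tmul,
      ← rTensor_incl_coinvariantsCoact]
    generalize M.coinvariantsCoact v = s
    induction s using TensorProduct.induction_on with
    | zero => simp
    | tmul w g => simp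
    | add x y hx hy => simp only [map_add, TensorProduct.add_tmul, hx, hy]
  | add x y hx hy => simp only [map_add, hx, hy]

theorem coinvariantsCoact_coassoc (v : M.toLeftCovariantHomBimodule.coinvariants.carrier) :
    TensorProduct.map M.toLeftCovariantHomBimodule.coinvariants.twist.symm.toLinearMap 𝓗.comul
        (M.coinvariantsCoact v) =
      TensorProduct.assoc k _ H H
        (TensorProduct.map M.coinvariantsCoact 𝓗.twist.symm.toLinearMap
          (M.coinvariantsCoact v)) := by
  refine M.rTensor_incl_injective _ ?_
  rw [rTensor_incl_assoc_coinvariantsCoact, rTensor_incl_coinvariantsCoact, ← M.rcoact_coassoc,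
    ← rTensor_incl_coinvariantsCoact]
  generalize M.coinvariantsCoact v = t
  induction t using TensorProduct.induction_on with
  | zero => simp
  | tmul w h => rfl
  | add x y hx hy => simp only [map_add, hx, hy]

/-- In σ(vh) = σ(v)Δ(h) the first factor of σ(v) is coinvariant, and P_L turns its right action into
◁. -/
theorem rTensor_proj_rcoact_ract (v : M.toLeftCovariantHomBimodule.coinvariants.carrier) (h : H) :
    M.proj.rTensor H (M.rcoact (M.ract (M.incl v) h)) =
      TensorProduct.map₂ M.toLeftCovariantHomBimodule.coinvariants.act 𝓗.mul
        (M.coinvariantsCoact v) (𝓗.comul h) := by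
  rw [rcoact_ract, ← rTensor_incl_coinvariantsCoact]
  generalize M.coinvariantsCoact v = t
  induction t using TensorProduct.induction_on with
  | zero => simp
  | tmul w g => simp [LeftCovariantHomBimodule.proj_ract_incl]
  | add x y hx hy => simp only [map_add, LinearMap.add_apply, hx, hy]

/-- In Δ(h)σ(v) the projection turns h₁ into ε(h₁), so only α⁻¹(h) remains, acting on the second
factor. -/
theorem rTensor_proj_rcoact_lact (h : H)
    (v : M.toLeftCovariantHomBimodule.coinvariants.carrier) :
    M.proj.rTensor H (M.rcoact (M.lact h (M.incl v))) =
      TensorProduct.map M.toLeftCovariantHomBimodule.coinvariants.twist.toLinearMap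
        (𝓗.mul (𝓗.twist.symm h)) (M.coinvariantsCoact v) := by
  rw [rcoact_lact, ← rTensor_incl_coinvariantsCoact]
  generalize M.coinvariantsCoact v = t
  induction t using TensorProduct.induction_on with
  | zero => simp
  | tmul w g =>
    have := 𝓗.sum_counit_fst h (fun a =>
      M.toLeftCovariantHomBimodule.coinvariants.twist w ⊗ₜ[k] 𝓗.mul a g) {}
    simpa [TensorProduct.smul_tmul'] using this
  | add x y hx hy => simp only [map_add, hx, hy]

/-- Both sides are (P_L ⊗ id)σ(vα⁻¹(h)). Right covariance gives the left one; expanding the product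
by vh = α(h₁)(ν⁻¹(v) ◁ h₂), here with α⁻¹(h) for h, and using left linearity gives the right one. -/
theorem coinvariants_yetter_drinfeld (v : M.toLeftCovariantHomBimodule.coinvariants.carrier)
    (h : H) :
    TensorProduct.map₂ M.toLeftCovariantHomBimodule.coinvariants.act 𝓗.mul (M.coinvariantsCoact v)
        (TensorProduct.map 𝓗.twist.symm.toLinearMap 𝓗.twist.symm.toLinearMap (𝓗.comul h)) =
      (𝓗.twist.symm.toLinearMap ∘ₗ TensorProduct.lift 𝓗.mul.flip).lTensor _
        (TensorProduct.assoc k _ H H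
          ((M.coinvariantsCoact ∘ₗ M.toLeftCovariantHomBimodule.coinvariants.act v).rTensor H
            (TensorProduct.comm k H H (𝓗.comul h)))) := by
  rw [← 𝓗.comul_twist_symm, ← rTensor_proj_rcoact_ract, LeftCovariantHomBimodule.ract_incl,
    𝓗.comul_twist_symm]
  generalize 𝓗.comul h = t
  induction t using TensorProduct.induction_on with
  | zero => simp
  | tmul a b =>
    simp only [TensorProduct.map_tmul, TensorProduct.lift.tmul, LinearMap.compl₂_apply,
      LinearMap.comp_apply, LinearEquiv.coe_coe, LinearEquiv.apply_symm_apply,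
      rTensor_proj_rcoact_lact, TensorProduct.comm_tmul, LinearMap.rTensor_tmul]
    rw [← RightHomModule.twist_symm_act, coinvariantsCoact_twist_symm]
    generalize M.coinvariantsCoact _ = s
    induction s using TensorProduct.induction_on with
    | zero => simp
    | tmul w g => simp
    | add x y hx hy => simp only [map_add, TensorProduct.add_tmul, hx, hy]
  | add x y hx hy => simp only [map_add, hx, hy]

/-- The Yetter-Drinfel'd Hom-module of left Hom-coinvariants. -/
@[reducible]
noncomputable def coinvariants : YetterDrinfeldHomModule 𝓗 where
  toRightHomModule := M.toLeftCovariantHomBimodule.coinvariants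
  coact := M.coinvariantsCoact
  coact_twist := M.coinvariantsCoact_twist
  coact_coassoc := M.coinvariantsCoact_coassoc
  coact_counit := M.coinvariantsCoact_counit
  yetter_drinfeld := M.coinvariants_yetter_drinfeld

end BicovariantHomBimodule

/-! ### Right colinearity of the functors, the unit and the counit -/

open RightHomModule LeftCovariantHomBimodule

theorem YetterDrinfeldHomModule.freeCoact_freeMap {V W : YetterDrinfeldHomModule 𝓗} (f : V ⟶ W)
    (m : V.toRightHomModule.free.carrier) :
    W.freeCoact (LeftCovariantHomBimodule.Hom.lin (freeMap (underlying f)) m) =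
      (LeftCovariantHomBimodule.Hom.lin (freeMap (underlying f))).rTensor H (V.freeCoact m) := by
  induction m using free_induction with
  | zero => simp
  | tmul g v => simp
  | add x y hx hy => simp only [map_add, hx, hy]

theorem BicovariantHomBimodule.coinvariantsCoact_coinvariantsMap {M N : BicovariantHomBimodule 𝓗}
    (f : M ⟶ N) (v : M.toLeftCovariantHomBimodule.coinvariants.carrier) :
    N.coinvariantsCoact (RightHomModule.Hom.lin (coinvariantsMap (underlying f)) v) =
      (RightHomModule.Hom.lin (coinvariantsMap (underlying f))).rTensor H
        (M.coinvariantsCoact v) := by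
  refine N.rTensor_incl_injective _ ?_
  rw [rTensor_incl_coinvariantsCoact, incl_coinvariantsMap, rcoact_lin,
    ← rTensor_incl_coinvariantsCoact, ← LinearMap.rTensor_comp_apply,
    ← LinearMap.rTensor_comp_apply]
  congr 2
  exact LinearMap.ext fun w => (incl_coinvariantsMap (underlying f) w).symm

theorem BicovariantHomBimodule.rcoact_counitHom (M : BicovariantHomBimodule 𝓗)
    (m : M.toLeftCovariantHomBimodule.coinvariants.free.carrier) :
    M.rcoact (LeftCovariantHomBimodule.Hom.lin (counitHom M.toLeftCovariantHomBimodule) m) =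
      (LeftCovariantHomBimodule.Hom.lin (counitHom M.toLeftCovariantHomBimodule)).rTensor H
        (M.coinvariants.freeCoact m) := by
  induction m using free_induction with
  | zero => simp
  | tmul g v =>
    rw [counitHom_freeMk, rcoact_lact, ← rTensor_incl_coinvariantsCoact]
    refine Eq.trans ?_ (congrArg _ (M.coinvariants.freeCoact_freeMk g v).symm)
    change _ = LinearMap.rTensor H _ (TensorProduct.map₂ _ _ _ (M.coinvariantsCoact v))
    generalize M.coinvariantsCoact v = t
    induction t using TensorProduct.induction_on with
    | zero => simp
    | tmul w a => simp
    | add x y hx hy => simp only [map_add, hx, hy]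
  | add x y hx hy => simp only [map_add, hx, hy]

theorem YetterDrinfeldHomModule.coinvariantsCoact_unitHom (V : YetterDrinfeldHomModule 𝓗)
    (v : V.carrier) :
    V.free.coinvariantsCoact (RightHomModule.Hom.lin (unitHom V.toRightHomModule) v) =
      (RightHomModule.Hom.lin (unitHom V.toRightHomModule)).rTensor H (V.coact v) := by
  refine V.free.rTensor_incl_injective _ ?_
  rw [BicovariantHomBimodule.rTensor_incl_coinvariantsCoact, incl_unitHom]
  simp

end

/-! ## The right coaction of the transported tensor product -/

section

variable {k A B C X : Type*} [CommRing k] [AddCommGroup A] [Module k A] [AddCommGroup B]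
  [Module k B] [AddCommGroup C] [Module k C] [AddCommGroup X] [Module k X]

/-- The left factors in `δ(a) = a₍₀₎ ⊗ a₍₁₎`. -/
noncomputable def valueFst (δ : A →ₗ[k] B ⊗[k] C) (a : A) : Fin (tensorRank (δ a)) → B :=
  tensorFst (δ a)

/-- The right factors in `δ(a) = a₍₀₎ ⊗ a₍₁₎`. -/
noncomputable def valueSnd (δ : A →ₗ[k] B ⊗[k] C) (a : A) : Fin (tensorRank (δ a)) → C :=
  tensorSnd (δ a)

/-- The number of terms in `δ(a) = a₍₀₎ ⊗ a₍₁₎`. -/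
noncomputable def valueRank (δ : A →ₗ[k] B ⊗[k] C) (a : A) : ℕ := tensorRank (δ a)

/-- Sweedler notation for an arbitrary linear map into a tensor product, needed where coactions
occur only as families over abstract categories. -/
theorem apply_eq_sum (δ : A →ₗ[k] B ⊗[k] C) (a : A) :
    δ a = ∑ i : Fin (valueRank δ a), valueFst δ a i ⊗ₜ[k] valueSnd δ a i := eq_sum_tensor _

theorem lin_sum_value (δ : A →ₗ[k] B ⊗[k] C) {T : B → C → X} (hT : Lin₂ k T) :
    Lin₁ k fun a => ∑ i : Fin (valueRank δ a), T (valueFst δ a i) (valueSnd δ a i) := by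
  have : (fun a => ∑ i : Fin (valueRank δ a), T (valueFst δ a i) (valueSnd δ a i)) =
      TensorProduct.lift hT.toLinearMap ∘ₗ δ := by
    ext a; simp [apply_eq_sum δ]
  rw [this]
  exact ⟨map_add _, map_smul _⟩

end

section

variable {k H : Type u} [CommRing k] [AddCommGroup H] [Module k H]
  {𝓗 : MonoidalHomHopfAlgebra k H}

attribute [local simp] TensorProduct.sum_tmul TensorProduct.tmul_sum LinearMap.sum_apply

theorem RightHomModule.sum_value_act (V : RightHomModule 𝓗)
    {δ : V.carrier →ₗ[k] V.carrier ⊗[k] H}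
    (hδ : ∀ n h, TensorProduct.map₂ V.act 𝓗.mul (δ n)
        (TensorProduct.map 𝓗.twist.symm.toLinearMap 𝓗.twist.symm.toLinearMap (𝓗.comul h)) =
      (𝓗.twist.symm.toLinearMap ∘ₗ TensorProduct.lift 𝓗.mul.flip).lTensor V.carrier
        (TensorProduct.assoc k V.carrier H H
          ((δ ∘ₗ V.act n).rTensor H (TensorProduct.comm k H H (𝓗.comul h)))))
    {X : Type*} [AddCommGroup X] [Module k X] (v : V.carrier) (h : H)
    (T : V.carrier → H → X) (hT : Lin₂ k T) :
    ∑ i, ∑ j : Fin (valueRank δ (V.act v (𝓗.twist (𝓗.snd h i)))),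
      T (valueFst δ (V.act v (𝓗.twist (𝓗.snd h i))) j) (𝓗.mul (𝓗.fst h i)
        (𝓗.twist.symm (valueSnd δ (V.act v (𝓗.twist (𝓗.snd h i))) j))) =
      ∑ i, ∑ j : Fin (valueRank δ v), T (V.act (valueFst δ v j) (𝓗.fst h i))
        (𝓗.mul (valueSnd δ v j) (𝓗.snd h i)) := by
  obtain ⟨L, hL⟩ := hT.exists_lift
  have := congrArg L (hδ v (𝓗.twist h))
  simp [hL, apply_eq_sum δ] at this
  rw [← this]

/-- The pattern of `freeCoact_ract`, coassociativity, Yetter-Drinfel'd condition, coassociativity,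
isolated with an arbitrary trilinear Φ for use in the colinearity of φ₂. -/
theorem RightHomModule.sum_comul_value_act (V : RightHomModule 𝓗)
    {δ : V.carrier →ₗ[k] V.carrier ⊗[k] H}
    (hδ : ∀ n h, TensorProduct.map₂ V.act 𝓗.mul (δ n)
        (TensorProduct.map 𝓗.twist.symm.toLinearMap 𝓗.twist.symm.toLinearMap (𝓗.comul h)) =
      (𝓗.twist.symm.toLinearMap ∘ₗ TensorProduct.lift 𝓗.mul.flip).lTensor V.carrier
        (TensorProduct.assoc k V.carrier H H
          ((δ ∘ₗ V.act n).rTensor H (TensorProduct.comm k H H (𝓗.comul h)))))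
    {X : Type*} [AddCommGroup X] [Module k X] (v : V.carrier) (h : H)
    (Φ : H →ₗ[k] V.carrier →ₗ[k] H →ₗ[k] X) :
    ∑ i, ∑ j, ∑ l : Fin (valueRank δ (V.act v (𝓗.snd h i))),
      Φ (𝓗.fst (𝓗.fst h i) j) (valueFst δ (V.act v (𝓗.snd h i)) l)
        (𝓗.mul (𝓗.snd (𝓗.fst h i) j) (𝓗.twist.symm (valueSnd δ (V.act v (𝓗.snd h i)) l))) =
      ∑ i, ∑ j, ∑ l : Fin (valueRank δ v),
        Φ (𝓗.fst (𝓗.fst h i) j) (V.act (valueFst δ v l) (𝓗.snd (𝓗.fst h i) j))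
          (𝓗.mul (valueSnd δ v l) (𝓗.twist.symm (𝓗.snd h i))) := by
  have h₁ := 𝓗.sum_comul_fst h (fun a b c => ∑ l : Fin (valueRank δ (V.act v c)),
    Φ a (valueFst δ (V.act v c) l) (𝓗.mul b (𝓗.twist.symm (valueSnd δ (V.act v c) l))))
    ⟨fun _ _ => {}, fun _ _ => {}, fun a b => (lin_sum_value δ (T := fun m y =>
      Φ a m (𝓗.mul b (𝓗.twist.symm y))) {}).comp (V.act v)⟩
  have h₂ := fun x => V.sum_value_act hδ v (𝓗.snd h x) (fun m y =>
    Φ (𝓗.twist.symm (𝓗.fst h x)) m y) {}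
  have h₃ := 𝓗.sum_comul_fst_twist_symm h (fun a b c => ∑ l : Fin (valueRank δ v),
    Φ a (V.act (valueFst δ v l) b) (𝓗.mul (valueSnd δ v l) c)) {}
  exact h₁.trans ((Finset.sum_congr rfl fun x _ => h₂ x).trans h₃.symm)

variable {C D : Type*} [Category* C] [Category* D] {U : C ⥤ RightHomModule 𝓗}
  {U' : D ⥤ LeftCovariantHomBimodule 𝓗} [MonoidalCategory C] (S : DiagonalTensor U)

/-- σ after φ₂ contains the coaction of ν⁻¹(v) ◁ h₂ multiplied by h₁₂; the Yetter-Drinfel'd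
condition for V rewrites this through v₍₀₎ and v₍₁₎, as in the product of σ(g ⊗ v) and σ(h ⊗ w). The
coaction of w is carried along unchanged. -/
theorem FreeFunctor.value_prod {F : C ⥤ D} (f : FreeFunctor U U' F)
    {δ : ∀ V : C, (U.obj V).carrier →ₗ[k] (U.obj V).carrier ⊗[k] H}
    {δ' : ∀ M : D, (U'.obj M).carrier →ₗ[k] (U'.obj M).carrier ⊗[k] H}
    (δ_twist : ∀ V v, δ V ((U.obj V).twist v) =
      TensorProduct.map (U.obj V).twist.toLinearMap 𝓗.twist.toLinearMap (δ V v))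
    (δ_act : ∀ V v h, TensorProduct.map₂ (U.obj V).act 𝓗.mul (δ V v)
        (TensorProduct.map 𝓗.twist.symm.toLinearMap 𝓗.twist.symm.toLinearMap (𝓗.comul h)) =
      (𝓗.twist.symm.toLinearMap ∘ₗ TensorProduct.lift 𝓗.mul.flip).lTensor (U.obj V).carrier
        (TensorProduct.assoc k (U.obj V).carrier H H
          ((δ V ∘ₗ (U.obj V).act v).rTensor H (TensorProduct.comm k H H (𝓗.comul h)))))
    (δ_τ : ∀ V W v w, δ (tensorObj V W) (S.τ V W v w) =
      TensorProduct.map₂ (S.τ V W) 𝓗.mul (δ V v) (δ W w))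
    (δ'_ι : ∀ V g v, δ' (F.obj V) (f.ι V g v) =
      TensorProduct.map₂ (f.ι V) 𝓗.mul (𝓗.comul g) (δ V v)) (V W : C) (a b) :
    δ' (F.obj (tensorObj V W)) (f.prod S V W a b) =
      TensorProduct.map₂ (f.prod S V W) 𝓗.mul (δ' (F.obj V) a) (δ' (F.obj W) b) := by
  have : (f.prod S V W).compr₂ (δ' (F.obj (tensorObj V W))) =
      (TensorProduct.map₂ (f.prod S V W) 𝓗.mul).compl₁₂ (δ' (F.obj V)) (δ' (F.obj W)) := by
    refine f.ext₂ fun g v h w => ?_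
    -- Replacing v by ν(v) removes the ν⁻¹ in φ₂.
    obtain ⟨v, rfl⟩ := (U.obj V).twist.surjective v
    simp only [LinearMap.compr₂_apply, LinearMap.compl₁₂_apply, δ'_ι, f.prod_ι, δ_twist,
      LinearEquiv.symm_apply_apply]
    simp [δ'_ι, f.prod_ι, δ_τ, apply_eq_sum (δ V), apply_eq_sum (δ W)]
    have h₄ := (U.obj V).sum_comul_value_act (δ_act V) v h (Lin₃.toLinearMap (T := fun a m y =>
      ∑ j : Fin (valueRank (δ W) w), ∑ l, f.ι (tensorObj V W) (𝓗.mul (𝓗.fst g l) (𝓗.twist a))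
        (S.τ V W m (valueFst (δ W) w j)) ⊗ₜ[k] 𝓗.mul (𝓗.twist (𝓗.snd g l))
          (𝓗.mul y (valueSnd (δ W) w j))) {})
    simp only [Lin₃.toLinearMap_apply, 𝓗.mul_mul] at h₄
    refine Eq.trans ?_ (h₄.trans ?_)
    · exact Finset.sum_congr rfl fun _ _ => (Finset.sum_congr rfl fun _ _ =>
        Finset.sum_comm).trans (Finset.sum_comm.trans (Finset.sum_congr rfl fun _ _ =>
          Finset.sum_comm))
    · refine Eq.trans (Finset.sum_congr rfl fun _ _ => ?_) Finset.sum_comm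
      refine (Finset.sum_congr rfl fun _ _ => Finset.sum_comm).trans (Finset.sum_comm.trans
        (Finset.sum_congr rfl fun _ _ => Finset.sum_comm.trans
          (Finset.sum_congr rfl fun _ _ => Finset.sum_comm)))
  exact LinearMap.congr_fun₂ this a b

end

section

variable {k H : Type u} [CommRing k] [AddCommGroup H] [Module k H]
  {𝓗 : MonoidalHomHopfAlgebra k H}

attribute [local simp] TensorProduct.sum_tmul TensorProduct.tmul_sum LinearMap.sum_apply

section

variable {C D : Type*} [Category* C] [Category* D] {U : C ⥤ RightHomModule 𝓗}
  {U' : D ⥤ LeftCovariantHomBimodule 𝓗} [MonoidalCategory C] (S : DiagonalTensor U)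
  {δ : ∀ V : C, (U.obj V).carrier →ₗ[k] (U.obj V).carrier ⊗[k] H}
  {δ' : ∀ M : D, (U'.obj M).carrier →ₗ[k] (U'.obj M).carrier ⊗[k] H}

theorem FreeFunctor.value_transportMk (e : C ≌ D) (f : FreeFunctor U U' e.functor)
    (h : ∀ V W a b, δ' (e.functor.obj (tensorObj V W)) (f.prod S V W a b) =
      TensorProduct.map₂ (f.prod S V W) 𝓗.mul (δ' (e.functor.obj V) a) (δ' (e.functor.obj W) b))
    (δ'_lin : ∀ {M N : D} (p : M ⟶ N) m,
      δ' N (LeftCovariantHomBimodule.Hom.lin (U'.map p) m) =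
        (LeftCovariantHomBimodule.Hom.lin (U'.map p)).rTensor H (δ' M m)) (M N : D) (m n) :
    δ' (e.functor.obj (e.inverse.obj M ⊗ e.inverse.obj N)) (f.transportMk e S M N m n) =
      TensorProduct.map₂ (f.transportMk e S M N) 𝓗.mul (δ' M m) (δ' N n) := by
  have h' : ∀ M m, δ' _ (counitInvLin U' e M m) = (counitInvLin U' e M).rTensor H (δ' M m) :=
    fun M m => δ'_lin _ m
  rw [transportMk_apply, h, h', h']
  generalize δ' M m = s
  generalize δ' N n = t
  induction s using TensorProduct.induction_on with
  | zero => simp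
  | tmul x a =>
    induction t using TensorProduct.induction_on with
    | zero => simp
    | tmul y b => simp [transportMk_apply]
    | add x y hx hy => simp only [map_add, hx, hy]
  | add x y hx hy => simp only [map_add, LinearMap.add_apply, hx, hy]

theorem FreeFunctor.value_unitEquiv {F : C ⥤ D} (f : FreeFunctor U U' F)
    (δ'_ι : ∀ V g v, δ' (F.obj V) (f.ι V g v) =
      TensorProduct.map₂ (f.ι V) 𝓗.mul (𝓗.comul g) (δ V v))
    (δ_unit : δ (𝟙_ C) (S.unit 1) = S.unit 1 ⊗ₜ[k] 𝓗.one) (h : H) :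
    δ' (F.obj (𝟙_ C)) (f.unitEquiv S h) =
      (f.unitEquiv S).toLinearMap.rTensor H (𝓗.comul h) := by
  rw [unitEquiv_apply, δ'_ι, δ_unit]
  simp

end

open YetterDrinfeldHomModule BicovariantHomBimodule

/-! ## The equivalence of Yetter-Drinfel'd Hom-modules and bicovariant Hom-bimodules -/

variable (𝓗) in
/-- The functor `V ↦ H ⊗ V` on Yetter-Drinfel'd Hom-modules. -/
noncomputable def bicovariantFreeFunctor :
    YetterDrinfeldHomModule 𝓗 ⥤ BicovariantHomBimodule 𝓗 where
  obj V := V.free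
  map f := BicovariantHomBimodule.homMk (RightHomModule.freeMap (YetterDrinfeldHomModule.underlying f))
    (freeCoact_freeMap f)
  map_id V := BicovariantHomBimodule.forget_map_injective
    ((freeFunctor 𝓗).map_id V.toRightHomModule)
  map_comp f g := BicovariantHomBimodule.forget_map_injective
    ((freeFunctor 𝓗).map_comp (YetterDrinfeldHomModule.underlying f)
      (YetterDrinfeldHomModule.underlying g))

variable (𝓗) in
/-- The functor of left Hom-coinvariants on bicovariant Hom-bimodules. -/
noncomputable def bicovariantCoinvariantsFunctor :
    BicovariantHomBimodule 𝓗 ⥤ YetterDrinfeldHomModule 𝓗 where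
  obj M := M.coinvariants
  map f := YetterDrinfeldHomModule.homMk (LeftCovariantHomBimodule.coinvariantsMap
    (BicovariantHomBimodule.underlying f)) (coinvariantsCoact_coinvariantsMap f)
  map_id M := YetterDrinfeldHomModule.forget_map_injective
    ((coinvariantsFunctor 𝓗).map_id M.toLeftCovariantHomBimodule)
  map_comp f g := YetterDrinfeldHomModule.forget_map_injective
    ((coinvariantsFunctor 𝓗).map_comp (BicovariantHomBimodule.underlying f)
      (BicovariantHomBimodule.underlying g))

variable (𝓗) in
/-- `H ⊗ -` and `^{coH}(-)` are mutually inverse equivalences. -/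
noncomputable def bicovariantFreeEquivalence :
    YetterDrinfeldHomModule 𝓗 ≌ BicovariantHomBimodule 𝓗 where
  functor := bicovariantFreeFunctor 𝓗
  inverse := bicovariantCoinvariantsFunctor 𝓗
  -- Naturality and the triangle identity are inherited from `freeEquivalence 𝓗` by faithfulness;
  -- only colinearity of the components is new.
  unitIso := NatIso.ofComponents (fun V => YetterDrinfeldHomModule.isoMk (W := V.free.coinvariants)
      V.toRightHomModule.unitEquivalence V.coinvariantsCoact_unitHom)
    fun f => YetterDrinfeldHomModule.forget_map_injective
      ((freeEquivalence 𝓗).unitIso.hom.naturality (YetterDrinfeldHomModule.underlying f))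
  counitIso := NatIso.ofComponents (fun M => BicovariantHomBimodule.isoMk (M := M.coinvariants.free)
      M.toLeftCovariantHomBimodule.counitEquiv M.rcoact_counitHom)
    fun f => BicovariantHomBimodule.forget_map_injective
      ((freeEquivalence 𝓗).counitIso.hom.naturality (BicovariantHomBimodule.underlying f))
  functor_unitIso_comp V := BicovariantHomBimodule.forget_map_injective
    ((freeEquivalence 𝓗).functor_unitIso_comp V.toRightHomModule)

variable (𝓗) in
/-- `H ⊗ -` is the free functor on Yetter-Drinfel'd Hom-modules. -/
noncomputable def bicovariantFreeFunctorData :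
    YetterDrinfeldFreeFunctor (bicovariantFreeEquivalence 𝓗).functor where
  ι V := V.toRightHomModule.freeMk
  ι_bijective V := V.toRightHomModule.freeMk_bijective
  twist_ι _ _ _ := rfl
  lact_ι _ _ _ _ := rfl
  ract_ι V := V.toRightHomModule.ract_freeMk_eq_lift
  lcoact_ι V := V.toRightHomModule.lcoact_freeMk_eq_map
  map_ι _ _ _ := rfl
  rcoact_ι _ _ _ := rfl

variable (𝓗) in
/-- `^{coH}(-)` is the functor of coinvariants on bicovariant Hom-bimodules. -/
noncomputable def bicovariantCoinvariantsFunctorData :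
    BicovariantCoinvariantsFunctor (bicovariantFreeEquivalence 𝓗).inverse where
  κ M := M.toLeftCovariantHomBimodule.incl
  κ_injective M := M.toLeftCovariantHomBimodule.incl_injective
  κ_range M := M.toLeftCovariantHomBimodule.incl_range
  κ_twist _ _ := rfl
  κ_act _ _ _ := rfl
  κ_map f := LeftCovariantHomBimodule.incl_coinvariantsMap (BicovariantHomBimodule.underlying f)
  κ_coact M v := (M.rTensor_incl_coinvariantsCoact v).symm

/-- The coaction of a Yetter-Drinfel'd Hom-module. -/
def coaction (V : YetterDrinfeldHomModule 𝓗) :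
    ((YetterDrinfeldHomModule.forget 𝓗).obj V).carrier →ₗ[k]
      ((YetterDrinfeldHomModule.forget 𝓗).obj V).carrier ⊗[k] H := V.coact

/-- The right coaction of a bicovariant Hom-bimodule. -/
def rightCoaction (M : BicovariantHomBimodule 𝓗) :
    ((BicovariantHomBimodule.forget 𝓗).obj M).carrier →ₗ[k]
      ((BicovariantHomBimodule.forget 𝓗).obj M).carrier ⊗[k] H := M.rcoact

variable (𝓗) in
/-- The tensor category of bicovariant Hom-bimodules. -/
noncomputable def bicovariantTensor :
    letI := Monoidal.transport (bicovariantFreeEquivalence 𝓗)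
    BicovariantTensor 𝓗 :=
  letI := Monoidal.transport (bicovariantFreeEquivalence 𝓗)
  { (bicovariantFreeFunctorData 𝓗).transport (bicovariantFreeEquivalence 𝓗)
      (yetterDrinfeldTensor 𝓗).toDiagonalTensor with
    rcoact_τ := (bicovariantFreeFunctorData 𝓗).value_transportMk
      (yetterDrinfeldTensor 𝓗).toDiagonalTensor (δ' := rightCoaction)
      (bicovariantFreeEquivalence 𝓗) ((bicovariantFreeFunctorData 𝓗).value_prod
        (yetterDrinfeldTensor 𝓗).toDiagonalTensor (δ := coaction)
        (δ' := rightCoaction) (fun V => V.coact_twist) (fun V => V.yetter_drinfeld)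
        (yetterDrinfeldTensor 𝓗).coact_τ (bicovariantFreeFunctorData 𝓗).rcoact_ι)
      (fun p => BicovariantHomBimodule.rcoact_lin p)
    rcoact_unit := (bicovariantFreeFunctorData 𝓗).value_unitEquiv
      (yetterDrinfeldTensor 𝓗).toDiagonalTensor (δ := coaction)
      (δ' := rightCoaction) (bicovariantFreeFunctorData 𝓗).rcoact_ι
      ((yetterDrinfeldTensor 𝓗).coact_unit 1) }

end

theorem mainTheorem2 {k H : Type u} [CommRing k] [AddCommGroup H] [Module k H]
    (𝓗 : MonoidalHomHopfAlgebra k H) :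
    (∃ (_ : MonoidalCategory (RightHomModule 𝓗))
        (_ : MonoidalCategory (LeftCovariantHomBimodule 𝓗))
        (S : DiagonalTensor (𝟭 (RightHomModule 𝓗)))
        (T : BalancedTensor (𝟭 (LeftCovariantHomBimodule 𝓗)))
        (e : RightHomModule 𝓗 ≌ LeftCovariantHomBimodule 𝓗)
        (f : FreeFunctor (𝟭 _) (𝟭 _) e.functor)
        (g : CoinvariantsFunctor (𝟭 _) (𝟭 _) e.inverse),
        IsTensorEquivalence S T e f g) ∧
    (∃ (_ : MonoidalCategory (YetterDrinfeldHomModule 𝓗))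
        (_ : MonoidalCategory (BicovariantHomBimodule 𝓗))
        (S : YetterDrinfeldTensor 𝓗)
        (T : BicovariantTensor 𝓗)
        (e : YetterDrinfeldHomModule 𝓗 ≌ BicovariantHomBimodule 𝓗)
        (f : YetterDrinfeldFreeFunctor e.functor)
        (g : BicovariantCoinvariantsFunctor e.inverse),
        IsTensorEquivalence S.toDiagonalTensor T.toBalancedTensor e f.toFreeFunctor
          g.toCoinvariantsFunctor) := by
  refine ⟨⟨inferInstance, Monoidal.transport (freeEquivalence 𝓗), RightHomModule.diagonalTensor,
    (freeFunctorData 𝓗).transport (freeEquivalence 𝓗) RightHomModule.diagonalTensor,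
    freeEquivalence 𝓗, freeFunctorData 𝓗, coinvariantsFunctorData 𝓗, ?_⟩,
    ⟨inferInstance, Monoidal.transport (bicovariantFreeEquivalence 𝓗),
    YetterDrinfeldHomModule.yetterDrinfeldTensor 𝓗, bicovariantTensor 𝓗,
    bicovariantFreeEquivalence 𝓗, bicovariantFreeFunctorData 𝓗,
    bicovariantCoinvariantsFunctorData 𝓗, ?_⟩⟩
  -- The counit was defined by h ⊗ m ↦ hm, so its formula holds by definition.
  · exact FreeFunctor.isTensorEquivalence_transport _ _ _ _ fun _ _ _ => rfl
  · exact FreeFunctor.isTensorEquivalence_transport _ _ _ _ fun _ _ _ => rfl
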